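/- **Conventions.** All spaces are over $\mathbb C$. A superalgebra is a $\mathbb Z_2$-graded vector space $L=L_0\oplus L_1$ with a bilinear product satisfying $[L_\alpha,L_\beta]\subseteq L_{\alpha+\beta}$; it is a *Leibniz superalgebra* if $[x,[y,z]]=[[x,y],z]-(-1)^{\alpha\beta}[[x,z],y]$ for all $x\in L$, $y\in L_\alpha$, $z\in L_\beta$. Isomorphisms are linear bijections preserving grading and product. Put $L^1=L$, $L^{k+1}=[L^k,L]$; the nilindex of a nilpotent $L$ is the least $s$ with $L^s=0$. For $x\in L_0$ let $C_i(x)$ be the descending sequence of the sizes of the Jordan blocks of the nilpotent operator $R_x\colon z\mapsto[z,x]$ on $L_i$ ($i=0,1$). The characteristic sequence of $L$ is $\big(\max C_0(x)\mid\max C_1(x)\big)$, where both maxima are lexicographic and taken over $x\in L_0\setminus[L_0,L_0]$. Let $n\ge 1$, $m=n+2$, $k=n+2-\lfloor\frac{n+5}{2}\rfloor$. For $(\beta_{\lfloor\frac{n+5}{2}\rfloor},\dots,\beta_{n+1})\in\mathbb C^k$ let $L(\beta_{\lfloor\frac{n+5}{2}\rfloor},\dots,\beta_{n+1})$ be the superalgebra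 whose even part has basis $x_1,\dots,x_n$, whose odd part has basis $y_1,\dots,y_{n+2}$, and whose product is given by $$[x_i,x_1]=x_{i+1}\ (1\le i\le n-1),\qquad [y_j,x_1]=y_{j+1}\ (1\le j\le n),$$ $$[x_i,y_1]=\tfrac12y_{i+1}\ (1\le i\le n),\qquad [y_j,y_1]=x_j\ (1\le j\le n),$$ $$[x_i,y_{n+2}]=\sum_{r=\lfloor\frac{n+5}{2}\rfloor}^{n+2-i}\beta_r\,y_{r-1+i}\ \ (1\le i\le\lfloor\tfrac n2\rfloor),\qquad [y_j,y_{n+2}]=-2\sum_{r=\lfloor\frac{n+5}{2}\rfloor}^{n+2-j}\beta_r\,x_{r-2+j}\ \ (1\le j\le\lfloor\tfrac n2\rfloor),$$ all other products of basis vectors being zero. For $1\le j\le k$, $1\le s\le k+1-j$, $0\le r<j$ and $\alpha=(\alpha_1,\dots,\alpha_k)\in\mathbb C^k$ put $S_{r,j}=\cos\frac{2\pi r}{j}+i\sin\frac{2\pi r}{j}$ and let $$W_{s,k}(V^1_{j,k}(\alpha))=(0,\dots,0,1,0,\dots,0,1,S_{r,j}^{\,j+1}\alpha_{s+j+1},\dots,S_{r,j}^{\,k-s}\alpha_k)\in\mathbb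 C^k$$ be the vector with entry $1$ at the positions $s$ and $s+j$, entry $S_{r,j}^{\,p-s}\alpha_p$ at every position $p>s+j$, and entry $0$ elsewhere; for $s=k+1-j$ it is the vector whose only nonzero entry is a $1$ at position $s$. The vectors obtained from one $\alpha$ for $r=0,\dots,j-1$ count as one and the same entry of the list below; that is, the parameters $(\alpha_{s+j+1},\dots,\alpha_k)$ are taken up to the action $\alpha_p\mapsto S_{t,j}^{\,p-s}\alpha_p$, $0\le t<j$. **Theorem 3.5.** The superalgebras $$L\big(W_{s,k}(V^1_{j,k}(\alpha_1,\dots,\alpha_k))\big)\quad(1\le j\le k,\ 1\le s\le k+1-j,\ \alpha\in\mathbb C^k),\qquad L(0,\dots,0)$$ are Leibniz superalgebras with $\dim L_0=n$, $\dim L_1=m$, characteristic sequence $(n\mid m-1,1)$ and nilindex $n+m$. Every complex Leibniz superalgebra $L$ with $\dim L_0=n$, $\dim L_1=m=n+2$, characteristic sequence $(n\mid m-1,1)$ and nilindex $n+m$ is isomorphic to one of them. They are pairwise non-isomorphic: no member of the families is isomorphic to $L(0,\dots,0)$, and the members with data $(s,j,\alpha)$ and $(s',j',\alpha')$ (each formed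 with any admissible choice of the root of unity) are isomorphic if and only if $s=s'$, $j=j'$ and there is $t\in\{0,\dots,j-1\}$ with $\alpha'_p=S_{t,j}^{\,p-s}\alpha_p$ for all $s+j<p\le k$. -/

import Mathlib

/-- A complex superalgebra structure on `L`: a `ℤ₂`-grading `L = L₀ ⊕ L₁` and a bilinear product
`[-,-]` with `[L_α, L_β] ⊆ L_{α+β}`. -/
structure Superalgebra (L : Type*) [AddCommGroup L] [Module ℂ L] where
  bracket : L →ₗ[ℂ] L →ₗ[ℂ] L
  part : ZMod 2 → Submodule ℂ L
  isCompl : IsCompl (part 0) (part 1)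
  bracket_mem : ∀ (a b : ZMod 2) (x y : L), x ∈ part a → y ∈ part b →
    bracket x y ∈ part (a + b)

namespace Superalgebra

variable {L : Type*} [AddCommGroup L] [Module ℂ L]

/-- The graded Leibniz identity `[x,[y,z]] = [[x,y],z] - (-1)^{αβ} [[x,z],y]` for all `x`,
`y ∈ L_α` and `z ∈ L_β`. -/
def IsLeibniz (A : Superalgebra L) : Prop :=
  ∀ (a b : ZMod 2) (x y z : L), y ∈ A.part a → z ∈ A.part b →
    A.bracket x (A.bracket y z) =
      A.bracket (A.bracket x y) z
        - ((-1 : ℂ) ^ (a.val * b.val)) • A.bracket (A.bracket x z) y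

/-- Isomorphism of superalgebras: a linear bijection that preserves the grading and the product. -/
def Iso {L' : Type*} [AddCommGroup L'] [Module ℂ L'] (A : Superalgebra L)
    (B : Superalgebra L') : Prop :=
  ∃ f : L ≃ₗ[ℂ] L', (∀ (a : ZMod 2) (x : L), x ∈ A.part a → f x ∈ B.part a) ∧
    ∀ x y : L, f (A.bracket x y) = B.bracket (f x) (f y)

/-- The descending central sequence, `lower k = L^{k+1}`: `L^1 = L` and `L^{k+1} = [L^k, L]`
(the span of the products). -/
def lower (A : Superalgebra L) : ℕ → Submodule ℂ L
  | 0 => ⊤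
  | k + 1 => Submodule.map₂ A.bracket (lower A k) ⊤

/-- `L` is nilpotent and `s ≥ 1` is the least number with `L^s = 0`. -/
def HasNilindex (A : Superalgebra L) (s : ℕ) : Prop :=
  1 ≤ s ∧ A.lower (s - 1) = ⊥ ∧ ∀ t : ℕ, 1 ≤ t → t < s → A.lower (t - 1) ≠ ⊥

/-- Right multiplication `R_x : z ↦ [z, x]`. -/
def rightMul (A : Superalgebra L) (x : L) : L →ₗ[ℂ] L := A.bracket.flip x

/-- `N` restricts to a nilpotent endomorphism of `W` whose Jordan blocks have the sizes listed, in
descending order, in `c`: there is a basis `b` of `W`, made of one string of length `c_i` for every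
`i`, such that `N` moves every basis vector to the next one of its string and the last one to `0`. -/
def HasJordanBlocks (N : L →ₗ[ℂ] L) (W : Submodule ℂ L) (c : List ℕ) : Prop :=
  c.Pairwise (fun p q => q ≤ p) ∧ (∀ p ∈ c, 1 ≤ p) ∧
    ∃ b : Module.Basis ((i : Fin c.length) × Fin (c.get i)) ℂ W,
      ∀ (i : Fin c.length) (k : Fin (c.get i)),
        N (b ⟨i, k⟩ : L) =
          if h : k.val + 1 < c.get i then (b ⟨i, ⟨k.val + 1, h⟩⟩ : L) else 0

/-- The block sequences `C_i(x)` of the operators `R_x` on `L_i`, where `x` runs over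
`L₀ \ [L₀, L₀]`. -/
def blockSequences (A : Superalgebra L) (i : ZMod 2) : Set (List ℕ) :=
  {c | ∃ x : L, x ∈ A.part 0 ∧ x ∉ Submodule.map₂ A.bracket (A.part 0) (A.part 0) ∧
    HasJordanBlocks (A.rightMul x) (A.part i) c}

/-- The characteristic sequence of `L` is `(c₀ | c₁)`: the sequence `c_i` is the lexicographic
maximum of the `C_i(x)`, `x ∈ L₀ \ [L₀, L₀]` (the order of `List ℕ` is the lexicographic one). -/
def HasCharSeq (A : Superalgebra L) (c₀ c₁ : List ℕ) : Prop :=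
  IsGreatest (A.blockSequences 0) c₀ ∧ IsGreatest (A.blockSequences 1) c₁

/-- A Leibniz superalgebra with `dim L₀ = n`, `dim L₁ = m`, characteristic sequence
`(n | m - 1, 1)` and nilindex `n + m`. -/
def InClass (A : Superalgebra L) (n m : ℕ) : Prop :=
  A.IsLeibniz ∧ Module.Finite ℂ L ∧
    Module.finrank ℂ (A.part 0) = n ∧ Module.finrank ℂ (A.part 1) = m ∧
    A.HasCharSeq [n] [m - 1, 1] ∧ A.HasNilindex (n + m)

end Superalgebra

noncomputable section

namespace LeibnizFamily

/-- The space with basis `x_1, …, x_n, y_1, …, y_{n+2}`. -/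
abbrev Space (n : ℕ) : Type := Fin n ⊕ Fin (n + 2) → ℂ

/-- The basis vector `x_i`, `1 ≤ i ≤ n` (and `0` for any other `i`). -/
def x (n i : ℕ) : Space n := Sum.elim (fun a => if a.val + 1 = i then 1 else 0) (fun _ => 0)

/-- The basis vector `y_j`, `1 ≤ j ≤ n + 2` (and `0` for any other `j`). -/
def y (n j : ℕ) : Space n := Sum.elim (fun _ => 0) (fun a => if a.val + 1 = j then 1 else 0)

/-- The number `n + 2 - ⌊(n+5)/2⌋` of the parameters `β_{⌊(n+5)/2⌋}, …, β_{n+1}`. -/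
def numParams (n : ℕ) : ℕ := n + 2 - (n + 5) / 2

/-- The entry `β_k`, `⌊(n+5)/2⌋ ≤ k ≤ n + 1`, of the parameter vector
`β = (β_{⌊(n+5)/2⌋}, …, β_{n+1})`. -/
def entry {n : ℕ} (β : Fin (numParams n) → ℂ) (k : ℕ) : ℂ :=
  if h : k - (n + 5) / 2 < numParams n then β ⟨k - (n + 5) / 2, h⟩ else 0

/-- The products of the basis vectors; the indices of the vectors in the comments are
`i = a + 1` and `j = b + 1`. -/
def table {n : ℕ} (β : Fin (numParams n) → ℂ) :
    Fin n ⊕ Fin (n + 2) → Fin n ⊕ Fin (n + 2) → Space n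
  -- `[x_i, x_1] = x_{i+1}` for `i ≤ n - 1`
  | .inl a, .inl b =>
      if b.val + 1 = 1 ∧ a.val + 1 ≤ n - 1 then x n (a.val + 1 + 1) else 0
  -- `[y_i, x_1] = y_{i+1}` for `i ≤ n`
  | .inr a, .inl b =>
      if b.val + 1 = 1 ∧ a.val + 1 ≤ n then y n (a.val + 1 + 1) else 0
  -- `[x_i, y_1] = (1/2) y_{i+1}`, and `[x_i, y_{n+2}] = ∑ β_k y_{k-1+i}` for `i ≤ ⌊n/2⌋`
  | .inl a, .inr b =>
      if b.val + 1 = 1 then (1 / 2 : ℂ) • y n (a.val + 1 + 1)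
      else if b.val + 1 = n + 2 ∧ a.val + 1 ≤ n / 2 then
        ∑ k ∈ Finset.Icc ((n + 5) / 2) (n + 2 - (a.val + 1)),
          entry β k • y n (k - 1 + (a.val + 1))
      else 0
  -- `[y_i, y_1] = x_i` for `i ≤ n`, and `[y_i, y_{n+2}] = -2 ∑ β_k x_{k-2+i}` for `i ≤ ⌊n/2⌋`
  | .inr a, .inr b =>
      if b.val + 1 = 1 ∧ a.val + 1 ≤ n then x n (a.val + 1)
      else if b.val + 1 = n + 2 ∧ a.val + 1 ≤ n / 2 then
        (-2 : ℂ) • ∑ k ∈ Finset.Icc ((n + 5) / 2) (n + 2 - (a.val + 1)),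
          entry β k • x n (k - 2 + (a.val + 1))
      else 0

/-- The bilinear product with the given multiplication table. -/
def bracket {n : ℕ} (β : Fin (numParams n) → ℂ) : Space n →ₗ[ℂ] Space n →ₗ[ℂ] Space n :=
  (Pi.basisFun ℂ (Fin n ⊕ Fin (n + 2))).constr ℂ
    (fun p => (Pi.basisFun ℂ (Fin n ⊕ Fin (n + 2))).constr ℂ (table β p))

/-- The span of the `x_i`, written as the vectors without `y`-coordinates. -/
def evenPart (n : ℕ) : Submodule ℂ (Space n) where
  carrier := {v | ∀ b, v (Sum.inr b) = 0}
  add_mem' := by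
    intro u v hu hv b
    simp [hu b, hv b]
  zero_mem' := by
    intro b
    rfl
  smul_mem' := by
    intro c v hv b
    simp [hv b]

/-- The span of the `y_j`, written as the vectors without `x`-coordinates. -/
def oddPart (n : ℕ) : Submodule ℂ (Space n) where
  carrier := {v | ∀ a, v (Sum.inl a) = 0}
  add_mem' := by
    intro u v hu hv b
    simp [hu b, hv b]
  zero_mem' := by
    intro b
    rfl
  smul_mem' := by
    intro c v hv b
    simp [hv b]

def part (n : ℕ) (a : ZMod 2) : Submodule ℂ (Space n) := if a = 0 then evenPart n else oddPart n

theorem x_mem (n i : ℕ) : x n i ∈ evenPart n := fun _ => rfl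

theorem y_mem (n i : ℕ) : y n i ∈ oddPart n := fun _ => rfl

theorem part_zero (n : ℕ) : part n 0 = evenPart n := if_pos rfl

theorem part_one (n : ℕ) : part n 1 = oddPart n := if_neg (by decide)

theorem isCompl_part (n : ℕ) : IsCompl (part n 0) (part n 1) := by
  rw [part_zero, part_one]
  constructor
  · rw [Submodule.disjoint_def]
    intro v hv hv'
    funext t
    rcases t with a | b
    · exact hv' a
    · exact hv b
  · rw [codisjoint_iff, Submodule.eq_top_iff']
    intro v
    rw [Submodule.mem_sup]
    refine ⟨Sum.elim (fun a => v (.inl a)) (fun _ => 0), fun _ => rfl,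
      Sum.elim (fun _ => 0) (fun b => v (.inr b)), fun _ => rfl, ?_⟩
    funext t
    rcases t with a | b <;> simp

theorem bracket_apply {n : ℕ} (β : Fin (numParams n) → ℂ) (u v : Space n) :
    bracket β u v = ∑ p, ∑ q, (u p * v q) • table β p q := by
  simp [bracket, Module.Basis.constr_apply_fintype, LinearMap.sum_apply, Finset.smul_sum,
    smul_smul]

theorem table_mem {n : ℕ} (β : Fin (numParams n) → ℂ) (p q : Fin n ⊕ Fin (n + 2)) :
    table β p q ∈ if p.isLeft = q.isLeft then evenPart n else oddPart n := by
  rcases p with a | a <;> rcases q with b | b <;> simp only [table] <;> simp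
  · split_ifs
    · exact x_mem _ _
    · exact zero_mem _
  · split_ifs
    · exact Submodule.smul_mem _ _ (y_mem _ _)
    · exact Submodule.sum_mem _ fun k _ => Submodule.smul_mem _ _ (y_mem _ _)
    · exact zero_mem _
  · split_ifs
    · exact y_mem _ _
    · exact zero_mem _
  · split_ifs
    · exact x_mem _ _
    · exact neg_mem (Submodule.smul_mem _ _
        (Submodule.sum_mem _ fun k _ => Submodule.smul_mem _ _ (x_mem _ _)))
    · exact zero_mem _

theorem bracket_mem_part {n : ℕ} (β : Fin (numParams n) → ℂ) (a b : ZMod 2) (u v : Space n)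
    (hu : u ∈ part n a) (hv : v ∈ part n b) : bracket β u v ∈ part n (a + b) := by
  rw [bracket_apply]
  refine Submodule.sum_mem _ fun p _ => Submodule.sum_mem _ fun q _ => ?_
  have key := table_mem β p q
  have h2 : ∀ c : ZMod 2, c = 0 ∨ c = 1 := by decide
  have h11 : (1 : ZMod 2) + 1 = 0 := rfl
  obtain rfl | rfl := h2 a <;> obtain rfl | rfl := h2 b <;>
    simp only [h11, add_zero, zero_add, part_zero, part_one] at hu hv ⊢ <;>
    rcases p with p | p <;> rcases q with q | q <;>
    first
      | exact Submodule.smul_mem _ _ (by simpa using key)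
      | (have h := hu p; simp [h])
      | (have h := hv q; simp [h])

/-- The superalgebra `L(β_{⌊(n+5)/2⌋}, …, β_{n+1})`. -/
def algebra {n : ℕ} (β : Fin (numParams n) → ℂ) : Superalgebra (Space n) where
  bracket := bracket β
  part := part n
  isCompl := isCompl_part n
  bracket_mem := bracket_mem_part β

/-- `S_{m,t} = cos (2πm/t) + i sin (2πm/t)`. -/
def S (m t : ℕ) : ℂ :=
  Complex.cos (2 * Real.pi * m / t) + Complex.I * Complex.sin (2 * Real.pi * m / t)

/-- The range `1 ≤ j ≤ k`, `1 ≤ s ≤ k + 1 - j` of the indices of the list. -/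
def Admissible (k s j : ℕ) : Prop := 1 ≤ j ∧ j ≤ k ∧ 1 ≤ s ∧ s ≤ k + 1 - j

/-- The vector `W_{s,k}(V¹_{j,k}(α_1, …, α_k))`, formed with the root of unity `S_{m,j}`. Its entry
at the position `p ∈ {1, …, k}` is `1` for `p = s` and for `p = s + j`, it is
`S_{m,j}^{p-s} α_p` for `p > s + j`, and all other entries vanish, so that the vector is
`(0, …, 0, 1, 0, …, 0, 1, S_{m,j}^{j+1} α_{s+j+1}, …, S_{m,j}^{k-s} α_k)`. For `s = k + 1 - j` it
has the single nonzero entry `1`, at the position `s`. The component `p : Fin k` of a vector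
is its entry at the position `p + 1`. -/
def WV (k s j m : ℕ) (α : Fin k → ℂ) : Fin k → ℂ := fun p =>
  if p.val + 1 = s ∨ p.val + 1 = s + j then 1
  else if s + j < p.val + 1 then S m j ^ (p.val + 1 - s) * α p
  else 0

end LeibnizFamily

end

/-! ### Parity decomposition and working forms of the Leibniz identity. -/

namespace Superalgebra

variable {L : Type*} [AddCommGroup L] [Module ℂ L] {A : Superalgebra L}

/-! Write R_v for z ↦ [z, v]. Since the nilindex equals the dimension 2n + 2, the descending central
sequence drops by two dimensions at the first step and by one at every later step
(`IsLeibniz.finrank_lower`). So L has two generators modulo [L, L], and they may be taken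
homogeneous.

Neither generator is even. If L₀ were not inside [L, L], an even x acting on L₀ as one Jordan block
would be a generator. The even elements of [L, L] would then act by zero from the right, so R_a² = 0
for every odd a. According to the position of [x, x], this forces dim L₁ ≤ 1
(`Mixed.finrank_odd_le`) or a single Jordan block of size n + 2 on L₁ (`Mixed.hasJordanBlocks_odd`),
and the latter exceeds the maximum (n + 1, 1). Hence L₀ ⊆ [L, L] (`InClass.even_le`).

Parity now alternates along the layers of the sequence, and an even element with a block of size n +
1 on L₁ must act nontrivially between them. This yields an odd y whose string F_i = R_y^i y meets
every layer (`InClass.exists_rightString`). A second odd generator w can be corrected so that [w, y]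
= [w, w] = 0. Then R_w anticommutes with R_y and squares to zero, which confines [y, w] to the span
of the F_{2r+1} with ⌊(n+1)/2⌋ ≤ r < n. Its coefficients are, up to the factors -2·2^r, the
parameters β. As R_{F_1} = 2R_y² and R_{F_i} = 0 for i ≥ 2, these data determine all products
(`OddGenerated.exists_presentation`, `IsPresentation.iso`).

An isomorphism between two models multiplies the leading coordinates of y and w by scalars, and
comparing [y, w] gives β'_p = c t^p β_p; conversely every such scaling is realised
(`iso_iff_scaling`). What remains is to classify vectors under this two-parameter torus: c and t
turn the first two nonzero entries into 1, and t stays free up to a j-th root of unity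
(`exists_WV_eq_scaling`, `WV_scaling_iff`). -/

theorem bracket_even_even {u v : L} (hu : u ∈ A.part 0) (hv : v ∈ A.part 0) :
    A.bracket u v ∈ A.part 0 := A.bracket_mem 0 0 u v hu hv

theorem bracket_even_odd {u v : L} (hu : u ∈ A.part 0) (hv : v ∈ A.part 1) :
    A.bracket u v ∈ A.part 1 := A.bracket_mem 0 1 u v hu hv

theorem bracket_odd_even {u v : L} (hu : u ∈ A.part 1) (hv : v ∈ A.part 0) :
    A.bracket u v ∈ A.part 1 := A.bracket_mem 1 0 u v hu hv

theorem bracket_odd_odd {u v : L} (hu : u ∈ A.part 1) (hv : v ∈ A.part 1) :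
    A.bracket u v ∈ A.part 0 := A.bracket_mem 1 1 u v hu hv

theorem exists_even_add_odd (A : Superalgebra L) (v : L) :
    ∃ v₀ ∈ A.part 0, ∃ v₁ ∈ A.part 1, v₀ + v₁ = v := by
  have h : v ∈ A.part 0 ⊔ A.part 1 := by rw [A.isCompl.sup_eq_top]; trivial
  exact Submodule.mem_sup.1 h

theorem eq_zero_of_even_of_odd {v : L} (h₀ : v ∈ A.part 0) (h₁ : v ∈ A.part 1) : v = 0 :=
  Submodule.disjoint_def.1 A.isCompl.disjoint v h₀ h₁

theorem add_unique {u₀ u₁ v₀ v₁ : L} (hu₀ : u₀ ∈ A.part 0) (hu₁ : u₁ ∈ A.part 1)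
    (hv₀ : v₀ ∈ A.part 0) (hv₁ : v₁ ∈ A.part 1) (h : u₀ + u₁ = v₀ + v₁) :
    u₀ = v₀ ∧ u₁ = v₁ := by
  have h1 : u₀ - v₀ = v₁ - u₁ := by
    rw [sub_eq_sub_iff_add_eq_add, h, add_comm]
  have h2 : u₀ - v₀ = 0 :=
    eq_zero_of_even_of_odd (sub_mem hu₀ hv₀) (h1 ▸ sub_mem hv₁ hu₁)
  rw [h2] at h1
  exact ⟨sub_eq_zero.1 h2, (sub_eq_zero.1 h1.symm).symm⟩

/-- For two odd arguments the sign is a plus: R_{[v,w]} is the anticommutator of R_v and R_w, and in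
particular R_{[v,v]} = 2R_v². -/
theorem IsLeibniz.odd (hA : A.IsLeibniz) (u : L) {v w : L} (hv : v ∈ A.part 1)
    (hw : w ∈ A.part 1) : A.bracket u (A.bracket v w) =
      A.bracket (A.bracket u v) w + A.bracket (A.bracket u w) v := by
  rw [hA 1 1 u v w hv hw]
  simp [ZMod.val_one]

/-- One even factor makes the sign trivial, so the other factor need not be homogeneous and
R_{[v,w]} is a commutator. -/
theorem IsLeibniz.even_right (hA : A.IsLeibniz) (u v : L) {w : L} (hw : w ∈ A.part 0) :
    A.bracket u (A.bracket v w) =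
      A.bracket (A.bracket u v) w - A.bracket (A.bracket u w) v := by
  obtain ⟨v₀, h₀, v₁, h₁, rfl⟩ := A.exists_even_add_odd v
  have e₀ := hA 0 0 u v₀ w h₀ hw
  have e₁ := hA 1 0 u v₁ w h₁ hw
  simp only [ZMod.val_zero, mul_zero, pow_zero, one_smul] at e₀ e₁
  simp only [map_add, LinearMap.add_apply, e₀, e₁]
  abel

theorem IsLeibniz.even_left (hA : A.IsLeibniz) (u w : L) {v : L} (hv : v ∈ A.part 0) :
    A.bracket u (A.bracket v w) =
      A.bracket (A.bracket u v) w - A.bracket (A.bracket u w) v := by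
  obtain ⟨w₀, h₀, w₁, h₁, rfl⟩ := A.exists_even_add_odd w
  have e₀ := hA 0 0 u v w₀ hv h₀
  have e₁ := hA 0 1 u v w₁ hv h₁
  simp only [ZMod.val_zero, zero_mul, pow_zero, one_smul] at e₀ e₁
  simp only [map_add, LinearMap.add_apply, e₀, e₁]
  abel

/-! ### The descending central sequence -/

theorem bracket_mem_lower_succ {i : ℕ} {u : L} (hu : u ∈ A.lower i) (v : L) :
    A.bracket u v ∈ A.lower (i + 1) :=
  Submodule.apply_mem_map₂ _ hu trivial

theorem lower_succ_le_of_forall {i : ℕ} {P : Submodule ℂ L}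
    (h : ∀ u ∈ A.lower i, ∀ v, A.bracket u v ∈ P) : A.lower (i + 1) ≤ P :=
  Submodule.map₂_le.2 fun u hu v _ => h u hu v

/-- Every term of the sequence is a graded subspace, because products of homogeneous components sort
by parity. This is what later allows a relation inside a term to be split into its even and odd
halves. -/
theorem lower_graded {i : ℕ} {v : L} (hv : v ∈ A.lower i) :
    ∃ v₀ ∈ A.part 0, ∃ v₁ ∈ A.part 1, v₀ ∈ A.lower i ∧ v₁ ∈ A.lower i ∧ v₀ + v₁ = v := by
  induction i generalizing v with
  | zero =>
    obtain ⟨v₀, h₀, v₁, h₁, h⟩ := A.exists_even_add_odd v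
    exact ⟨v₀, h₀, v₁, h₁, trivial, trivial, h⟩
  | succ i ih =>
    have key : A.lower (i + 1) ≤
        (A.part 0 ⊓ A.lower (i + 1)) ⊔ (A.part 1 ⊓ A.lower (i + 1)) := by
      refine Submodule.map₂_le.2 fun u hu w _ => ?_
      obtain ⟨u₀, hu₀, u₁, hu₁, hl₀, hl₁, rfl⟩ := ih hu
      obtain ⟨w₀, hw₀, w₁, hw₁, rfl⟩ := A.exists_even_add_odd w
      refine Submodule.mem_sup.2 ⟨A.bracket u₀ w₀ + A.bracket u₁ w₁, ⟨?_, ?_⟩,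
        A.bracket u₀ w₁ + A.bracket u₁ w₀, ⟨?_, ?_⟩, ?_⟩
      · exact add_mem (bracket_even_even hu₀ hw₀) (bracket_odd_odd hu₁ hw₁)
      · exact add_mem (bracket_mem_lower_succ hl₀ _) (bracket_mem_lower_succ hl₁ _)
      · exact add_mem (bracket_even_odd hu₀ hw₁) (bracket_odd_even hu₁ hw₀)
      · exact add_mem (bracket_mem_lower_succ hl₀ _) (bracket_mem_lower_succ hl₁ _)
      · simp only [map_add, LinearMap.add_apply]
        abel
    obtain ⟨v₀, ⟨h₀, l₀⟩, v₁, ⟨h₁, l₁⟩, h⟩ := Submodule.mem_sup.1 (key hv)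
    exact ⟨v₀, h₀, v₁, h₁, l₀, l₁, h⟩

theorem mem_lower_of_add {i : ℕ} {u₀ u₁ : L} (h₀ : u₀ ∈ A.part 0) (h₁ : u₁ ∈ A.part 1)
    (h : u₀ + u₁ ∈ A.lower i) : u₀ ∈ A.lower i ∧ u₁ ∈ A.lower i := by
  obtain ⟨v₀, k₀, v₁, k₁, l₀, l₁, e⟩ := lower_graded h
  obtain ⟨rfl, rfl⟩ := add_unique k₀ k₁ h₀ h₁ e
  exact ⟨l₀, l₁⟩

theorem lower_succ_le (A : Superalgebra L) (i : ℕ) : A.lower (i + 1) ≤ A.lower i := by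
  induction i with
  | zero => exact le_top
  | succ i ih => exact Submodule.map₂_le_map₂_left ih

theorem lower_antitone (A : Superalgebra L) : Antitone A.lower :=
  antitone_nat_of_succ_le A.lower_succ_le

/-- The Leibniz identity expresses [u, [p, q]] through [[u, p], q] and [[u, q], p], which allows
induction on j. The extra 1 is the index shift `lower k` = L^{k+1}. -/
theorem IsLeibniz.bracket_mem_lower (hA : A.IsLeibniz) {i j : ℕ} {u v : L} (hu : u ∈ A.lower i)
    (hv : v ∈ A.lower j) : A.bracket u v ∈ A.lower (i + j + 1) := by
  induction j generalizing i u v with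
  | zero => exact bracket_mem_lower_succ hu v
  | succ j ih =>
    have key : A.lower (j + 1) ≤ (A.lower (i + (j + 1) + 1)).comap (A.bracket u) := by
      refine Submodule.map₂_le.2 fun p hp q _ => ?_
      obtain ⟨p₀, hp₀, p₁, hp₁, hl₀, hl₁, rfl⟩ := lower_graded hp
      obtain ⟨q₀, hq₀, q₁, hq₁, rfl⟩ := A.exists_even_add_odd q
      have hl : ∀ p ∈ A.lower j, ∀ q : L,
          A.bracket (A.bracket u p) q ∈ A.lower (i + (j + 1) + 1) :=
        fun p hp q => bracket_mem_lower_succ (ih hu hp) q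
      have hr : ∀ p ∈ A.lower j, ∀ q : L,
          A.bracket (A.bracket u q) p ∈ A.lower (i + (j + 1) + 1) := fun p hp q => by
        have := ih (bracket_mem_lower_succ hu q) hp
        rwa [show i + 1 + j + 1 = i + (j + 1) + 1 by ring] at this
      rw [Submodule.mem_comap, map_add, map_add, map_add, LinearMap.add_apply,
        LinearMap.add_apply, map_add, map_add, hA.even_left u q₀ hp₀, hA.even_left u q₁ hp₀,
        hA.even_right u p₁ hq₀, hA.odd u hp₁ hq₁]
      exact add_mem
        (add_mem (sub_mem (hl _ hl₀ _) (hr _ hl₀ _)) (sub_mem (hl _ hl₁ _) (hr _ hl₁ _)))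
        (add_mem (sub_mem (hl _ hl₀ _) (hr _ hl₀ _)) (add_mem (hl _ hl₁ _) (hr _ hl₁ _)))
    exact key hv

theorem lower_eq_of_succ_eq {i : ℕ} (h : A.lower (i + 1) = A.lower i) (k : ℕ) :
    A.lower (i + k) = A.lower i := by
  induction k with
  | zero => rfl
  | succ k ih =>
    change Submodule.map₂ A.bracket (A.lower (i + k)) ⊤ = _
    rw [ih]
    exact h

/-- If the generators modulo `[L, L]` are multiples of one vector, then every quotient of the
descending central sequence is at most one-dimensional. -/
theorem IsLeibniz.lower_le_of_cyclic (hA : A.IsLeibniz) {a : L}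
    (h : ∀ v : L, ∃ c : ℂ, v - c • a ∈ A.lower 1) (i : ℕ) :
    ∃ b ∈ A.lower i, A.lower i ≤ Submodule.span ℂ {b} ⊔ A.lower (i + 1) := by
  induction i with
  | zero =>
    refine ⟨a, trivial, fun v _ => ?_⟩
    obtain ⟨c, hc⟩ := h v
    exact Submodule.mem_sup.2 ⟨c • a, Submodule.mem_span_singleton.2 ⟨c, rfl⟩, _, hc, by abel⟩
  | succ i ih =>
    obtain ⟨b, hb, hle⟩ := ih
    refine ⟨A.bracket b a, bracket_mem_lower_succ hb a, Submodule.map₂_le.2 fun u hu v _ => ?_⟩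
    obtain ⟨_, hs, u', hu', rfl⟩ := Submodule.mem_sup.1 (hle hu)
    obtain ⟨d, rfl⟩ := Submodule.mem_span_singleton.1 hs
    obtain ⟨c, hc⟩ := h v
    refine Submodule.mem_sup.2 ⟨(d * c) • A.bracket b a,
      Submodule.mem_span_singleton.2 ⟨_, rfl⟩,
      d • A.bracket b (v - c • a) + A.bracket u' v, ?_, ?_⟩
    · exact add_mem (Submodule.smul_mem _ _ (hA.bracket_mem_lower hb hc))
        (bracket_mem_lower_succ hu' v)
    · simp only [map_add, map_sub, map_smul, LinearMap.add_apply, LinearMap.smul_apply, smul_sub,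
        smul_smul]
      abel

/-- W and u together already exhaust V, by counting dimensions. -/
theorem exists_smul_sub_mem {V W : Submodule ℂ L} [Module.Finite ℂ L] {u : L}
    (hVW : Module.finrank ℂ V ≤ Module.finrank ℂ W + 1) (hWV : W ≤ V) (hu : u ∈ V) (hu' : u ∉ W)
    {v : L} (hv : v ∈ V) : ∃ c : ℂ, v - c • u ∈ W := by
  have hlt : W < W ⊔ Submodule.span ℂ {u} := by
    refine lt_of_le_of_ne le_sup_left fun h => hu' ?_
    rw [h]
    exact Submodule.mem_sup_right (Submodule.mem_span_singleton_self u)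
  have hle : W ⊔ Submodule.span ℂ {u} ≤ V :=
    sup_le hWV ((Submodule.span_singleton_le_iff_mem _ _).2 hu)
  have h1 := Submodule.finrank_lt_finrank_of_lt hlt
  have h2 := Submodule.eq_of_le_of_finrank_le hle (by omega)
  rw [← h2] at hv
  obtain ⟨w, hw, _, hs, rfl⟩ := Submodule.mem_sup.1 hv
  obtain ⟨c, rfl⟩ := Submodule.mem_span_singleton.1 hs
  exact ⟨c, by simpa using hw⟩

/-- In a Leibniz superalgebra whose nilindex is its dimension `D + 1`, the terms of the descending
central sequence from the second on have codimension one in one another. -/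
theorem IsLeibniz.finrank_lower (hA : A.IsLeibniz) [Module.Finite ℂ L] {D : ℕ} (hD : 1 ≤ D)
    (hdim : Module.finrank ℂ L = D + 1) (h0 : A.lower D = ⊥) (hne : ∀ i < D, A.lower i ≠ ⊥) :
    ∀ i, 1 ≤ i → i ≤ D → Module.finrank ℂ (A.lower i) = D - i := by
  have hlt : ∀ i < D, Module.finrank ℂ (A.lower (i + 1)) < Module.finrank ℂ (A.lower i) := by
    intro i hi
    refine Submodule.finrank_lt_finrank_of_lt (lt_of_le_of_ne (A.lower_succ_le i) fun h => ?_)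
    have := lower_eq_of_succ_eq h (D - i)
    rw [Nat.add_sub_cancel' hi.le, h0] at this
    exact hne i hi this.symm
  have h00 : Module.finrank ℂ (A.lower 0) = D + 1 := by
    rw [← hdim]; exact finrank_top ℂ L
  -- Codimension at most one would make L one-generated. Then every step loses at most one
  -- dimension, and `lower D` could not be zero.
  have h1 : Module.finrank ℂ (A.lower 1) ≤ D - 1 := by
    by_contra hcon
    have hl := hlt 0 (by omega)
    rw [h00] at hl
    have hex : ∃ a : L, a ∉ A.lower 1 := by
      by_contra hall
      push Not at hall
      have : A.lower 1 = ⊤ := Submodule.eq_top_iff'.2 hall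
      rw [zero_add, this, finrank_top, hdim] at hl
      omega
    obtain ⟨a, ha⟩ := hex
    have hcyc := hA.lower_le_of_cyclic (a := a) fun v =>
      exists_smul_sub_mem (V := A.lower 0) (W := A.lower 1) (by omega) le_top trivial ha
        (v := v) trivial
    have hstep : ∀ i, Module.finrank ℂ (A.lower i) ≤ Module.finrank ℂ (A.lower (i + 1)) + 1 := by
      intro i
      obtain ⟨b, _, hb⟩ := hcyc i
      refine (Submodule.finrank_mono hb).trans
        ((Submodule.finrank_add_le_finrank_add_finrank _ _).trans ?_)
      have : Module.finrank ℂ (Submodule.span ℂ {b}) ≤ 1 := by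
        simpa using finrank_span_le_card (R := ℂ) ({b} : Set L)
      omega
    have : ∀ i, D + 1 ≤ Module.finrank ℂ (A.lower i) + i := by
      intro i
      induction i with
      | zero => omega
      | succ i ih => have := hstep i; omega
    have h := this D
    rw [h0, finrank_bot] at h
    omega
  -- Strict descent from `lower 1` bounds the dimensions above, and strict descent to `lower D`
  -- bounds them below by the same numbers.
  have hup : ∀ i, i + 1 ≤ D → Module.finrank ℂ (A.lower (i + 1)) + i ≤ D - 1 := by
    intro i
    induction i with
    | zero => intro _; simpa using h1
    | succ i ih => intro hi; have := hlt (i + 1) (by omega); have := ih (by omega); omega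
  have hlow : ∀ k, k ≤ D → k ≤ Module.finrank ℂ (A.lower (D - k)) := by
    intro k
    induction k with
    | zero => intro _; omega
    | succ k ih =>
      intro hk
      have := hlt (D - (k + 1)) (by omega)
      rw [show D - (k + 1) + 1 = D - k by omega] at this
      have := ih (by omega)
      omega
  intro i hi hiD
  have a1 := hup (i - 1) (by omega)
  have a2 := hlow (D - i) (by omega)
  rw [show i - 1 + 1 = i by omega] at a1
  rw [show D - (D - i) = i by omega] at a2
  omega

end Superalgebra

namespace Superalgebra

variable {L : Type*} [AddCommGroup L] [Module ℂ L] {A : Superalgebra L}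

/-! ### Jordan blocks -/

/-- Strings that span are automatically a basis when their total length is the dimension, so
independence never has to be checked. -/
theorem hasJordanBlocks_of_strings {N : L →ₗ[ℂ] L} {W : Submodule ℂ L} {c : List ℕ}
    [Module.Finite ℂ W]
    (hc : c.Pairwise (fun p q => q ≤ p)) (hpos : ∀ p ∈ c, 1 ≤ p) (v : Fin c.length → L)
    (hmem : ∀ i k, (N ^ k) (v i) ∈ W) (hzero : ∀ i, (N ^ c.get i) (v i) = 0)
    (hspan : W ≤ Submodule.span ℂ {u | ∃ i k, k < c.get i ∧ (N ^ k) (v i) = u})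
    (hrank : Module.finrank ℂ W = c.sum) : HasJordanBlocks N W c := by
  refine ⟨hc, hpos, ?_⟩
  let b : ((i : Fin c.length) × Fin (c.get i)) → W :=
    fun p => ⟨(N ^ p.2.val) (v p.1), hmem p.1 p.2.val⟩
  have hb : ⊤ ≤ Submodule.span ℂ (Set.range b) := by
    have himg : Submodule.map W.subtype (Submodule.span ℂ (Set.range b)) = 
        Submodule.span ℂ (W.subtype '' Set.range b) := Submodule.map_span _ _
    intro w _
    have hw := hspan w.2
    have : {u | ∃ i k, k < c.get i ∧ (N ^ k) (v i) = u} ⊆ W.subtype '' Set.range b := by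
      rintro u ⟨i, k, hk, rfl⟩
      exact ⟨b ⟨i, ⟨k, hk⟩⟩, ⟨_, rfl⟩, rfl⟩
    have hw' := Submodule.span_mono this hw
    rw [← himg] at hw'
    obtain ⟨w', hw', he⟩ := hw'
    rwa [← Subtype.ext (a1 := w') (a2 := w) he]
  have hcard : Fintype.card ((i : Fin c.length) × Fin (c.get i)) = Module.finrank ℂ W := by
    rw [hrank, Fintype.card_sigma]
    simp
  refine ⟨basisOfTopLeSpanOfCardEqFinrank b hb hcard, fun i k => ?_⟩
  simp only [coe_basisOfTopLeSpanOfCardEqFinrank]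
  have hs : N ((N ^ k.val) (v i)) = (N ^ (k.val + 1)) (v i) := by
    rw [pow_succ', Module.End.mul_apply]
  split_ifs with h
  · exact hs
  · change N ((N ^ k.val) (v i)) = 0
    rw [hs, show k.val + 1 = c.get i by omega, hzero]

theorem HasJordanBlocks.sum_eq {N : L →ₗ[ℂ] L} {W : Submodule ℂ L} {c : List ℕ}
    (h : HasJordanBlocks N W c) : c.sum = Module.finrank ℂ W := by
  obtain ⟨_, _, b, _⟩ := h
  rw [Module.finrank_eq_card_basis b, Fintype.card_sigma]
  simp

theorem pow_string {N : L →ₗ[ℂ] L} {p : ℕ} {b : Fin p → L}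
    (hb : ∀ k : Fin p, N (b k) = if h : k.val + 1 < p then b ⟨k.val + 1, h⟩ else 0) (hp : 0 < p)
    (k : ℕ) : (N ^ k) (b ⟨0, hp⟩) = if h : k < p then b ⟨k, h⟩ else 0 := by
  induction k with
  | zero => simp [hp]
  | succ k ih =>
    rw [pow_succ', Module.End.mul_apply, ih]
    split_ifs with h1 h2
    · rw [hb]; simp [h2]
    · rw [hb]; simp [h2]
    · omega
    · simp

/-- The head of the first string survives p - 1 applications of N. This is the bridge between block
sizes and nilpotency order. -/
theorem HasJordanBlocks.exists_pow_ne_zero {N : L →ₗ[ℂ] L} {W : Submodule ℂ L} {p : ℕ}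
    {c : List ℕ} (h : HasJordanBlocks N W (p :: c)) : ∃ v ∈ W, (N ^ (p - 1)) v ≠ 0 := by
  obtain ⟨_, hpos, b, hb⟩ := h
  have hp : 1 ≤ p := hpos p (by simp)
  let i : Fin (p :: c).length := ⟨0, by simp⟩
  have hs := pow_string (N := N) (p := p) (b := fun k : Fin p => (b ⟨i, k⟩ : L))
    (fun k => hb i k) hp (p - 1)
  refine ⟨b ⟨i, ⟨0, hp⟩⟩, (b ⟨i, ⟨0, hp⟩⟩).2, ?_⟩
  rw [hs, dif_pos (by omega)]
  have := b.ne_zero ⟨i, ⟨p - 1, by change p - 1 < p; omega⟩⟩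
  simpa using this

/-- With a single block, the head of the string spans the cokernel of N. -/
theorem HasJordanBlocks.exists_cyclic {N : L →ₗ[ℂ] L} {W : Submodule ℂ L} {p : ℕ}
    (h : HasJordanBlocks N W [p]) : ∃ z ∈ W, ∀ w ∈ W, ∃ c : ℂ, ∃ u ∈ W, w = c • z + N u := by
  obtain ⟨_, hpos, b, hb⟩ := h
  have hp : 1 ≤ p := hpos p (by simp)
  let i : Fin [p].length := ⟨0, by simp⟩
  set z : W := b ⟨i, ⟨0, hp⟩⟩ with hz
  refine ⟨z, z.2, ?_⟩
  have hle : (⊤ : Submodule ℂ W) ≤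
      (Submodule.span ℂ {(z : L)} ⊔ W.map N).comap W.subtype := by
    rw [← b.span_eq, Submodule.span_le]
    rintro _ ⟨⟨j, k⟩, rfl⟩
    obtain rfl : j = i := Subsingleton.elim (α := Fin 1) _ _
    obtain ⟨k, hk⟩ := k
    cases k with
    | zero => exact Submodule.mem_sup_left (Submodule.mem_span_singleton_self _)
    | succ k =>
      refine Submodule.mem_sup_right ⟨b ⟨i, ⟨k, by omega⟩⟩, (b _).2, ?_⟩
      rw [hb, dif_pos hk]
      rfl
  intro w hw
  obtain ⟨_, hs, _, ⟨u, hu, rfl⟩, he⟩ := Submodule.mem_sup.1 (hle (x := ⟨w, hw⟩) trivial)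
  obtain ⟨c, rfl⟩ := Submodule.mem_span_singleton.1 hs
  exact ⟨c, u, hu, he.symm⟩

/-! ### Isomorphisms -/

variable {L' L'' : Type*} [AddCommGroup L'] [Module ℂ L'] [AddCommGroup L''] [Module ℂ L'']
  {B : Superalgebra L'} {C : Superalgebra L''}

theorem even_of_grading {f : L ≃ₗ[ℂ] L'}
    (h : ∀ (a : ZMod 2) (x : L), x ∈ A.part a → f x ∈ B.part a) (a : ZMod 2) (x : L)
    (hx : f x ∈ B.part a) : x ∈ A.part a := by
  obtain ⟨x₀, h₀, x₁, h₁, rfl⟩ := A.exists_even_add_odd x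
  rw [map_add] at hx
  have h2 : ∀ c : ZMod 2, c = 0 ∨ c = 1 := by decide
  obtain rfl | rfl := h2 a
  · have := (add_unique hx (zero_mem _) (h 0 _ h₀) (h 1 _ h₁) (add_zero _)).2
    rw [f.map_eq_zero_iff.1 this.symm, add_zero]
    exact h₀
  · have := (add_unique (zero_mem _) hx (h 0 _ h₀) (h 1 _ h₁) (zero_add _)).1
    rw [f.map_eq_zero_iff.1 this.symm, zero_add]
    exact h₁

theorem Iso.symm (h : A.Iso B) : B.Iso A := by
  obtain ⟨f, hf, hm⟩ := h
  refine ⟨f.symm, fun a x hx => even_of_grading hf a _ (by simpa using hx), fun x y => ?_⟩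
  apply f.injective
  simp [hm]

theorem Iso.trans (h : A.Iso B) (h' : B.Iso C) : A.Iso C := by
  obtain ⟨f, hf, hm⟩ := h
  obtain ⟨g, hg, hn⟩ := h'
  exact ⟨f.trans g, fun a x hx => hg a _ (hf a x hx), fun x y => by simp [hm, hn]⟩

end Superalgebra

/-! ### One even and one odd generator: first restrictions. -/

namespace Superalgebra

variable {L : Type*} [AddCommGroup L] [Module ℂ L] {A : Superalgebra L}

/-- A Leibniz superalgebra of dimension `D + 1` and nilindex `D + 1`, with the resulting dimensions
of the terms of the descending central sequence. -/
structure Chain (A : Superalgebra L) (D : ℕ) : Prop where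
  leib : A.IsLeibniz
  two_le : 2 ≤ D
  bot : A.lower D = ⊥
  dim : Module.finrank ℂ L = D + 1
  rank : ∀ i, 1 ≤ i → i ≤ D → Module.finrank ℂ (A.lower i) = D - i

/-- Where a layer is spanned by an odd vector, an even vector falls one term deeper. This and its
mirror image drive all the parity arguments below. -/
theorem mem_lower_of_even_of_smul_odd {i : ℕ} {v w : L} {c : ℂ} (hv : v ∈ A.part 0)
    (hw : w ∈ A.part 1) (h : v - c • w ∈ A.lower i) : v ∈ A.lower i :=
  (mem_lower_of_add hv (neg_mem (Submodule.smul_mem _ c hw)) (by rwa [← sub_eq_add_neg])).1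

theorem mem_lower_of_odd_of_smul_even {i : ℕ} {v w : L} {c : ℂ} (hv : v ∈ A.part 1)
    (hw : w ∈ A.part 0) (h : v - c • w ∈ A.lower i) : v ∈ A.lower i :=
  (mem_lower_of_add (neg_mem (Submodule.smul_mem _ c hw)) hv
    (by rwa [add_comm, ← sub_eq_add_neg])).2

namespace Chain

variable {D : ℕ}

theorem eq_zero (h : A.Chain D) {i : ℕ} (hi : D ≤ i) {v : L} (hv : v ∈ A.lower i) : v = 0 := by
  have := A.lower_antitone hi hv
  rwa [h.bot, Submodule.mem_bot] at this

variable [Module.Finite ℂ L]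

theorem not_le_succ (h : A.Chain D) {i : ℕ} (hi : 1 ≤ i) (hiD : i < D) :
    ¬ A.lower i ≤ A.lower (i + 1) := fun hle => by
  have h1 := Submodule.finrank_mono hle
  rw [h.rank i hi hiD.le, h.rank (i + 1) (by omega) hiD] at h1
  omega

theorem exists_sub (h : A.Chain D) {i : ℕ} (hi : 1 ≤ i) {u v : L} (hu : u ∈ A.lower i)
    (hu' : u ∉ A.lower (i + 1)) (hv : v ∈ A.lower i) : ∃ c : ℂ, v - c • u ∈ A.lower (i + 1) := by
  have hiD : i < D := by
    by_contra hcon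
    rw [h.eq_zero (not_lt.1 hcon) hu] at hu'
    exact hu' (zero_mem _)
  refine exists_smul_sub_mem ?_ (A.lower_succ_le i) hu hu' hv
  rw [h.rank i hi hiD.le, h.rank (i + 1) (by omega) hiD]
  omega

/-- Two vectors that are independent modulo `[L, L]` generate `L` modulo `[L, L]`. -/
theorem exists_sub_sub (h : A.Chain D) {a b : L} (ha : a ∉ A.lower 1)
    (hb : ∀ c : ℂ, b - c • a ∉ A.lower 1) (v : L) :
    ∃ c d : ℂ, v - c • a - d • b ∈ A.lower 1 := by
  have hr := h.rank 1 le_rfl (by have := h.two_le; omega)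
  have h2 := h.two_le
  set W := A.lower 1 ⊔ Submodule.span ℂ {a} with hW
  have hlt : A.lower 1 < W := by
    refine lt_of_le_of_ne le_sup_left fun e => ha ?_
    rw [e, hW]
    exact Submodule.mem_sup_right (Submodule.mem_span_singleton_self a)
  have hr' := Submodule.finrank_lt_finrank_of_lt hlt
  have htop : Module.finrank ℂ (⊤ : Submodule ℂ L) = D + 1 := by rw [finrank_top, h.dim]
  have hbW : b ∉ W := fun hbW => by
    obtain ⟨l, hl, _, hs, e⟩ := Submodule.mem_sup.1 hbW
    obtain ⟨c, rfl⟩ := Submodule.mem_span_singleton.1 hs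
    exact hb c (by rw [← e]; simpa using hl)
  obtain ⟨d, hd⟩ := exists_smul_sub_mem (V := ⊤) (W := W) (by omega) le_top trivial hbW
    (v := v) trivial
  obtain ⟨l, hl, _, hs, e⟩ := Submodule.mem_sup.1 hd
  obtain ⟨c, rfl⟩ := Submodule.mem_span_singleton.1 hs
  refine ⟨c, d, ?_⟩
  rwa [sub_right_comm, ← e, add_sub_cancel_right]

end Chain

/-- An even generator `x` and an odd generator `y`, where `x` acts on `L₀` as one Jordan block. -/
structure Mixed (A : Superalgebra L) (D : ℕ) (x y : L) : Prop extends A.Chain D where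
  hx : x ∈ A.part 0
  hy : y ∈ A.part 1
  hx1 : x ∉ A.lower 1
  hy1 : y ∉ A.lower 1
  image : ∀ e ∈ A.part 0, e ∈ A.lower 1 → ∃ e' ∈ A.part 0, e = A.bracket e' x

namespace Mixed

variable {D : ℕ} {x y : L} [Module.Finite ℂ L]

theorem decomp (h : A.Mixed D x y) (v : L) : ∃ c d : ℂ, v - c • x - d • y ∈ A.lower 1 :=
  h.toChain.exists_sub_sub h.hx1
    (fun _ hc => h.hy1 (mem_lower_of_odd_of_smul_even h.hy h.hx hc)) v

theorem exists_eq (h : A.Mixed D x y) (v : L) :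
    ∃ c d : ℂ, ∃ l ∈ A.lower 1, v = c • x + d • y + l := by
  obtain ⟨c, d, hl⟩ := h.decomp v
  exact ⟨c, d, _, hl, by abel⟩

theorem decomp_even (h : A.Mixed D x y) {v : L} (hv : v ∈ A.part 0) :
    ∃ c : ℂ, v - c • x ∈ A.lower 1 := by
  obtain ⟨c, d, hcd⟩ := h.decomp v
  exact ⟨c, mem_lower_of_even_of_smul_odd (sub_mem hv (Submodule.smul_mem _ c h.hx)) h.hy hcd⟩

theorem decomp_odd (h : A.Mixed D x y) {v : L} (hv : v ∈ A.part 1) :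
    ∃ d : ℂ, v - d • y ∈ A.lower 1 := by
  obtain ⟨c, d, hcd⟩ := h.decomp v
  rw [sub_right_comm] at hcd
  exact ⟨d, mem_lower_of_odd_of_smul_even (sub_mem hv (Submodule.smul_mem _ d h.hy)) h.hx hcd⟩

theorem even_eq (h : A.Mixed D x y) {e : L} (he : e ∈ A.part 0) (he1 : e ∈ A.lower 1) :
    ∃ c : ℂ, ∃ e' ∈ A.part 0, e' ∈ A.lower 1 ∧ e = c • A.bracket x x + A.bracket e' x := by
  obtain ⟨e', he', rfl⟩ := h.image e he he1
  obtain ⟨c, hc⟩ := h.decomp_even he'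
  exact ⟨c, e' - c • x, sub_mem he' (Submodule.smul_mem _ c h.hx), hc, by simp⟩

theorem even_induct (h : A.Mixed D x y) {P : Submodule ℂ L} (hP : A.bracket x x ∈ P)
    (hX : ∀ p ∈ P, A.bracket p x ∈ P) {e : L} (he : e ∈ A.part 0) (he1 : e ∈ A.lower 1) :
    e ∈ P := by
  have key : ∀ k, ∀ e ∈ A.part 0, e ∈ A.lower 1 → e ∈ P ⊔ A.lower k := by
    intro k
    induction k with
    | zero => intro e _ _; exact Submodule.mem_sup_right trivial
    | succ k ih =>
      intro e he he1
      obtain ⟨c, e', he', he1', rfl⟩ := h.even_eq he he1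
      obtain ⟨p, hp, l, hl, rfl⟩ := Submodule.mem_sup.1 (ih e' he' he1')
      refine Submodule.mem_sup.2 ⟨c • A.bracket x x + A.bracket p x,
        add_mem (Submodule.smul_mem _ c hP) (hX p hp), A.bracket l x,
        bracket_mem_lower_succ hl x, ?_⟩
      simp [add_assoc]
  have := key D e he he1
  rwa [h.bot, sup_bot_eq] at this

/-- R_{[x,x]} is the commutator of R_x with itself, and R_{[p,x]} is the commutator of R_p and R_x,
hence zero once R_p is. -/
theorem ann (h : A.Mixed D x y) {e : L} (he : e ∈ A.part 0) (he1 : e ∈ A.lower 1) (z : L) :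
    A.bracket z e = 0 := by
  have hP : e ∈ LinearMap.ker A.bracket.flip := by
    refine h.even_induct ?_ ?_ he he1
    · rw [LinearMap.mem_ker]
      ext z
      simp [h.leib.even_right z x h.hx]
    · intro p hp
      rw [LinearMap.mem_ker] at hp ⊢
      ext z
      have hp' : ∀ z, A.bracket z p = 0 := fun z => LinearMap.congr_fun hp z
      simp [h.leib.even_right z p h.hx, hp']
  exact LinearMap.congr_fun (LinearMap.mem_ker.1 hP) z

theorem anticomm (h : A.Mixed D x y) {a b : L} (ha : a ∈ A.part 1) (hb : b ∈ A.part 1) (z : L) :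
    A.bracket (A.bracket z a) b + A.bracket (A.bracket z b) a = 0 := by
  rw [← h.leib.odd z ha hb]
  exact h.ann (bracket_odd_odd ha hb) (bracket_mem_lower_succ (i := 0) trivial b) z

/-- Here 2R_a² = R_{[a,a]}, and [a, a] is an even element of [L, L]. -/
theorem sq_zero (h : A.Mixed D x y) {a : L} (ha : a ∈ A.part 1) (z : L) :
    A.bracket (A.bracket z a) a = 0 := by
  have := h.anticomm ha ha z
  rwa [← two_smul ℂ, smul_eq_zero_iff_right two_ne_zero] at this

/-- If the square of the even generator is nonzero modulo the third term, the odd part is at most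
one-dimensional. -/
theorem finrank_odd_le (h : A.Mixed D x y) (hZ : A.bracket x x ∉ A.lower 2) :
    Module.finrank ℂ (A.part 1) ≤ 1 := by
  have hxx : A.bracket x x ∈ A.lower 1 := bracket_mem_lower_succ (i := 0) trivial x
  have hxy : A.bracket x y ∈ A.lower 2 := by
    obtain ⟨c, hc⟩ := h.toChain.exists_sub le_rfl hxx hZ
      (bracket_mem_lower_succ (i := 0) (u := x) trivial y)
    exact mem_lower_of_odd_of_smul_even (bracket_even_odd h.hx h.hy)
      (bracket_even_even h.hx h.hx) hc
  -- Every layer from the first on is spanned by an even iterated product z of x. The induction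
  -- carries along that [z, y] drops two terms below z instead of one, so multiplying by y
  -- contributes nothing to the next layer.
  have key : ∀ i, ∃ z ∈ A.part 0, z ∈ A.lower (i + 1) ∧ A.bracket z y ∈ A.lower (i + 3) ∧
      ∀ v ∈ A.lower (i + 1), ∃ c : ℂ, v - c • z ∈ A.lower (i + 2) := by
    intro i
    induction i with
    | zero =>
      refine ⟨_, bracket_even_even h.hx h.hx, hxx, ?_, fun v hv =>
        h.toChain.exists_sub le_rfl hxx hZ hv⟩
      have e := h.leib.even_left x y h.hx
      rw [eq_sub_iff_add_eq] at e
      rw [← e]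
      exact add_mem (h.leib.bracket_mem_lower (i := 0) (j := 2) trivial hxy)
        (bracket_mem_lower_succ hxy x)
    | succ i ih =>
      obtain ⟨z, hz, hzl, hzy, hz'⟩ := ih
      refine ⟨A.bracket z x, bracket_even_even hz h.hx, bracket_mem_lower_succ hzl x, ?_, ?_⟩
      · have e := h.leib.even_left z y h.hx
        rw [eq_sub_iff_add_eq] at e
        rw [← e]
        exact add_mem (A.lower_antitone (by omega) (h.leib.bracket_mem_lower hzl hxy))
          (bracket_mem_lower_succ hzy x)
      · have hle : A.lower (i + 1 + 1) ≤
            Submodule.span ℂ {A.bracket z x} ⊔ A.lower (i + 1 + 2) := by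
          refine lower_succ_le_of_forall fun u hu v => ?_
          obtain ⟨c, hc⟩ := hz' u hu
          obtain ⟨a, b, hab⟩ := h.decomp v
          refine Submodule.mem_sup.2 ⟨(c * a) • A.bracket z x,
            Submodule.mem_span_singleton.2 ⟨_, rfl⟩,
            A.bracket (u - c • z) v + c • (b • A.bracket z y +
              A.bracket z (v - a • x - b • y)), ?_, ?_⟩
          · exact add_mem (bracket_mem_lower_succ hc v) (Submodule.smul_mem _ _
              (add_mem (Submodule.smul_mem _ _ hzy) (h.leib.bracket_mem_lower (i := i + 1) (j := 1) hzl hab)))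
          · simp only [map_sub, map_smul, LinearMap.sub_apply, LinearMap.smul_apply, smul_add,
              smul_sub, smul_smul]
            abel
        intro v hv
        obtain ⟨_, hs, w, hw, rfl⟩ := Submodule.mem_sup.1 (hle hv)
        obtain ⟨c, rfl⟩ := Submodule.mem_span_singleton.1 hs
        exact ⟨c, by simpa using hw⟩
  have hodd : ∀ i, ∀ v ∈ A.part 1, v ∈ A.lower 1 → v ∈ A.lower (i + 1) := by
    intro i
    induction i with
    | zero => exact fun v _ hv => hv
    | succ i ih =>
      intro v hv hv1
      obtain ⟨z, hz, _, _, hz'⟩ := key i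
      obtain ⟨c, hc⟩ := hz' v (ih v hv hv1)
      exact mem_lower_of_odd_of_smul_even hv hz hc
  have hle : A.part 1 ≤ Submodule.span ℂ {y} := by
    intro v hv
    obtain ⟨d, hd⟩ := h.decomp_odd hv
    have h0 := h.toChain.eq_zero (Nat.le_succ D)
      (hodd D _ (sub_mem hv (Submodule.smul_mem _ d h.hy)) hd)
    exact Submodule.mem_span_singleton.2 ⟨d, (sub_eq_zero.1 h0).symm⟩
  refine (Submodule.finrank_mono hle).trans ?_
  simpa using finrank_span_le_card (R := ℂ) ({y} : Set L)

theorem even_mem_lower_two (h : A.Mixed D x y) (hZ : A.bracket x x ∈ A.lower 2) {e : L}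
    (he : e ∈ A.part 0) (he1 : e ∈ A.lower 1) : e ∈ A.lower 2 :=
  h.even_induct hZ (fun p hp => A.lower_antitone (by omega) (bracket_mem_lower_succ hp x)) he he1

/-- Otherwise [x, y] alone would span the first layer. As [[x, y], y] = 0 and [[x, y], x] lies in
`lower 3`, the second layer would then vanish. -/
theorem bracket_y_x_notMem (h : A.Mixed D x y) (hD : 3 ≤ D) (hZ : A.bracket x x ∈ A.lower 2) :
    A.bracket y x ∉ A.lower 2 := by
  intro hyx
  have hw1 : A.bracket x y ∈ A.lower 1 := bracket_mem_lower_succ (i := 0) trivial y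
  have hyy : A.bracket y y ∈ A.lower 2 := h.even_mem_lower_two hZ (bracket_odd_odd h.hy h.hy)
    (bracket_mem_lower_succ (i := 0) trivial y)
  have hw : A.bracket x y ∉ A.lower 2 := by
    intro hw
    refine h.toChain.not_le_succ le_rfl (by omega) (lower_succ_le_of_forall (i := 0) fun u _ v => ?_)
    obtain ⟨a, b, l, hl, rfl⟩ := h.exists_eq u
    obtain ⟨c, d, l', hl', rfl⟩ := h.exists_eq v
    have hr : ∀ u, A.bracket u l' ∈ A.lower 2 := fun u =>
      h.leib.bracket_mem_lower (i := 0) (j := 1) trivial hl'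
    have hm : ∀ v, A.bracket l v ∈ A.lower 2 := fun v => bracket_mem_lower_succ hl v
    simp only [map_add, map_smul, LinearMap.add_apply, LinearMap.smul_apply]
    exact add_mem (add_mem (Submodule.smul_mem _ _ (add_mem (add_mem (Submodule.smul_mem _ _ hZ)
      (Submodule.smul_mem _ _ hyx)) (hm x))) (Submodule.smul_mem _ _ (add_mem (add_mem
      (Submodule.smul_mem _ _ hw) (Submodule.smul_mem _ _ hyy)) (hm y))))
      (add_mem (add_mem (Submodule.smul_mem _ _ (hr x)) (Submodule.smul_mem _ _ (hr y))) (hr l))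
  have hwx : A.bracket (A.bracket x y) x ∈ A.lower 3 := by
    have e := h.leib.even_right x y h.hx
    rw [eq_sub_iff_add_eq] at e
    rw [← e]
    exact add_mem (h.leib.bracket_mem_lower (i := 0) (j := 2) trivial hyx) (bracket_mem_lower_succ hZ y)
  refine h.toChain.not_le_succ (i := 2) (by omega) (by omega)
    (lower_succ_le_of_forall (i := 1) fun u hu v => ?_)
  obtain ⟨a, ha⟩ := h.toChain.exists_sub le_rfl hw1 hw hu
  obtain ⟨c, d, l, hl, rfl⟩ := h.exists_eq v
  have hu' : u = a • A.bracket x y + (u - a • A.bracket x y) := by abel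
  have hy0 := h.sq_zero h.hy x
  have hm : ∀ v, A.bracket (u - a • A.bracket x y) v ∈ A.lower 3 := fun v =>
    bracket_mem_lower_succ ha v
  generalize u - a • A.bracket x y = u' at hu' hm
  subst hu'
  rw [map_add, map_add, map_smul, map_smul]
  refine add_mem (add_mem (Submodule.smul_mem _ _ ?_) (Submodule.smul_mem _ _ ?_))
    (h.leib.bracket_mem_lower (j := 1) hu hl)
  · rw [map_add, LinearMap.add_apply, map_smul, LinearMap.smul_apply]
    exact add_mem (Submodule.smul_mem _ _ hwx) (hm x)
  · rw [map_add, LinearMap.add_apply, map_smul, LinearMap.smul_apply, hy0, smul_zero, zero_add]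
    exact hm y

end Mixed

end Superalgebra

/-! ### One even and one odd generator: the string R_x^i y fills the odd part. -/

namespace Superalgebra

variable {L : Type*} [AddCommGroup L] [Module ℂ L] {A : Superalgebra L}

/-- The string `y, [y, x], [[y, x], x], …`. -/
def rightString (A : Superalgebra L) (y x : L) (i : ℕ) : L := (A.rightMul x ^ i) y

theorem rightString_zero (y x : L) : A.rightString y x 0 = y := rfl

theorem rightString_succ (y x : L) (i : ℕ) :
    A.rightString y x (i + 1) = A.bracket (A.rightString y x i) x := by
  rw [rightString, pow_succ', Module.End.mul_apply]
  rfl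

theorem rightString_mem_lower (y x : L) (i : ℕ) : A.rightString y x i ∈ A.lower i := by
  induction i with
  | zero => trivial
  | succ i ih => rw [rightString_succ]; exact bracket_mem_lower_succ ih x

theorem rightString_odd {y x : L} (hy : y ∈ A.part 1) (hx : x ∈ A.part 0) (i : ℕ) :
    A.rightString y x i ∈ A.part 1 := by
  induction i with
  | zero => exact hy
  | succ i ih => rw [rightString_succ]; exact bracket_odd_even ih hx

theorem even_lower_one_odd_odd {a b : L} (ha : a ∈ A.part 1) (hb : b ∈ A.part 1) :
    A.bracket a b ∈ A.part 0 ∧ A.bracket a b ∈ A.lower 1 :=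
  ⟨bracket_odd_odd ha hb, bracket_mem_lower_succ (i := 0) trivial b⟩

namespace Mixed

variable {D : ℕ} {x y : L} [Module.Finite ℂ L]

/-- The number `s` is the length of the initial piece of the descending central sequence that is
spanned by the string `y, [y, x], [[y, x], x], …`. -/
theorem exists_length (h : A.Mixed D x y) (hD : 3 ≤ D) (hZ : A.bracket x x ∈ A.lower 2) :
    ∃ s, 1 ≤ s ∧ A.rightString y x (s + 1) ∈ A.lower (s + 2) ∧
      ∀ i ≤ s, A.rightString y x i ∉ A.lower (i + 1) := by
  classical
  have hex : ∃ s, A.rightString y x (s + 1) ∈ A.lower (s + 2) := by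
    refine ⟨D, ?_⟩
    rw [h.toChain.eq_zero (Nat.le_succ D) (rightString_mem_lower y x (D + 1))]
    exact zero_mem _
  refine ⟨Nat.find hex, ?_, Nat.find_spec hex, fun i hi => ?_⟩
  · rw [Nat.one_le_iff_ne_zero]
    intro h0
    have := Nat.find_spec hex
    rw [h0] at this
    exact h.bracket_y_x_notMem hD hZ this
  · cases i with
    | zero => exact h.hy1
    | succ i => exact Nat.find_min hex hi

variable {s : ℕ}

/-- Up to index s the string spans the odd content of each layer, so subtracting multiples of its
members pushes an odd vector down to `lower k`. -/
theorem odd_mem_span_sup (h : A.Mixed D x y)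
    (hs : ∀ i ≤ s, A.rightString y x i ∉ A.lower (i + 1)) {v : L} (hv : v ∈ A.part 1) (k : ℕ)
    (hk : k ≤ s + 1) : ∃ u ∈ Submodule.span ℂ (A.rightString y x '' Set.Iio k),
      v - u ∈ A.lower k ∧ v - u ∈ A.part 1 := by
  induction k with
  | zero => exact ⟨0, zero_mem _, trivial, by simpa using hv⟩
  | succ k ih =>
    obtain ⟨u, hu, hl, ho⟩ := ih (by omega)
    have hc : ∃ c : ℂ, v - u - c • A.rightString y x k ∈ A.lower (k + 1) := by
      cases k with
      | zero => exact h.decomp_odd ho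
      | succ k =>
        exact h.toChain.exists_sub (by omega) (rightString_mem_lower y x (k + 1))
          (hs (k + 1) (Nat.le_of_succ_le_succ hk)) hl
    obtain ⟨c, hc⟩ := hc
    refine ⟨u + c • A.rightString y x k, add_mem (Submodule.span_mono (Set.image_mono
      (Set.Iio_subset_Iio (by omega))) hu) (Submodule.smul_mem _ _ (Submodule.subset_span
      ⟨k, by simp, rfl⟩)), ?_, ?_⟩
    · rwa [← sub_sub]
    · rw [← sub_sub]
      exact sub_mem ho (Submodule.smul_mem _ _ (rightString_odd h.hy h.hx k))

/-- The layers 1, …, s are spanned by odd string vectors, so no even vector can stop in them. -/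
theorem even_mem_lower (h : A.Mixed D x y)
    (hs : ∀ i ≤ s, A.rightString y x i ∉ A.lower (i + 1)) {e : L} (he : e ∈ A.part 0)
    (he1 : e ∈ A.lower 1) : e ∈ A.lower (s + 1) := by
  have key : ∀ k ≤ s, e ∈ A.lower (k + 1) := by
    intro k
    induction k with
    | zero => exact fun _ => he1
    | succ k ih =>
      intro hk
      obtain ⟨c, hc⟩ := h.toChain.exists_sub (by omega) (rightString_mem_lower y x (k + 1))
        (hs _ hk) (ih (by omega))
      exact mem_lower_of_even_of_smul_odd he (rightString_odd h.hy h.hx _) hc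
  exact key s le_rfl

/-- Layer s is spanned by the last string vector, and modulo [L, L] only x and y multiply it. If
both products drop too far, layer s + 1 is empty and the sequence has ended. -/
theorem eq_bot_of_sq_mem (h : A.Mixed D x y) (hs1 : 1 ≤ s)
    (hs' : A.rightString y x (s + 1) ∈ A.lower (s + 2))
    (hs : ∀ i ≤ s, A.rightString y x i ∉ A.lower (i + 1))
    (hf : A.bracket (A.rightString y x s) y ∈ A.lower (s + 2)) : A.lower (s + 1) = ⊥ := by
  by_contra hne
  have hlt : s + 1 < D := by
    by_contra hcon
    exact hne ((Submodule.eq_bot_iff _).2 fun v hv => h.toChain.eq_zero (not_lt.1 hcon) hv)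
  refine h.toChain.not_le_succ (i := s + 1) (by omega) hlt
    (lower_succ_le_of_forall fun u hu v => ?_)
  have hF := rightString_mem_lower (A := A) y x s
  obtain ⟨a, ha⟩ := h.toChain.exists_sub hs1 hF (hs s le_rfl) hu
  obtain ⟨c, d, l, hl, rfl⟩ := h.exists_eq v
  have hu' : u = a • A.rightString y x s + (u - a • A.rightString y x s) := by abel
  have hm : ∀ v, A.bracket (u - a • A.rightString y x s) v ∈ A.lower (s + 2) := fun v =>
    bracket_mem_lower_succ ha v
  generalize u - a • A.rightString y x s = u' at hu' hm
  subst hu'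
  rw [rightString_succ] at hs'
  rw [map_add, map_add, map_smul, map_smul]
  refine add_mem (add_mem (Submodule.smul_mem _ _ ?_) (Submodule.smul_mem _ _ ?_))
    (h.leib.bracket_mem_lower (j := 1) hu hl)
  · rw [map_add, LinearMap.add_apply, map_smul, LinearMap.smul_apply]
    exact add_mem (Submodule.smul_mem _ _ hs') (hm x)
  · rw [map_add, LinearMap.add_apply, map_smul, LinearMap.smul_apply]
    exact add_mem (Submodule.smul_mem _ _ hf) (hm y)

/-- Write F_i for the string. Shifting one x from the left factor to the right one changes [F_{s-b},
F_b] only by a sign modulo `lower (s + 2)`: the error is [F_{s-b-1}, F_b] times x, and that even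
product already lies in `lower (s + 1)`. -/
theorem bracket_rightString_notMem (h : A.Mixed D x y)
    (hs : ∀ i ≤ s, A.rightString y x i ∉ A.lower (i + 1))
    (hf : A.bracket (A.rightString y x s) y ∉ A.lower (s + 2)) (b : ℕ) (hb : b ≤ s) :
    A.bracket (A.rightString y x (s - b)) (A.rightString y x b) ∉ A.lower (s + 2) := by
  induction b with
  | zero => exact hf
  | succ b ih =>
    intro hcon
    refine ih (by omega) ?_
    have e := h.leib.even_right (A.rightString y x (s - (b + 1))) (A.rightString y x b) h.hx
    rw [← rightString_succ, ← rightString_succ, show s - (b + 1) + 1 = s - b by omega,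
      eq_sub_iff_add_eq, ← eq_sub_iff_add_eq'] at e
    rw [e]
    obtain ⟨h0, h1⟩ := even_lower_one_odd_odd (rightString_odd h.hy h.hx (s - (b + 1)))
      (rightString_odd h.hy h.hx b)
    exact sub_mem (bracket_mem_lower_succ (h.even_mem_lower hs h0 h1) x) hcon

/-- If the odd vectors of `lower (s + 1)` lie in `lower p`, then the products of the even vectors of
`[L, L]` with the string lie in the next term. -/
theorem bracket_even_rightString_mem (h : A.Mixed D x y)
    (hs : ∀ i ≤ s, A.rightString y x i ∉ A.lower (i + 1))
    (hf : A.bracket (A.rightString y x s) y ∉ A.lower (s + 2))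
    {p : ℕ}
    (hp : ∀ v ∈ A.part 1, v ∈ A.lower (s + 1) → v ∈ A.lower p) (k : ℕ) :
    ∀ b, s + 1 ≤ b + k → ∀ e ∈ A.part 0, e ∈ A.lower 1 →
      A.bracket e (A.rightString y x b) ∈ A.lower (p + 1) := by
  have hFo := rightString_odd (A := A) h.hy h.hx
  have base : ∀ b, s + 1 ≤ b → ∀ e, A.bracket e (A.rightString y x b) ∈ A.lower (p + 1) :=
    fun b hb e => A.lower_antitone (by omega) (h.leib.bracket_mem_lower (i := 0) (u := e) trivial
      (hp _ (hFo b) (A.lower_antitone hb (rightString_mem_lower y x b))))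
  have hXb : ∀ e b, A.bracket (A.bracket e x) (A.rightString y x b) =
      A.bracket (A.bracket e (A.rightString y x b)) x - A.bracket e (A.rightString y x (b + 1)) :=
    fun e b => by rw [rightString_succ, h.leib.even_right _ _ h.hx]; abel
  induction k with
  | zero => exact fun b hb e _ _ => base b hb e
  | succ k ih =>
    intro b₀ hb₀
    by_cases hle : s + 1 ≤ b₀
    · exact fun e _ _ => base b₀ hle e
    -- Expand 0 = [[F_{s-b₀}, F_{b₀}], F_{b₀}] with the inner product written as c[x, x] + [e', x].
    -- That product is not in `lower (s + 2)`, hence c ≠ 0 and [[x, x], F_{b₀}] can be solved for.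
    have hZb₀ : A.bracket (A.bracket x x) (A.rightString y x b₀) ∈ A.lower (p + 1) := by
      obtain ⟨h0, h1⟩ := even_lower_one_odd_odd (hFo (s - b₀)) (hFo b₀)
      have hn := h.bracket_rightString_notMem hs hf b₀ (by omega)
      obtain ⟨c, e', he', he1', e⟩ := h.even_eq h0 h1
      have hc : c ≠ 0 := by
        rintro rfl
        rw [e, zero_smul, zero_add] at hn
        exact hn (bracket_mem_lower_succ (h.even_mem_lower hs he' he1') x)
      have hsq := h.sq_zero (hFo b₀) (A.rightString y x (s - b₀))
      rw [e, map_add, LinearMap.add_apply, map_smul, LinearMap.smul_apply, hXb e'] at hsq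
      have h2 : A.bracket e' (A.rightString y x (b₀ + 1)) ∈ A.lower (p + 1) :=
        ih (b₀ + 1) (by omega) e' he' he1'
      have h3 : A.bracket (A.bracket e' (A.rightString y x b₀)) x ∈ A.lower (p + 1) :=
        bracket_mem_lower_succ (hp _ (bracket_even_odd he' (hFo b₀)) (A.lower_antitone (by omega)
          (bracket_mem_lower_succ (h.even_mem_lower hs he' he1') _))) x
      have h4 : c • A.bracket (A.bracket x x) (A.rightString y x b₀) ∈ A.lower (p + 1) := by
        rw [eq_neg_of_add_eq_zero_left hsq]
        exact neg_mem (sub_mem h3 h2)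
      exact (Submodule.smul_mem_iff _ hc).1 h4
    -- All b ≥ b₀ are treated together, because moving x past F_b produces F_{b+1}.
    let P : Submodule ℂ L := ⨅ b : Set.Ici b₀,
      (A.lower (p + 1)).comap (A.bracket.flip (A.rightString y x b))
    have hP : ∀ e, e ∈ P ↔ ∀ b, b₀ ≤ b → A.bracket e (A.rightString y x b) ∈ A.lower (p + 1) := by
      intro e
      simp [P, Submodule.mem_iInf]
    intro e he he1
    refine (hP e).1 (h.even_induct ((hP _).2 fun b hb => ?_) (fun q hq => (hP _).2 fun b hb => ?_)
      he he1) b₀ le_rfl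
    · rcases hb.eq_or_lt with rfl | hlt
      · exact hZb₀
      · exact ih b (by omega) _ (bracket_even_even h.hx h.hx)
          (bracket_mem_lower_succ (i := 0) trivial x)
    · rw [hXb]
      exact sub_mem (A.lower_succ_le _ (bracket_mem_lower_succ ((hP q).1 hq b hb) x))
        ((hP q).1 hq (b + 1) (by omega))

/-- If `lower (s + 1)` is nonzero, then [x, x] spans layer s + 1, since otherwise every even product
would lie deeper and the layer would be empty. So odd vectors of `lower (s + 1)` fall into `lower (s
+ 2)`. There, modulo any depth already reached plus one, the generating products are even: the odd
ones come from an odd left factor that is already deep, or from an even vector times the string. -/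
theorem odd_eq_zero (h : A.Mixed D x y) (hs1 : 1 ≤ s)
    (hs' : A.rightString y x (s + 1) ∈ A.lower (s + 2))
    (hs : ∀ i ≤ s, A.rightString y x i ∉ A.lower (i + 1)) {v : L} (hv : v ∈ A.part 1)
    (hvs : v ∈ A.lower (s + 1)) : v = 0 := by
  by_cases hbot : A.lower (s + 1) = ⊥
  · rwa [hbot, Submodule.mem_bot] at hvs
  have hf : A.bracket (A.rightString y x s) y ∉ A.lower (s + 2) := fun hf =>
    hbot (h.eq_bot_of_sq_mem hs1 hs' hs hf)
  have hZ : A.bracket x x ∉ A.lower (s + 2) := by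
    intro hZ
    refine hf (h.even_induct hZ (fun p hp => A.lower_succ_le _ (bracket_mem_lower_succ hp x))
      (bracket_odd_odd (rightString_odd h.hy h.hx s) h.hy)
      (bracket_mem_lower_succ (i := 0) trivial y))
  have hZe := bracket_even_even h.hx h.hx
  have hZs : A.bracket x x ∈ A.lower (s + 1) :=
    h.even_mem_lower hs hZe (bracket_mem_lower_succ (i := 0) trivial x)
  have key : ∀ k, ∀ v ∈ A.part 1, v ∈ A.lower (s + 1) → v ∈ A.lower (s + 1 + k) := by
    intro k
    induction k with
    | zero => exact fun v _ hv => hv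
    | succ k ih =>
      intro v hv hvs
      have hb : ∀ e ∈ A.part 0, e ∈ A.lower 1 → ∀ b,
          A.bracket e (A.rightString y x b) ∈ A.lower (s + 1 + k + 1) := fun e he he1 b =>
        h.bracket_even_rightString_mem hs hf ih (s + 1) b (by omega) e he he1
      obtain ⟨c, hc⟩ := h.toChain.exists_sub (by omega) hZs hZ hvs
      have hv2 := mem_lower_of_odd_of_smul_even hv hZe hc
      have hle : A.lower (s + 1 + 1) ≤ A.part 0 ⊔ A.lower (s + 1 + k + 1) := by
        refine lower_succ_le_of_forall fun u hu w => ?_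
        obtain ⟨u₀, hu₀, u₁, hu₁, l₀, l₁, rfl⟩ := lower_graded hu
        obtain ⟨w₀, hw₀, w₁, hw₁, rfl⟩ := A.exists_even_add_odd w
        obtain ⟨q, hq, hwl, hwo⟩ := h.odd_mem_span_sup hs hw₁ (s + 1) le_rfl
        have h01 : A.bracket u₀ w₁ ∈ A.lower (s + 1 + k + 1) := by
          have hq' : A.bracket u₀ q ∈ A.lower (s + 1 + k + 1) := by
            have : Submodule.span ℂ (A.rightString y x '' Set.Iio (s + 1)) ≤
                (A.lower (s + 1 + k + 1)).comap (A.bracket u₀) := by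
              rw [Submodule.span_le]
              rintro _ ⟨b, _, rfl⟩
              exact hb u₀ hu₀ (A.lower_antitone (by omega) l₀) b
            exact this hq
          have hr : A.bracket u₀ (w₁ - q) ∈ A.lower (s + 1 + k + 1) :=
            A.lower_antitone (by omega)
              (h.leib.bracket_mem_lower (i := 0) (u := u₀) trivial (ih _ hwo hwl))
          have := add_mem hq' hr
          rwa [← map_add, add_sub_cancel] at this
        rw [map_add, map_add, LinearMap.add_apply, LinearMap.add_apply]
        refine add_mem (add_mem (Submodule.mem_sup_left (bracket_even_even hu₀ hw₀))
          (Submodule.mem_sup_right (bracket_mem_lower_succ (ih u₁ hu₁ l₁) w₀)))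
          (add_mem (Submodule.mem_sup_right h01)
          (Submodule.mem_sup_left (bracket_odd_odd hu₁ hw₁)))
      obtain ⟨e, he, l, hl, hel⟩ := Submodule.mem_sup.1 (hle hv2)
      refine (mem_lower_of_add (neg_mem he) hv (i := s + 1 + k + 1) ?_).2
      rwa [← hel, neg_add_cancel_left]
  exact h.toChain.eq_zero (by omega) (key D v hv hvs)

/-- An even and an odd generator: the even generator acts on the odd part as one Jordan block. -/
theorem hasJordanBlocks_odd (h : A.Mixed D x y) (hD : 3 ≤ D)
    (hZ : A.bracket x x ∈ A.lower 2) :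
    HasJordanBlocks (A.rightMul x) (A.part 1) [Module.finrank ℂ (A.part 1)] := by
  obtain ⟨s, hs1, hs', hs⟩ := h.exists_length hD hZ
  have hzero : A.rightString y x (s + 1) = 0 := h.odd_eq_zero hs1 hs' hs
    (rightString_odd h.hy h.hx _) (rightString_mem_lower y x _)
  have hspan : A.part 1 ≤ Submodule.span ℂ (A.rightString y x '' Set.Iio (s + 1)) := by
    intro v hv
    obtain ⟨u, hu, hl, ho⟩ := h.odd_mem_span_sup hs hv (s + 1) le_rfl
    rwa [sub_eq_zero.1 (h.odd_eq_zero hs1 hs' hs ho hl)]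
  -- Each string vector separates two consecutive terms within the odd part, which gives s + 1 ≤ dim
  -- L₁; the spanning property gives the converse.
  have hge : ∀ k, k ≤ s + 1 →
      k ≤ Module.finrank ℂ (A.part 1 ⊓ A.lower (s + 1 - k) : Submodule ℂ L) := by
    intro k
    induction k with
    | zero => intro _; omega
    | succ k ih =>
      intro hk
      refine lt_of_le_of_lt (ih (by omega)) (Submodule.finrank_lt_finrank_of_lt ?_)
      refine lt_of_le_of_ne (inf_le_inf_left _ (A.lower_antitone (by omega))) fun e => ?_
      have hF : A.rightString y x (s + 1 - (k + 1)) ∈ A.part 1 ⊓ A.lower (s + 1 - (k + 1)) :=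
        ⟨rightString_odd h.hy h.hx _, rightString_mem_lower y x _⟩
      rw [← e] at hF
      refine hs (s + 1 - (k + 1)) (by omega) ?_
      rw [show s + 1 - (k + 1) + 1 = s + 1 - k by omega]
      exact hF.2
  have hr : s + 1 ≤ Module.finrank ℂ (A.part 1) :=
    (hge (s + 1) le_rfl).trans (Submodule.finrank_mono inf_le_left)
  have hr' : Module.finrank ℂ (A.part 1) = s + 1 := by
    refine le_antisymm ((Submodule.finrank_mono hspan).trans ?_) hr
    rw [Set.image_eq_range]
    refine (finrank_range_le_card _).trans ?_
    simp
  rw [hr']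
  refine hasJordanBlocks_of_strings (by simp) (by simp) (fun _ => y)
    (fun _ k => rightString_odd h.hy h.hx k) (fun i => ?_) ?_ (by simpa using hr')
  · obtain rfl : i = ⟨0, by simp⟩ := Subsingleton.elim (α := Fin 1) _ _
    exact hzero
  · refine hspan.trans (Submodule.span_mono ?_)
    rintro _ ⟨k, hk, rfl⟩
    exact ⟨⟨0, by simp⟩, k, hk, rfl⟩

end Mixed

end Superalgebra

/-! ### Both generators are odd; a string through all layers. -/

namespace Superalgebra

variable {L : Type*} [AddCommGroup L] [Module ℂ L] {A : Superalgebra L}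

theorem InClass.chain {n : ℕ} (h : A.InClass n (n + 2)) (hn : 1 ≤ n) : A.Chain (2 * n + 1) := by
  obtain ⟨hL, hfin, h0, h1, _, hN, hbot, hne⟩ := h
  have hdim : Module.finrank ℂ L = 2 * n + 1 + 1 := by
    rw [← Submodule.finrank_add_eq_of_isCompl A.isCompl, h0, h1]
    omega
  have hb : A.lower (2 * n + 1) = ⊥ := by
    rw [← hbot]; congr 1; omega
  refine ⟨hL, by omega, hb, hdim, hL.finrank_lower (by omega) hdim hb fun i hi => ?_⟩
  have := hne (i + 1) (by omega) (by omega)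
  simpa using this

/-- The odd part is not contained in `[L, L]`. -/
theorem Chain.exists_odd_notMem {D : ℕ} [Module.Finite ℂ L] (h : A.Chain D)
    (hpos : 1 ≤ Module.finrank ℂ (A.part 1)) : ∃ y ∈ A.part 1, y ∉ A.lower 1 := by
  by_contra! hodd
  -- If all odd vectors lay in [L, L], each odd product would gain a step and the odd part would
  -- sink through the whole sequence.
  have key : ∀ i, ∀ v ∈ A.part 1, v ∈ A.lower i → v ∈ A.lower (i + 1) := by
    intro i
    induction i with
    | zero => exact fun v hv _ => hodd v hv
    | succ i ih =>
      intro v hv hvi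
      have hle : A.lower (i + 1) ≤ A.part 0 ⊔ A.lower (i + 1 + 1) := by
        refine lower_succ_le_of_forall fun u hu w => ?_
        obtain ⟨u₀, hu₀, u₁, hu₁, l₀, l₁, rfl⟩ := lower_graded hu
        obtain ⟨w₀, hw₀, w₁, hw₁, rfl⟩ := A.exists_even_add_odd w
        rw [map_add, map_add, LinearMap.add_apply, LinearMap.add_apply]
        exact add_mem (add_mem (Submodule.mem_sup_left (bracket_even_even hu₀ hw₀))
          (Submodule.mem_sup_right (bracket_mem_lower_succ (ih u₁ hu₁ l₁) w₀)))
          (add_mem (Submodule.mem_sup_right (h.leib.bracket_mem_lower (j := 1) l₀ (hodd _ hw₁)))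
          (Submodule.mem_sup_left (bracket_odd_odd hu₁ hw₁)))
      obtain ⟨e, he, l, hl, hel⟩ := Submodule.mem_sup.1 (hle hvi)
      refine (mem_lower_of_add (neg_mem he) hv (i := i + 1 + 1) ?_).2
      rwa [← hel, neg_add_cancel_left]
  have hall : ∀ i, ∀ v ∈ A.part 1, v ∈ A.lower i := by
    intro i
    induction i with
    | zero => exact fun _ _ => trivial
    | succ i ih => exact fun v hv => key i v hv (ih v hv)
  have hbot : A.part 1 = ⊥ := (Submodule.eq_bot_iff _).2 fun v hv =>
    h.eq_zero le_rfl (hall D v hv)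
  rw [hbot, finrank_bot] at hpos
  omega

/-- The even part of an algebra of the class is contained in `[L, L]`: both generators are odd. -/
theorem InClass.even_le {n : ℕ} (h : A.InClass n (n + 2)) (hn : 1 ≤ n) {e : L}
    (he : e ∈ A.part 0) : e ∈ A.lower 1 := by
  have hc := h.chain hn
  obtain ⟨hL, hfin, h0, h1, ⟨⟨⟨u, hu, hu', hJ⟩, _⟩, _, hmax⟩, _⟩ := h
  by_contra hel
  obtain ⟨z, hz, hz'⟩ := hJ.exists_cyclic
  have hzl : z ∉ A.lower 1 := fun hzl => by
    obtain ⟨c, q, hq, rfl⟩ := hz' e he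
    exact hel (add_mem (Submodule.smul_mem _ _ hzl) (bracket_mem_lower_succ (i := 0) trivial u))
  have himage : ∀ e ∈ A.part 0, e ∈ A.lower 1 → ∃ e' ∈ A.part 0, e = A.bracket e' u := by
    intro e he hel
    obtain ⟨c, q, hq, rfl⟩ := hz' e he
    have hq1 : A.rightMul u q ∈ A.lower 1 := bracket_mem_lower_succ (i := 0) trivial u
    by_cases hc0 : c = 0
    · exact ⟨q, hq, by rw [hc0, zero_smul, zero_add]; rfl⟩
    · exact absurd ((Submodule.smul_mem_iff _ hc0).1 ((Submodule.add_mem_iff_left _ hq1).1 hel)) hzl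
  -- Otherwise u = [q, u] with q even, so u would lie in [L₀, L₀], which the choice of u excludes.
  have hul : u ∉ A.lower 1 := fun hul => by
    obtain ⟨q, hq, hqu⟩ := himage u hu hul
    exact hu' (by rw [hqu]; exact Submodule.apply_mem_map₂ _ hq hu)
  obtain ⟨y, hy, hyl⟩ := hc.exists_odd_notMem (by omega)
  have hM : A.Mixed (2 * n + 1) u y := ⟨hc, hu, hy, hul, hyl, himage⟩
  by_cases hZ : A.bracket u u ∈ A.lower 2
  -- One block of size n + 2 beats the assumed maximum (n + 1, 1) lexicographically.
  · have hJ' := hM.hasJordanBlocks_odd (by omega) hZ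
    rw [h1] at hJ'
    have := hmax ⟨u, hu, hu', hJ'⟩
    rw [← not_lt] at this
    exact this (List.cons_lt_cons_iff.2 (Or.inl (by omega)))
  · have := hM.finrank_odd_le hZ
    omega

/-- The Leibniz identity for two odd arguments is symmetric in them. -/
theorem bracket_swap_eq_zero (hA : A.IsLeibniz) {a b : L} (ha : a ∈ A.part 1) (hb : b ∈ A.part 1)
    (w : L) : A.bracket w (A.bracket a b - A.bracket b a) = 0 := by
  rw [map_sub, hA.odd w ha hb, hA.odd w hb ha]
  abel

/-- Both generators are odd. -/
structure OddGenerated (A : Superalgebra L) (n : ℕ) : Prop extends A.Chain (2 * n + 1) where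
  one_le : 1 ≤ n
  even_le : ∀ e ∈ A.part 0, e ∈ A.lower 1

namespace OddGenerated

variable {n : ℕ}

/-- An even right factor lies in [L, L] and gains two steps, so only odd right factors reach the
next layer and parity alternates: layer i has parity i + 1. -/
theorem parity (h : A.OddGenerated n) (i : ℕ) :
    ∀ v ∈ A.part (i : ZMod 2), v ∈ A.lower i → v ∈ A.lower (i + 1) := by
  induction i with
  | zero => exact fun v hv _ => h.even_le v hv
  | succ i ih =>
    intro v hv hvi
    have h2 : ∀ c : ZMod 2, c = 0 ∨ c = 1 := by decide
    have hmul : ∀ u ∈ A.lower i, ∀ w ∈ A.part 0, A.bracket u w ∈ A.lower (i + 1 + 1) :=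
      fun u hu w hw => h.leib.bracket_mem_lower (j := 1) hu (h.even_le w hw)
    rw [Nat.cast_succ] at hv
    obtain hi | hi := h2 (i : ZMod 2) <;> rw [hi] at ih hv
    · have hle : A.lower (i + 1) ≤ A.part 0 ⊔ A.lower (i + 1 + 1) := by
        refine lower_succ_le_of_forall fun u hu w => ?_
        obtain ⟨u₀, hu₀, u₁, hu₁, l₀, l₁, rfl⟩ := lower_graded hu
        obtain ⟨w₀, hw₀, w₁, hw₁, rfl⟩ := A.exists_even_add_odd w
        rw [map_add (A.bracket (u₀ + u₁)), map_add, LinearMap.add_apply]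
        exact add_mem (Submodule.mem_sup_right (by
            rw [← LinearMap.add_apply, ← map_add]; exact hmul _ hu w₀ hw₀))
          (add_mem (Submodule.mem_sup_right (bracket_mem_lower_succ (ih _ hu₀ l₀) w₁))
          (Submodule.mem_sup_left (bracket_odd_odd hu₁ hw₁)))
      obtain ⟨e, he, l, hl, hel⟩ := Submodule.mem_sup.1 (hle hvi)
      refine (mem_lower_of_add (neg_mem he) (by simpa using hv) (i := i + 1 + 1) ?_).2
      rwa [← hel, neg_add_cancel_left]
    · have hle : A.lower (i + 1) ≤ A.part 1 ⊔ A.lower (i + 1 + 1) := by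
        refine lower_succ_le_of_forall fun u hu w => ?_
        obtain ⟨u₀, hu₀, u₁, hu₁, l₀, l₁, rfl⟩ := lower_graded hu
        obtain ⟨w₀, hw₀, w₁, hw₁, rfl⟩ := A.exists_even_add_odd w
        rw [map_add (A.bracket (u₀ + u₁)), map_add, LinearMap.add_apply]
        exact add_mem (Submodule.mem_sup_right (by
            rw [← LinearMap.add_apply, ← map_add]; exact hmul _ hu w₀ hw₀))
          (add_mem (Submodule.mem_sup_left (bracket_even_odd hu₀ hw₁))
          (Submodule.mem_sup_right (bracket_mem_lower_succ (ih _ hu₁ l₁) w₁)))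
      obtain ⟨e, he, l, hl, hel⟩ := Submodule.mem_sup.1 (hle hvi)
      have hv' : v ∈ A.part 0 := by rwa [show (1 : ZMod 2) + 1 = 0 from rfl] at hv
      refine (mem_lower_of_add hv' (neg_mem he) (i := i + 1 + 1) ?_).1
      rwa [← hel, add_neg_cancel_comm]

theorem parity_even (h : A.OddGenerated n) (j : ℕ) {v : L} (hv : v ∈ A.part 0)
    (hl : v ∈ A.lower (2 * j)) : v ∈ A.lower (2 * j + 1) := by
  refine h.parity (2 * j) v ?_ hl
  rwa [Nat.cast_mul, show ((2 : ℕ) : ZMod 2) = 0 from rfl, zero_mul]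

theorem parity_odd (h : A.OddGenerated n) (j : ℕ) {v : L} (hv : v ∈ A.part 1)
    (hl : v ∈ A.lower (2 * j + 1)) : v ∈ A.lower (2 * j + 2) := by
  refine h.parity (2 * j + 1) v ?_ hl
  rwa [Nat.cast_succ, Nat.cast_mul, show ((2 : ℕ) : ZMod 2) = 0 from rfl, zero_mul, zero_add]

/-- If an even element acts on the odd part with a block of size `n + 1`, then it acts nontrivially
on the quotients of the descending central sequence. -/
theorem exists_bracket_notMem (h : A.OddGenerated n) {v z : L} (hv : v ∈ A.part 0)
    (hz : z ∈ A.part 1) (hne : A.rightString z v n ≠ 0) (j : ℕ) (hj : j < n) :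
    ∃ w ∈ A.lower (2 * j), A.bracket w v ∉ A.lower (2 * j + 3) := by
  by_contra! hcon
  have hstep : ∀ i, ∀ w ∈ A.lower i, A.bracket w v ∈ A.lower (i + 2) := fun i w hw =>
    h.leib.bracket_mem_lower (j := 1) hw (h.even_le v hv)
  have h1 : ∀ k, A.rightString z v k ∈ A.lower (2 * k) := by
    intro k
    induction k with
    | zero => trivial
    | succ k ih => rw [rightString_succ]; exact hstep _ _ ih
  -- A missed jump at j puts the string one step ahead, parity adds another, and the lead is never
  -- lost. So R_v^n z would lie in `lower (2n + 2)`, which is zero.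
  have h2 : ∀ k, A.rightString z v (j + 1 + k) ∈ A.lower (2 * (j + 1 + k) + 2) := by
    intro k
    induction k with
    | zero =>
      have := hcon _ (h1 j)
      rw [← rightString_succ] at this
      exact h.parity_odd (j + 1) (rightString_odd hz hv _) this
    | succ k ih => rw [← add_assoc, rightString_succ]; exact hstep _ _ ih
  have := h2 (n - (j + 1))
  rw [show j + 1 + (n - (j + 1)) = n by omega] at this
  exact hne (h.toChain.eq_zero (by omega) this)

variable [Module.Finite ℂ L]

/-- If all odd squares were in `lower 2`, polarization would leave only differences [a, b] - [b, a]
to span the first layer. These act by zero from the right, so v, a multiple of one of them modulo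
`lower 3`, could not act nontrivially. Hence no product would reach the first layer. -/
theorem exists_sq_notMem (h : A.OddGenerated n) {v : L} (hv : v ∈ A.part 0)
    (hjump : ∃ w, A.bracket w v ∉ A.lower 3) :
    ∃ y ∈ A.part 1, A.bracket y y ∉ A.lower 2 := by
  by_contra! hsq
  have hab : ∀ a ∈ A.part 1, ∀ b ∈ A.part 1, A.bracket a b ∈ A.lower 2 := by
    intro a ha b hb
    have hsum : A.bracket a b + A.bracket b a ∈ A.lower 2 := by
      have e : A.bracket a b + A.bracket b a =
          A.bracket (a + b) (a + b) - A.bracket a a - A.bracket b b := by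
        simp only [map_add, LinearMap.add_apply]
        abel
      rw [e]
      exact sub_mem (sub_mem (hsq _ (add_mem ha hb)) (hsq a ha)) (hsq b hb)
    by_cases hd : A.bracket a b - A.bracket b a ∈ A.lower 2
    · have := add_mem hsum hd
      rw [show A.bracket a b + A.bracket b a + (A.bracket a b - A.bracket b a) =
        (2 : ℂ) • A.bracket a b by module] at this
      exact (Submodule.smul_mem_iff _ two_ne_zero).1 this
    · exfalso
      have hde : A.bracket a b - A.bracket b a ∈ A.part 0 :=
        sub_mem (bracket_odd_odd ha hb) (bracket_odd_odd hb ha)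
      obtain ⟨c, hc⟩ := h.toChain.exists_sub le_rfl (h.even_le _ hde) hd (h.even_le v hv)
      have hc3 := h.parity_even 1 (sub_mem hv (Submodule.smul_mem _ c hde)) hc
      obtain ⟨w, hw⟩ := hjump
      have e : A.bracket w v = A.bracket w (v - c • (A.bracket a b - A.bracket b a)) := by
        rw [map_sub, map_smul, bracket_swap_eq_zero h.leib ha hb, smul_zero, sub_zero]
      rw [e] at hw
      exact hw (A.lower_antitone (by omega)
        (h.leib.bracket_mem_lower (i := 0) (u := w) (j := 3) trivial hc3))
  have h1 := h.one_le
  refine h.toChain.not_le_succ (i := 1) le_rfl (by omega)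
    (lower_succ_le_of_forall (i := 0) fun u _ w => ?_)
  obtain ⟨u₀, hu₀, u₁, hu₁, rfl⟩ := A.exists_even_add_odd u
  obtain ⟨w₀, hw₀, w₁, hw₁, rfl⟩ := A.exists_even_add_odd w
  rw [map_add (A.bracket (u₀ + u₁)), map_add A.bracket, LinearMap.add_apply, LinearMap.add_apply]
  have hl : ∀ w, A.bracket u₀ w ∈ A.lower 2 := fun w => bracket_mem_lower_succ (h.even_le u₀ hu₀) w
  exact add_mem (add_mem (hl _)
    (h.leib.bracket_mem_lower (i := 0) (j := 1) trivial (h.even_le w₀ hw₀)))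
    (add_mem (hl _) (hab _ hu₁ _ hw₁))

/-- The even v is a multiple of [y, y] modulo `lower 3`, and R_{[y,y]} = 2R_y². So the jumps of R_v
by two are jumps of R_y², and R_y is nonzero between any two consecutive layers that it has to join.
-/
theorem rightString_notMem (h : A.OddGenerated n) {v y : L} (hv : v ∈ A.part 0)
    (hjump : ∀ j < n, ∃ w ∈ A.lower (2 * j), A.bracket w v ∉ A.lower (2 * j + 3))
    (hy : y ∈ A.part 1) (hyy : A.bracket y y ∉ A.lower 2) (i : ℕ) (hi : i ≤ 2 * n) :
    A.rightString y y i ∉ A.lower (i + 1) := by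
  have hyye := bracket_odd_odd hy hy
  obtain ⟨c, hc⟩ := h.toChain.exists_sub le_rfl (h.even_le _ hyye) hyy (h.even_le v hv)
  have hc3 := h.parity_even 1 (sub_mem hv (Submodule.smul_mem _ c hyye)) hc
  have hj2 : ∀ j < n, ∃ w ∈ A.lower (2 * j), A.bracket (A.bracket w y) y ∉ A.lower (2 * j + 3) := by
    intro j hj
    obtain ⟨w, hw, hwv⟩ := hjump j hj
    refine ⟨w, hw, fun hcon => hwv ?_⟩
    have e : A.bracket w v = (2 * c) • A.bracket (A.bracket w y) y +
        A.bracket w (v - c • A.bracket y y) := by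
      rw [map_sub, map_smul, h.leib.odd w hy hy]
      module
    rw [e]
    exact add_mem (Submodule.smul_mem _ _ hcon) (A.lower_antitone (by omega)
      (h.leib.bracket_mem_lower (j := 3) hw hc3))
  have hj1 : ∀ i < 2 * n, ∃ w ∈ A.lower i, A.bracket w y ∉ A.lower (i + 2) := by
    intro i hi
    obtain ⟨j, rfl | rfl⟩ := Nat.even_or_odd' i
    · obtain ⟨w, hw, hwy⟩ := hj2 j (by omega)
      exact ⟨w, hw, fun hcon => hwy (bracket_mem_lower_succ hcon y)⟩
    · obtain ⟨w, hw, hwy⟩ := hj2 j (by omega)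
      exact ⟨_, bracket_mem_lower_succ hw y, hwy⟩
  induction i with
  | zero => exact fun hcon => hyy (bracket_mem_lower_succ hcon y)
  | succ i ih =>
    cases i with
    | zero => exact hyy
    | succ i =>
      intro hcon
      obtain ⟨w, hw, hwy⟩ := hj1 (i + 1) (by omega)
      obtain ⟨c, hc⟩ := h.toChain.exists_sub (by omega) (rightString_mem_lower y y (i + 1))
        (ih (by omega)) hw
      refine hwy ?_
      have e : A.bracket w y = c • A.rightString y y (i + 1 + 1) +
          A.bracket (w - c • A.rightString y y (i + 1)) y := by
        rw [rightString_succ, map_sub, map_smul, LinearMap.sub_apply, LinearMap.smul_apply]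
        abel
      rw [e]
      exact add_mem (Submodule.smul_mem _ _ hcon) (bracket_mem_lower_succ hc y)

end OddGenerated

/-- In an algebra of the class some odd `y` generates a string through all terms of the descending
central sequence. -/
theorem InClass.exists_rightString {n : ℕ} (h : A.InClass n (n + 2)) (hn : 1 ≤ n) :
    ∃ y ∈ A.part 1, ∀ i ≤ 2 * n, A.rightString y y i ∉ A.lower (i + 1) := by
  have hG : A.OddGenerated n := ⟨h.chain hn, hn, fun e he => h.even_le hn he⟩
  obtain ⟨_, hfin, _, _, ⟨_, ⟨v, hv, _, hJ'⟩, _⟩, _⟩ := h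
  obtain ⟨q, hq, hq'⟩ := hJ'.exists_pow_ne_zero
  have hjump := hG.exists_bracket_notMem hv hq hq'
  obtain ⟨w, _, hw⟩ := hjump 0 hn
  obtain ⟨y, hy, hyy⟩ := hG.exists_sq_notMem hv ⟨w, hw⟩
  exact ⟨y, hy, hG.rightString_notMem hv hjump hy hyy⟩

end Superalgebra

/-! ### Normalizing the second generator and reading off the parameters. -/

namespace Superalgebra

variable {L : Type*} [AddCommGroup L] [Module ℂ L] {A : Superalgebra L}

open LeibnizFamily in
/-- Two odd generators `y` and `w` that satisfy the relations of `L(β)`. -/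
structure IsPresentation (A : Superalgebra L) (n : ℕ) (β : Fin (numParams n) → ℂ) (y w : L) :
    Prop where
  leib : A.IsLeibniz
  hy : y ∈ A.part 1
  hw : w ∈ A.part 1
  wy : A.bracket w y = 0
  ww : A.bracket w w = 0
  yw : A.bracket y w = ∑ r ∈ Finset.Ico ((n + 1) / 2) n,
    (-2 * 2 ^ r * entry β (r + 2)) • A.rightString y y (2 * r + 1)
  top : A.rightString y y (2 * n + 1) = 0
  gen : Submodule.span ℂ (insert w (Set.range (A.rightString y y))) = ⊤

theorem rightString_self_parity {y : L} (hy : y ∈ A.part 1) (r : ℕ) :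
    A.rightString y y (2 * r) ∈ A.part 1 ∧ A.rightString y y (2 * r + 1) ∈ A.part 0 := by
  induction r with
  | zero => exact ⟨hy, bracket_odd_odd hy hy⟩
  | succ r ih =>
    have h1 : A.rightString y y (2 * (r + 1)) ∈ A.part 1 := by
      rw [show 2 * (r + 1) = 2 * r + 1 + 1 by ring, rightString_succ]
      exact bracket_even_odd ih.2 hy
    exact ⟨h1, by rw [rightString_succ]; exact bracket_odd_odd h1 hy⟩

theorem span_rightString_le (y : L) :
    Submodule.span ℂ (Set.range (A.rightString y y)) ≤ Submodule.span ℂ {y} ⊔ A.lower 1 := by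
  rw [Submodule.span_le]
  rintro _ ⟨i, rfl⟩
  cases i with
  | zero => exact Submodule.mem_sup_left (Submodule.mem_span_singleton_self _)
  | succ i =>
    exact Submodule.mem_sup_right
      (A.lower_antitone (by omega) (rightString_mem_lower y y (i + 1)))

/-- R_{[w,y]} is the anticommutator of R_w and R_y. -/
theorem IsLeibniz.bracket_bracket_of_bracket_eq_zero (hA : A.IsLeibniz) {y w : L}
    (hy : y ∈ A.part 1) (hw : w ∈ A.part 1) (hwy : A.bracket w y = 0) (z : L) :
    A.bracket (A.bracket z y) w = - A.bracket (A.bracket z w) y := by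
  have := hA.odd z hw hy
  rw [hwy, map_zero] at this
  exact (neg_eq_of_add_eq_zero_right this.symm).symm

namespace OddGenerated

variable {n : ℕ} [Module.Finite ℂ L] {y : L}

/-- Each layer from the first on is spanned by a string vector, which is R_y of its predecessor;
descending induction thus gives preimages under R_y. -/
theorem mem_map_span (h : A.OddGenerated n)
    (hs : ∀ i ≤ 2 * n, A.rightString y y i ∉ A.lower (i + 1)) (k : ℕ) :
    ∀ i, 1 ≤ i → i + k = 2 * n + 1 → ∀ v ∈ A.lower i,
      ∃ q ∈ Submodule.span ℂ (Set.range (A.rightString y y)), v = A.bracket q y := by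
  induction k with
  | zero =>
    intro i _ hi v hv
    rw [h.toChain.eq_zero (by omega) hv]
    exact ⟨0, zero_mem _, by simp⟩
  | succ k ih =>
    intro i hi hik v hv
    obtain ⟨c, hc⟩ := h.toChain.exists_sub hi (rightString_mem_lower y y i) (hs i (by omega)) hv
    obtain ⟨q, hq, e⟩ := ih (i + 1) (by omega) (by omega) _ hc
    refine ⟨q + c • A.rightString y y (i - 1),
      add_mem hq (Submodule.smul_mem _ _ (Submodule.subset_span ⟨_, rfl⟩)), ?_⟩
    rw [map_add, map_smul, LinearMap.add_apply, LinearMap.smul_apply, ← rightString_succ, ← e,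
      show i - 1 + 1 = i by omega, sub_add_cancel]

theorem lower_one_le_span (h : A.OddGenerated n)
    (hs : ∀ i ≤ 2 * n, A.rightString y y i ∉ A.lower (i + 1)) :
    A.lower 1 ≤ Submodule.span ℂ (Set.range (A.rightString y y)) := by
  intro v hv
  obtain ⟨q, hq, rfl⟩ := h.mem_map_span hs (2 * n) 1 le_rfl (by omega) v hv
  have : Submodule.span ℂ (Set.range (A.rightString y y)) ≤
      (Submodule.span ℂ (Set.range (A.rightString y y))).comap (A.rightMul y) := by
    rw [Submodule.span_le]
    rintro _ ⟨i, rfl⟩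
    exact Submodule.subset_span ⟨i + 1, rightString_succ y y i⟩
  exact this hq

theorem exists_odd_complement (h : A.OddGenerated n) (y : L) :
    ∃ w ∈ A.part 1, ∀ c : ℂ, w - c • y ∉ A.lower 1 := by
  by_contra! hcon
  have htop : (⊤ : Submodule ℂ L) ≤ A.lower 1 ⊔ Submodule.span ℂ {y} := by
    intro v _
    obtain ⟨v₀, hv₀, v₁, hv₁, rfl⟩ := A.exists_even_add_odd v
    obtain ⟨c, hc⟩ := hcon v₁ hv₁
    refine Submodule.mem_sup.2 ⟨v₀ + (v₁ - c • y), add_mem (h.even_le v₀ hv₀) hc, c • y,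
      Submodule.mem_span_singleton.2 ⟨c, rfl⟩, by abel⟩
  have h1 := Submodule.finrank_mono htop
  have h2 := Submodule.finrank_add_le_finrank_add_finrank (A.lower 1) (Submodule.span ℂ {y})
  have h3 : Module.finrank ℂ (Submodule.span ℂ {y}) ≤ 1 := by
    simpa using finrank_span_le_card (R := ℂ) ({y} : Set L)
  rw [finrank_top, h.dim] at h1
  rw [h.rank 1 le_rfl (by omega)] at h2
  omega

/-- Subtract from any complement w' the odd part of a preimage of [w', y] under R_y. That correction
lies in ⟨y⟩ + [L, L], so independence of y modulo [L, L] is kept. -/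
theorem exists_commuting (h : A.OddGenerated n) (hy : y ∈ A.part 1)
    (hs : ∀ i ≤ 2 * n, A.rightString y y i ∉ A.lower (i + 1)) :
    ∃ w ∈ A.part 1, A.bracket w y = 0 ∧ ∀ c : ℂ, w - c • y ∉ A.lower 1 := by
  obtain ⟨w', hw', hc'⟩ := h.exists_odd_complement y
  obtain ⟨q, hq, e⟩ := h.mem_map_span hs (2 * n) 1 le_rfl (by omega) (A.bracket w' y)
    (bracket_mem_lower_succ (i := 0) trivial y)
  obtain ⟨_, hq', l, hl, rfl⟩ := Submodule.mem_sup.1 (span_rightString_le y hq)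
  obtain ⟨c, rfl⟩ := Submodule.mem_span_singleton.1 hq'
  obtain ⟨l₀, hl₀, l₁, hl₁, m₀, m₁, rfl⟩ := lower_graded hl
  have hq₁ : c • y + l₁ ∈ A.part 1 := add_mem (Submodule.smul_mem _ _ hy) hl₁
  have e' : A.bracket w' y = A.bracket (c • y + l₁) y := by
    have : A.bracket w' y + 0 = A.bracket (c • y + l₁) y + A.bracket l₀ y := by
      rw [e, add_zero]
      simp only [map_add, LinearMap.add_apply]
      abel
    exact (add_unique (bracket_odd_odd hw' hy) (zero_mem _) (bracket_odd_odd hq₁ hy)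
      (bracket_even_odd hl₀ hy) this).1
  refine ⟨w' - (c • y + l₁), sub_mem hw' hq₁, ?_, fun d hd => hc' (c + d) ?_⟩
  · rw [map_sub, LinearMap.sub_apply, e', sub_self]
  · have := add_mem hd m₁
    rwa [show w' - (c • y + l₁) - d • y + l₁ = w' - (c + d) • y by module] at this

/-- R_y is injective from each layer 1, …, 2n - 1 to the next, and the last layer 2n is odd. -/
theorem eq_zero_of_bracket_eq_zero (h : A.OddGenerated n)
    (hs : ∀ i ≤ 2 * n, A.rightString y y i ∉ A.lower (i + 1)) {z : L} (hz : z ∈ A.part 0)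
    (hzy : A.bracket z y = 0) : z = 0 := by
  have h1 := h.one_le
  have key : ∀ i, i < 2 * n → z ∈ A.lower (i + 1) := by
    intro i
    induction i with
    | zero => exact fun _ => h.even_le z hz
    | succ i ih =>
      intro hi
      obtain ⟨c, hc⟩ := h.toChain.exists_sub (by omega) (rightString_mem_lower y y (i + 1))
        (hs _ (by omega)) (ih (by omega))
      have hb := bracket_mem_lower_succ hc y
      rw [map_sub, LinearMap.sub_apply, hzy, map_smul, LinearMap.smul_apply, ← rightString_succ,
        zero_sub] at hb
      have hb' := neg_mem hb
      rw [neg_neg] at hb'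
      by_cases hc0 : c = 0
      · simpa [hc0] using hc
      · exact absurd ((Submodule.smul_mem_iff _ hc0).1 hb') (hs (i + 1 + 1) (by omega))
  have h2 := key (2 * n - 1) (by omega)
  rw [show 2 * n - 1 + 1 = 2 * n by omega] at h2
  exact h.toChain.eq_zero le_rfl (h.parity_even n hz h2)

/-- Right multiplication by `w` shifts the descending central sequence as far as it moves `y`. -/
theorem bracket_mem_lower_add (h : A.OddGenerated n) (hy : y ∈ A.part 1)
    (hs : ∀ i ≤ 2 * n, A.rightString y y i ∉ A.lower (i + 1)) {w : L} (hw : w ∈ A.part 1)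
    (hwy : A.bracket w y = 0) {p : ℕ} (hp : A.bracket y w ∈ A.lower p) (k : ℕ) :
    ∀ i, 1 ≤ i → i + k = 2 * n + 1 → ∀ v ∈ A.lower i, A.bracket v w ∈ A.lower (i + p) := by
  have hstring : ∀ i, A.bracket (A.rightString y y i) w ∈ A.lower (i + p) := by
    intro i
    induction i with
    | zero => rwa [zero_add]
    | succ i ih =>
      rw [rightString_succ, h.leib.bracket_bracket_of_bracket_eq_zero hy hw hwy,
        show i + 1 + p = i + p + 1 by ring]
      exact neg_mem (bracket_mem_lower_succ ih y)
  induction k with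
  | zero =>
    intro i _ hi v hv
    rw [h.toChain.eq_zero (by omega) hv]
    simp
  | succ k ih =>
    intro i hi hik v hv
    obtain ⟨c, hc⟩ := h.toChain.exists_sub hi (rightString_mem_lower y y i) (hs i (by omega)) hv
    have h1 := ih (i + 1) (by omega) (by omega) _ hc
    have h2 := add_mem (A.lower_antitone (by omega : i + p ≤ i + 1 + p) h1)
      (Submodule.smul_mem _ c (hstring i))
    rwa [map_sub, map_smul, LinearMap.sub_apply, LinearMap.smul_apply, sub_add_cancel] at h2

/-- As [w, w] = 0, also [[y, w], w] = 0. A leading term a F_{2j+1} of [y, w] (F_i the string of y)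
would contribute -a² F_{4j+2} to it, by anticommutation of R_w and R_y. This is nonzero as long as
4j + 2 ≤ 2n, so a = 0 for j < ⌊(n+1)/2⌋. -/
theorem bracket_y_w_mem (h : A.OddGenerated n) (hy : y ∈ A.part 1)
    (hs : ∀ i ≤ 2 * n, A.rightString y y i ∉ A.lower (i + 1)) {w : L} (hw : w ∈ A.part 1)
    (hwy : A.bracket w y = 0) (hww : A.bracket w w = 0) (j : ℕ) (hj : j ≤ (n + 1) / 2) :
    A.bracket y w ∈ A.lower (2 * j + 1) := by
  induction j with
  | zero => exact h.even_le _ (bracket_odd_odd hy hw)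
  | succ j ih =>
    have hl := ih (by omega)
    obtain ⟨a, ha⟩ := h.toChain.exists_sub (by omega) (rightString_mem_lower y y (2 * j + 1))
      (hs _ (by omega)) hl
    have hg := h.parity_even (j + 1) (sub_mem (bracket_odd_odd hy hw)
      (Submodule.smul_mem _ a (rightString_self_parity hy j).2)) ha
    set g := A.bracket y w - a • A.rightString y y (2 * j + 1) with hgdef
    have hT : A.bracket (A.bracket y w) w = 0 := by
      have := h.leib.odd y hw hw
      rw [hww, map_zero, ← two_smul ℂ, eq_comm, smul_eq_zero_iff_right two_ne_zero] at this
      exact this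
    have hstring : ∀ i, a • A.bracket (A.rightString y y i) w -
        ((-1) ^ i * a ^ 2) • A.rightString y y (i + (2 * j + 1)) ∈
          A.lower (i + (2 * j + 2)) := by
      intro i
      induction i with
      | zero =>
        have : a • A.bracket y w - ((-1) ^ 0 * a ^ 2) • A.rightString y y (0 + (2 * j + 1)) =
            a • g := by
          rw [hgdef, zero_add]
          module
        rw [rightString_zero, this]
        exact Submodule.smul_mem _ _ (A.lower_antitone (by omega) hg)
      | succ i ih =>
        have := neg_mem (bracket_mem_lower_succ ih y)
        rw [rightString_succ, h.leib.bracket_bracket_of_bracket_eq_zero hy hw hwy,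
          show i + 1 + (2 * j + 1) = i + (2 * j + 1) + 1 by ring,
          show i + 1 + (2 * j + 2) = i + (2 * j + 2) + 1 by ring, rightString_succ]
        convert this using 1
        simp only [map_sub, map_smul, LinearMap.sub_apply, LinearMap.smul_apply, pow_succ]
        module
    by_cases ha0 : a = 0
    · have : A.bracket y w = g := by rw [hgdef, ha0, zero_smul, sub_zero]
      rw [this]; exact hg
    · exfalso
      have hmem := hstring (2 * j + 1)
      have hgw := h.bracket_mem_lower_add hy hs hw hwy hl (2 * n + 1 - (2 * (j + 1) + 1))
        (2 * (j + 1) + 1) (by omega) (by omega) g hg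
      have hsum : a • A.bracket (A.rightString y y (2 * j + 1)) w = - A.bracket g w := by
        rw [eq_neg_iff_add_eq_zero, hgdef, map_sub, LinearMap.sub_apply, hT, map_smul,
          LinearMap.smul_apply]
        abel
      rw [hsum] at hmem
      have h3 := add_mem hmem (A.lower_antitone
        (by omega : 2 * j + 1 + (2 * j + 2) ≤ 2 * (j + 1) + 1 + (2 * j + 1)) hgw)
      rw [sub_add_eq_add_sub, neg_add_cancel, zero_sub] at h3
      have h4 := neg_mem h3
      rw [neg_neg] at h4
      have hne : (-1) ^ (2 * j + 1) * a ^ 2 ≠ 0 :=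
        mul_ne_zero (pow_ne_zero _ (by norm_num)) (pow_ne_zero _ ha0)
      exact hs (2 * j + 1 + (2 * j + 1)) (by omega) ((Submodule.smul_mem_iff _ hne).1 h4)

theorem even_eq_sum (h : A.OddGenerated n) (hy : y ∈ A.part 1)
    (hs : ∀ i ≤ 2 * n, A.rightString y y i ∉ A.lower (i + 1)) (k : ℕ) :
    ∀ j, j + k = n → ∀ v ∈ A.part 0, v ∈ A.lower (2 * j + 1) →
      ∃ a : ℕ → ℂ, v = ∑ r ∈ Finset.Ico j n, a r • A.rightString y y (2 * r + 1) := by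
  induction k with
  | zero =>
    intro j hj v _ hvl
    exact ⟨0, by rw [h.toChain.eq_zero (by omega) hvl]; simp⟩
  | succ k ih =>
    intro j hj v hv hvl
    obtain ⟨c, hc⟩ := h.toChain.exists_sub (by omega) (rightString_mem_lower y y (2 * j + 1))
      (hs _ (by omega)) hvl
    have hve := sub_mem hv (Submodule.smul_mem _ c (rightString_self_parity hy j).2)
    obtain ⟨a, ha⟩ := ih (j + 1) (by omega) _ hve (h.parity_even (j + 1) hve hc)
    refine ⟨fun r => if r = j then c else a r, ?_⟩
    rw [← Finset.sum_Ioo_add_eq_sum_Ico (by omega)]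
    simp only [if_true]
    rw [← sub_eq_iff_eq_add, ha]
    refine Finset.sum_congr ?_ fun r hr => ?_
    · ext r; simp
    · rw [if_neg]
      simp at hr
      omega

theorem exists_presentation (h : A.OddGenerated n) (hy : y ∈ A.part 1)
    (hs : ∀ i ≤ 2 * n, A.rightString y y i ∉ A.lower (i + 1)) :
    ∃ β w, A.IsPresentation n β y w := by
  obtain ⟨w, hw, hwy, hwc⟩ := h.exists_commuting hy hs
  have hww : A.bracket w w = 0 := by
    refine h.eq_zero_of_bracket_eq_zero hs (bracket_odd_odd hw hw) ?_
    have := h.leib.bracket_bracket_of_bracket_eq_zero hy hw hwy w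
    rw [hwy, map_zero, LinearMap.zero_apply, eq_comm, neg_eq_zero] at this
    exact this
  obtain ⟨a, ha⟩ := h.even_eq_sum hy hs (n - (n + 1) / 2) ((n + 1) / 2) (by omega) _
    (bracket_odd_odd hy hw) (h.bracket_y_w_mem hy hs hw hwy hww _ le_rfl)
  -- The component p is β_{r+2} with r = p + ⌊(n+1)/2⌋. The divisor comes from [y_1, y_{n+2}] = -2 ∑
  -- β_{r+2} x_{r+1} and x_{r+1} = 2^r F_{2r+1}.
  refine ⟨fun p => a (p.val + (n + 1) / 2) / (-2 * 2 ^ (p.val + (n + 1) / 2)), w, h.leib, hy, hw,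
    hwy, hww, ?_, ?_, ?_⟩
  · rw [ha]
    refine Finset.sum_congr rfl fun r hr => ?_
    rw [Finset.mem_Ico] at hr
    rw [LeibnizFamily.entry, dif_pos (by rw [LeibnizFamily.numParams]; omega)]
    have : r + 2 - (n + 5) / 2 + (n + 1) / 2 = r := by omega
    simp only [this]
    rw [mul_div_cancel₀]
    exact mul_ne_zero (by norm_num) (pow_ne_zero _ two_ne_zero)
  · exact h.toChain.eq_zero le_rfl (rightString_mem_lower y y _)
  · rw [Submodule.eq_top_iff']
    intro v
    have hy1 : y ∉ A.lower 1 := hs 0 (by omega)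
    obtain ⟨c, d, hl⟩ := h.toChain.exists_sub_sub hy1 hwc v
    have h1 := Submodule.span_mono (Set.subset_insert w _) (h.lower_one_le_span hs hl)
    have h2 : y ∈ Submodule.span ℂ (insert w (Set.range (A.rightString y y))) :=
      Submodule.subset_span (Or.inr ⟨0, rfl⟩)
    have h3 : w ∈ Submodule.span ℂ (insert w (Set.range (A.rightString y y))) :=
      Submodule.subset_span (Or.inl rfl)
    have := add_mem (add_mem h1 (Submodule.smul_mem _ d h3)) (Submodule.smul_mem _ c h2)
    rwa [sub_add_cancel, sub_add_cancel] at this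

end OddGenerated

end Superalgebra

/-! ### Coordinates and sums in the model. -/

namespace LeibnizFamily

theorem bracket_single {n : ℕ} (β : Fin (numParams n) → ℂ) (p q : Fin n ⊕ Fin (n + 2)) :
    bracket β (Pi.single p 1) (Pi.single q 1) = table β p q := by
  rw [bracket_apply, Finset.sum_eq_single p, Finset.sum_eq_single q]
  · simp
  · intro b _ hb; simp [hb]
  · simp
  · intro b _ hb; simp [hb]
  · simp

theorem x_eq_single {n : ℕ} (a : Fin n) : x n (a.val + 1) = Pi.single (Sum.inl a) 1 := by
  funext t
  rcases t with t | t
  · simp [x, Pi.single_apply, Fin.ext_iff]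
  · simp [x]

theorem y_eq_single {n : ℕ} (a : Fin (n + 2)) : y n (a.val + 1) = Pi.single (Sum.inr a) 1 := by
  funext t
  rcases t with t | t
  · simp [y]
  · simp [y, Pi.single_apply, Fin.ext_iff]

theorem x_eq_zero {n i : ℕ} (h : n ≤ i) : x n (i + 1) = 0 := by
  funext t
  rcases t with t | t
  · have := t.2
    simp [x]
    omega
  · rfl

/-- Shifts the index by 2 and frees the range from its dependence on the row of the table; the added
terms vanish. -/
theorem sum_Icc_eq_sum_Ico {M : Type*} [AddCommMonoid M] {n N : ℕ} (hN : N ≤ n + 1) {F : ℕ → M}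
    (hF : ∀ k, N < k → F k = 0) :
    ∑ k ∈ Finset.Icc ((n + 5) / 2) N, F k = ∑ r ∈ Finset.Ico ((n + 1) / 2) n, F (r + 2) := by
  rw [Finset.sum_Ico_add' F, show (n + 1) / 2 + 2 = (n + 5) / 2 by omega]
  refine Finset.sum_subset (fun k hk => ?_) fun k _ hk => hF k ?_
  · rw [Finset.mem_Icc] at hk
    rw [Finset.mem_Ico]
    omega
  · rw [Finset.mem_Icc] at hk
    by_contra hcon
    simp at *
    omega

theorem finrank_space (n : ℕ) : Module.finrank ℂ (Space n) = n + (n + 2) := by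
  simp

end LeibnizFamily

/-! ### The relations determine the whole multiplication table. -/

namespace Superalgebra.IsPresentation

open LeibnizFamily

variable {L : Type*} [AddCommGroup L] [Module ℂ L] {A : Superalgebra L} {n : ℕ}
  {β : Fin (numParams n) → ℂ} {y w : L}

theorem rightString_eq_zero (h : A.IsPresentation n β y w) {i : ℕ} (hi : 2 * n + 1 ≤ i) :
    A.rightString y y i = 0 := by
  induction i, hi using Nat.le_induction with
  | base => exact h.top
  | succ i _ ih => rw [rightString_succ, ih, map_zero, LinearMap.zero_apply]

theorem bracket_one (h : A.IsPresentation n β y w) (z : L) :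
    A.bracket z (A.rightString y y 1) = (2 : ℂ) • A.bracket (A.bracket z y) y := by
  rw [rightString_succ, rightString_zero, h.leib.odd z h.hy h.hy, two_smul]

/-- R_{[y,y]} = 2R_y² commutes with R_y, so [[y, y], y] acts by zero, and so does every later string
vector. -/
theorem bracket_add_two (h : A.IsPresentation n β y w) (i : ℕ) (z : L) :
    A.bracket z (A.rightString y y (i + 2)) = 0 := by
  induction i generalizing z with
  | zero =>
    rw [rightString_succ, h.leib.even_left z y (rightString_self_parity h.hy 0).2, h.bracket_one,
      h.bracket_one, map_smul, LinearMap.smul_apply, sub_self]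
  | succ i ih =>
    rw [rightString_succ]
    obtain ⟨j, e | e⟩ := Nat.even_or_odd' (i + 2)
    · have := (rightString_self_parity h.hy j).1
      rw [← e] at this
      rw [show i + 1 + 1 = i + 2 from rfl, h.leib.odd z this h.hy, ih, ih]
      simp
    · have := (rightString_self_parity h.hy j).2
      rw [← e] at this
      rw [show i + 1 + 1 = i + 2 from rfl, h.leib.even_left z y this, ih, ih]
      simp

theorem bracket_w (h : A.IsPresentation n β y w) (i : ℕ) :
    A.bracket w (A.rightString y y i) = 0 := by
  match i with
  | 0 => exact h.wy
  | 1 => rw [h.bracket_one, h.wy, map_zero, LinearMap.zero_apply, smul_zero]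
  | i + 2 => exact h.bracket_add_two i w

theorem rightString_bracket_w (h : A.IsPresentation n β y w) (i : ℕ) :
    A.bracket (A.rightString y y i) w = (-1 : ℂ) ^ i • ∑ r ∈ Finset.Ico ((n + 1) / 2) n,
      (-2 * 2 ^ r * entry β (r + 2)) • A.rightString y y (2 * r + 1 + i) := by
  induction i with
  | zero => rw [rightString_zero, h.yw, pow_zero, one_smul]
  | succ i ih =>
    rw [rightString_succ, h.leib.bracket_bracket_of_bracket_eq_zero h.hy h.hw h.wy, ih, map_smul,
      LinearMap.smul_apply, pow_succ, mul_neg_one, neg_smul, map_sum, LinearMap.sum_apply]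
    refine congrArg _ (congrArg _ (Finset.sum_congr rfl fun r _ => ?_))
    rw [map_smul, LinearMap.smul_apply, ← add_assoc, rightString_succ]

/-- The images of the basis vectors. -/
def basisImage (A : Superalgebra L) (n : ℕ) (y w : L) : Fin n ⊕ Fin (n + 2) → L :=
  Sum.elim (fun a => (2 : ℂ) ^ a.val • A.rightString y y (2 * a.val + 1))
    (fun b => if b.val = n + 1 then w else (2 : ℂ) ^ b.val • A.rightString y y (2 * b.val))

/-- The linear map that sends the basis of the model to the images of the basis vectors. -/
noncomputable def map (A : Superalgebra L) (n : ℕ) (y w : L) : Space n →ₗ[ℂ] L :=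
  (Pi.basisFun ℂ (Fin n ⊕ Fin (n + 2))).constr ℂ (basisImage A n y w)

theorem map_single (p : Fin n ⊕ Fin (n + 2)) :
    map A n y w (Pi.single p 1) = basisImage A n y w p := by
  rw [map, ← Pi.basisFun_apply, Module.Basis.constr_basis]

theorem map_apply (u : Space n) : map A n y w u = ∑ p, u p • basisImage A n y w p := by
  rw [map, Module.Basis.constr_apply_fintype]
  simp

theorem map_x (h : A.IsPresentation n β y w) (a : ℕ) :
    map A n y w (x n (a + 1)) = (2 : ℂ) ^ a • A.rightString y y (2 * a + 1) := by
  by_cases ha : a < n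
  · exact (congrArg _ (x_eq_single ⟨a, ha⟩)).trans (map_single _)
  · rw [x_eq_zero (by omega), map_zero, h.rightString_eq_zero (by omega), smul_zero]

theorem map_y {a : ℕ} (ha : a ≤ n) :
    map A n y w (LeibnizFamily.y n (a + 1)) = (2 : ℂ) ^ a • A.rightString y y (2 * a) := by
  refine (congrArg _ (y_eq_single ⟨a, by omega⟩)).trans ((map_single _).trans ?_)
  simp only [basisImage, Sum.elim_inr]
  rw [if_neg (by omega)]

theorem map_sum_y (h : A.IsPresentation n β y w) {a : ℕ} (ha : a < n) :
    map A n y w (∑ k ∈ Finset.Icc ((n + 5) / 2) (n + 2 - (a + 1)),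
      entry β k • LeibnizFamily.y n (k - 1 + (a + 1))) =
    ∑ r ∈ Finset.Ico ((n + 1) / 2) n,
      entry β (r + 2) • (2 : ℂ) ^ (r + 1 + a) • A.rightString y y (2 * (r + 1 + a)) := by
  rw [map_sum, Finset.sum_congr rfl (g := fun k =>
    entry β k • (2 : ℂ) ^ (k - 1 + a) • A.rightString y y (2 * (k - 1 + a))),
    sum_Icc_eq_sum_Ico (by omega)]
  · exact Finset.sum_congr rfl fun r _ => by rw [show r + 2 - 1 = r + 1 by omega]
  · intro k hk
    rw [h.rightString_eq_zero (by omega), smul_zero, smul_zero]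
  · intro k hk
    rw [Finset.mem_Icc] at hk
    rw [map_smul, ← add_assoc, map_y (by omega)]

theorem map_sum_x (h : A.IsPresentation n β y w) {a : ℕ} :
    map A n y w (∑ k ∈ Finset.Icc ((n + 5) / 2) (n + 2 - (a + 1)),
      entry β k • LeibnizFamily.x n (k - 2 + (a + 1))) =
    ∑ r ∈ Finset.Ico ((n + 1) / 2) n,
      entry β (r + 2) • (2 : ℂ) ^ (r + a) • A.rightString y y (2 * (r + a) + 1) := by
  rw [map_sum, Finset.sum_congr rfl (g := fun k =>
    entry β k • (2 : ℂ) ^ (k - 2 + a) • A.rightString y y (2 * (k - 2 + a) + 1)),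
    sum_Icc_eq_sum_Ico (by omega)]
  · exact Finset.sum_congr rfl fun r _ => by rw [show r + 2 - 2 = r by omega]
  · intro k hk
    rw [h.rightString_eq_zero (by omega), smul_zero, smul_zero]
  · intro k hk
    rw [map_smul, ← add_assoc, h.map_x]

/-- The relations give every product of string vectors and w. Outside the index ranges of `table`
only string vectors of index above 2n occur, and these vanish; for the products with y_{n+2} this is
⌊n/2⌋ + ⌊(n+1)/2⌋ = n. -/
theorem map_table (h : A.IsPresentation n β y w) (p q : Fin n ⊕ Fin (n + 2)) :
    map A n y w (table β p q) =
      A.bracket (basisImage A n y w p) (basisImage A n y w q) := by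
  have hs : ∀ i, A.bracket (A.rightString y y i) y = A.rightString y y (i + 1) :=
    fun i => (rightString_succ y y i).symm
  have hone : ∀ i, A.bracket (A.rightString y y i) (A.rightString y y 1) =
      (2 : ℂ) • A.rightString y y (i + 2) := fun i => by rw [h.bracket_one, hs, hs]
  rcases p with a | a <;> rcases q with b | b <;>
    simp only [table, basisImage, Sum.elim_inl, Sum.elim_inr] <;>
    have ha := a.2 <;> have hb := b.2
  · rw [map_smul, map_smul, LinearMap.smul_apply]
    rcases Nat.eq_zero_or_pos b.val with hb | hb
    · rw [hb, pow_zero, one_smul, mul_zero, zero_add, hone, smul_smul, ← pow_succ]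
      split_ifs with hc
      · rw [h.map_x]; rfl
      · rw [map_zero, h.rightString_eq_zero (by omega), smul_zero]
    · rw [if_neg (by omega), map_zero, show 2 * b.val + 1 = (2 * b.val - 1) + 2 by omega,
        h.bracket_add_two, smul_zero, smul_zero]
  · rcases Nat.eq_zero_or_pos b.val with hb0 | hb0
    · rw [if_pos (by omega), if_neg (by omega), map_smul, map_y (by omega), hb0, pow_zero,
        one_smul, map_smul, LinearMap.smul_apply, mul_zero, rightString_zero, hs, smul_smul,
        pow_succ]
      congr 1
      ring
    rw [if_neg (by omega)]
    by_cases hbn : b.val = n + 1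
    · rw [if_pos hbn, map_smul, LinearMap.smul_apply, h.rightString_bracket_w]
      split_ifs with hc
      · rw [h.map_sum_y ha, Finset.smul_sum, Finset.smul_sum]
        refine Finset.sum_congr rfl fun r _ => ?_
        rw [smul_smul, smul_smul, smul_smul,
          show 2 * r + 1 + (2 * a.val + 1) = 2 * (r + 1 + a.val) by ring]
        congr 1
        rw [pow_succ (-1 : ℂ), pow_mul]
        ring
      · rw [map_zero, Finset.sum_eq_zero, smul_zero, smul_zero]
        intro r hr
        rw [Finset.mem_Ico] at hr
        rw [h.rightString_eq_zero (by omega), smul_zero]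
    · rw [if_neg (by omega), if_neg hbn, map_zero, map_smul,
        show 2 * b.val = (2 * b.val - 2) + 2 by omega, h.bracket_add_two, smul_zero]
  · by_cases han : a.val = n + 1
    · rw [if_neg (by omega), if_pos han, map_smul, h.bracket_w, map_zero, smul_zero]
    rw [if_neg han, map_smul, map_smul, LinearMap.smul_apply]
    rcases Nat.eq_zero_or_pos b.val with hb | hb
    · rw [hb, pow_zero, one_smul, mul_zero, zero_add, hone, smul_smul, ← pow_succ]
      split_ifs with hc
      · rw [map_y (by omega)]; rfl
      · rw [map_zero, h.rightString_eq_zero (by omega), smul_zero]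
    · rw [if_neg (by omega), map_zero, show 2 * b.val + 1 = (2 * b.val - 1) + 2 by omega,
        h.bracket_add_two, smul_zero, smul_zero]
  · by_cases han : a.val = n + 1
    · rw [if_neg (by omega), if_neg (by omega), if_pos han, map_zero]
      split_ifs with hc
      · exact h.ww.symm
      · rw [map_smul, h.bracket_w, smul_zero]
    rw [if_neg han, map_smul, LinearMap.smul_apply]
    rcases Nat.eq_zero_or_pos b.val with hb0 | hb0
    · rw [if_neg (show ¬ b.val = n + 1 by omega), hb0, pow_zero, one_smul, mul_zero,
        rightString_zero, hs]
      split_ifs with hc hd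
      · rw [h.map_x]
      · omega
      · rw [map_zero, h.rightString_eq_zero (by omega), smul_zero]
    rw [if_neg (by omega)]
    by_cases hbn : b.val = n + 1
    · rw [if_pos hbn, h.rightString_bracket_w]
      split_ifs with hc
      · rw [map_smul, h.map_sum_x, Finset.smul_sum, Finset.smul_sum, Finset.smul_sum]
        refine Finset.sum_congr rfl fun r _ => ?_
        rw [smul_smul, smul_smul, smul_smul, smul_smul,
          show 2 * r + 1 + 2 * a.val = 2 * (r + a.val) + 1 by ring]
        congr 1
        rw [pow_mul]
        ring
      · rw [map_zero, Finset.sum_eq_zero, smul_zero, smul_zero]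
        intro r hr
        rw [Finset.mem_Ico] at hr
        rw [h.rightString_eq_zero (by omega), smul_zero]
    · rw [if_neg (by omega), if_neg hbn, map_zero, map_smul,
        show 2 * b.val = (2 * b.val - 2) + 2 by omega, h.bracket_add_two, smul_zero, smul_zero]

theorem map_bracket (h : A.IsPresentation n β y w) (u v : Space n) :
    map A n y w (LeibnizFamily.bracket β u v) = A.bracket (map A n y w u) (map A n y w v) := by
  rw [bracket_apply, map_apply u, map_apply v]
  simp only [map_sum, map_smul, LinearMap.sum_apply, LinearMap.smul_apply, h.map_table,
    Finset.smul_sum, smul_smul]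
  rw [Finset.sum_comm]
  simp only [mul_comm]

theorem map_mem_part (h : A.IsPresentation n β y w) (a : ZMod 2) (u : Space n)
    (hu : u ∈ LeibnizFamily.part n a) : map A n y w u ∈ A.part a := by
  rw [map_apply]
  refine Submodule.sum_mem _ fun p _ => ?_
  have h2 : ∀ c : ZMod 2, c = 0 ∨ c = 1 := by decide
  obtain rfl | rfl := h2 a
  · rw [part_zero] at hu
    rcases p with p | p
    · exact Submodule.smul_mem _ _ (Submodule.smul_mem _ _ (rightString_self_parity h.hy _).2)
    · rw [hu p, zero_smul]
      exact zero_mem _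
  · rw [part_one] at hu
    rcases p with p | p
    · rw [hu p, zero_smul]
      exact zero_mem _
    · refine Submodule.smul_mem _ _ ?_
      simp only [basisImage, Sum.elim_inr]
      split_ifs
      · exact h.hw
      · exact Submodule.smul_mem _ _ (rightString_self_parity h.hy _).1

theorem map_surjective (h : A.IsPresentation n β y w) : Function.Surjective (map A n y w) := by
  rw [← LinearMap.range_eq_top, eq_top_iff, ← h.gen, Submodule.span_le]
  have hp : ∀ (a : ℕ) (u : L) (v : Space n), map A n y w v = (2 : ℂ) ^ a • u →
      u ∈ LinearMap.range (map A n y w) := fun a u v e =>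
    (Submodule.smul_mem_iff _ (pow_ne_zero a (two_ne_zero (α := ℂ)))).1 (e ▸ ⟨v, rfl⟩)
  rintro _ (rfl | ⟨i, rfl⟩)
  · refine ⟨Pi.single (Sum.inr (Fin.last (n + 1))) 1, ?_⟩
    rw [map_single]
    simp [basisImage]
  · obtain ⟨a, rfl | rfl⟩ := Nat.even_or_odd' i
    · by_cases ha : a ≤ n
      · exact hp a _ _ (map_y ha)
      · rw [h.rightString_eq_zero (by omega)]
        exact zero_mem _
    · exact hp a _ _ (h.map_x a)

/-- A superalgebra of dimension `2n + 2` with a presentation is isomorphic to the model. -/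
theorem iso (h : A.IsPresentation n β y w) [Module.Finite ℂ L]
    (hdim : Module.finrank ℂ L = 2 * n + 2) : (algebra β).Iso A := by
  have hinj : Function.Injective (map A n y w) := by
    rw [LinearMap.injective_iff_surjective_of_finrank_eq_finrank]
    · exact h.map_surjective
    · rw [finrank_space, hdim]
      ring
  exact ⟨LinearEquiv.ofBijective _ ⟨hinj, h.map_surjective⟩, h.map_mem_part, h.map_bracket⟩

end Superalgebra.IsPresentation

theorem Superalgebra.InClass.exists_iso {L : Type*} [AddCommGroup L] [Module ℂ L]
    {A : Superalgebra L} {n : ℕ} (h : A.InClass n (n + 2)) (hn : 1 ≤ n) :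
    ∃ β : Fin (LeibnizFamily.numParams n) → ℂ, (LeibnizFamily.algebra β).Iso A := by
  have hG : A.OddGenerated n := ⟨h.chain hn, hn, fun e he => h.even_le hn he⟩
  obtain ⟨y, hy, hs⟩ := h.exists_rightString hn
  have := h.2.1
  obtain ⟨β, w, hP⟩ := hG.exists_presentation hy hs
  exact ⟨β, hP.iso hG.dim⟩

/-! ### Products in the model, expressed in the rescaled basis `E`. -/

noncomputable section

namespace LeibnizFamily

variable {n : ℕ}

/-- The vectors `y_1, x_1, y_2 / 2, x_2 / 2, y_3 / 4, …`, which right multiplication by `y_1` moves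
to one another. -/
def E (n i : ℕ) : Space n :=
  if Even i then (if i ≤ 2 * n then ((2 : ℂ) ^ (i / 2))⁻¹ • y n (i / 2 + 1) else 0)
  else ((2 : ℂ) ^ (i / 2))⁻¹ • x n (i / 2 + 1)

theorem E_even {a : ℕ} (ha : a ≤ n) : E n (2 * a) = ((2 : ℂ) ^ a)⁻¹ • y n (a + 1) := by
  rw [E, if_pos (even_two_mul a), if_pos (by omega), Nat.mul_div_cancel_left _ two_pos]

theorem E_odd (a : ℕ) : E n (2 * a + 1) = ((2 : ℂ) ^ a)⁻¹ • x n (a + 1) := by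
  rw [E, if_neg (by simp), show (2 * a + 1) / 2 = a by omega]

theorem E_eq_zero {i : ℕ} (hi : 2 * n + 1 ≤ i) : E n i = 0 := by
  obtain ⟨a, rfl | rfl⟩ := Nat.even_or_odd' i
  · rw [E, if_pos (even_two_mul a), if_neg (by omega)]
  · rw [E_odd, x_eq_zero (by omega), smul_zero]

theorem y_eq_E {a : ℕ} (ha : a ≤ n) : y n (a + 1) = (2 : ℂ) ^ a • E n (2 * a) := by
  rw [E_even ha, smul_inv_smul₀ (pow_ne_zero _ two_ne_zero)]

theorem x_eq_E (a : ℕ) : x n (a + 1) = (2 : ℂ) ^ a • E n (2 * a + 1) := by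
  rw [E_odd, smul_inv_smul₀ (pow_ne_zero _ two_ne_zero)]

theorem E_zero : E n 0 = y n 1 := by
  rw [← mul_zero 2, E_even (Nat.zero_le n)]
  simp

theorem y_one : y n 1 = Pi.single (Sum.inr 0) 1 := y_eq_single (0 : Fin (n + 2))

theorem y_last : y n (n + 2) = Pi.single (Sum.inr (Fin.last (n + 1))) 1 :=
  y_eq_single (Fin.last (n + 1))

theorem x_one (hn : 1 ≤ n) : x n 1 = Pi.single (Sum.inl ⟨0, hn⟩) 1 := x_eq_single ⟨0, hn⟩

variable (β : Fin (numParams n) → ℂ)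

theorem span_E (n : ℕ) : Submodule.span ℂ (insert (y n (n + 2)) (Set.range (E n))) = ⊤ := by
  rw [Submodule.eq_top_iff']
  intro v
  have hv : v = ∑ p, v p • (Pi.single p 1 : Space n) := by
    funext t
    simp [Finset.sum_apply, Pi.single_apply]
  rw [hv]
  refine Submodule.sum_mem _ fun p _ => Submodule.smul_mem _ _ ?_
  rcases p with p | p
  · rw [← x_eq_single, x_eq_E]
    exact Submodule.smul_mem _ _ (Submodule.subset_span (Or.inr ⟨_, rfl⟩))
  · rw [← y_eq_single]
    by_cases hp : p.val ≤ n
    · rw [y_eq_E hp]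
      exact Submodule.smul_mem _ _ (Submodule.subset_span (Or.inr ⟨_, rfl⟩))
    · refine Submodule.subset_span (Or.inl ?_)
      congr 1
      omega

theorem hom_ext {M : Type*} [AddCommGroup M] [Module ℂ M] {f g : Space n →ₗ[ℂ] M}
    (hE : ∀ i, f (E n i) = g (E n i)) (hw : f (y n (n + 2)) = g (y n (n + 2))) : f = g := by
  refine LinearMap.ext_on (span_E n) ?_
  rintro _ (rfl | ⟨i, rfl⟩)
  · exact hw
  · exact hE i

theorem bracket_E_y (i : ℕ) : bracket β (E n i) (y n 1) = E n (i + 1) := by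
  rcases lt_or_ge (2 * n) i with hi | hi
  · rw [E_eq_zero hi, E_eq_zero (by omega), map_zero, LinearMap.zero_apply]
  obtain ⟨a, rfl | rfl⟩ := Nat.even_or_odd' i
  · rw [E_even (by omega), map_smul, LinearMap.smul_apply, E_odd, y_one,
      (y_eq_single ⟨a, by omega⟩ : y n (a + 1) = _), bracket_single]
    simp only [table, Fin.val_zero, zero_add, true_and]
    split_ifs with h1 h2
    · rfl
    · omega
    · rw [x_eq_zero (by omega)]
  · rw [E_odd, map_smul, LinearMap.smul_apply, show 2 * a + 1 + 1 = 2 * (a + 1) by ring,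
      E_even (by omega), y_one, (x_eq_single ⟨a, by omega⟩ : x n (a + 1) = _), bracket_single]
    simp only [table, Fin.val_zero, zero_add, if_true]
    rw [smul_smul, pow_succ, mul_inv, one_div]

theorem bracket_w_y : bracket β (y n (n + 2)) (y n 1) = 0 := by
  rw [y_one, y_last, bracket_single]
  simp [table]

theorem bracket_w_w : bracket β (y n (n + 2)) (y n (n + 2)) = 0 := by
  rw [y_last, bracket_single]
  simp only [table, Fin.val_last]
  rw [if_neg (by omega), if_neg (by omega)]

theorem bracket_w_x (hn : 1 ≤ n) : bracket β (y n (n + 2)) (x n 1) = 0 := by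
  rw [y_last, x_one hn, bracket_single]
  simp [table]

theorem bracket_E_x (hn : 1 ≤ n) (i : ℕ) : bracket β (E n i) (x n 1) = (2 : ℂ) • E n (i + 2) := by
  rcases lt_or_ge (2 * n) i with hi | hi
  · rw [E_eq_zero hi, E_eq_zero (by omega), map_zero, LinearMap.zero_apply, smul_zero]
  obtain ⟨a, rfl | rfl⟩ := Nat.even_or_odd' i
  · rw [E_even (by omega), map_smul, LinearMap.smul_apply, x_one hn,
      (y_eq_single ⟨a, by omega⟩ : y n (a + 1) = _), bracket_single]
    simp only [table, zero_add, true_and]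
    split_ifs with h1
    · rw [show 2 * a + 2 = 2 * (a + 1) by ring, E_even h1, smul_smul, pow_succ]
      congr 1
      field_simp
    · rw [E_eq_zero (by omega), smul_zero, smul_zero]
  · rw [E_odd, map_smul, LinearMap.smul_apply, show 2 * a + 1 + 2 = 2 * (a + 1) + 1 by ring,
      E_odd, x_one hn, (x_eq_single ⟨a, by omega⟩ : x n (a + 1) = _), bracket_single]
    simp only [table, zero_add, true_and]
    have : (2 : ℂ) * (2 ^ (a + 1))⁻¹ = (2 ^ a)⁻¹ := by
      rw [pow_succ]
      field_simp
    split_ifs with h1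
    · rw [smul_smul, this]
    · rw [smul_smul, x_eq_zero (i := a + 1) (by omega), smul_zero, smul_zero]

/-- No row restriction is needed here: the vanishing of `E n i` for i > 2n takes its place. -/
theorem bracket_E_w (i : ℕ) : bracket β (E n i) (y n (n + 2)) =
    (-1 : ℂ) ^ i • ∑ r ∈ Finset.Ico ((n + 1) / 2) n,
      (-2 * 2 ^ r * entry β (r + 2)) • E n (2 * r + 1 + i) := by
  rcases lt_or_ge (2 * n) i with hi | hi
  · rw [E_eq_zero hi, map_zero, LinearMap.zero_apply, Finset.sum_eq_zero, smul_zero]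
    exact fun r _ => by rw [E_eq_zero (by omega), smul_zero]
  obtain ⟨a, rfl | rfl⟩ := Nat.even_or_odd' i
  · rw [E_even (by omega), map_smul, LinearMap.smul_apply, y_last,
      (y_eq_single ⟨a, by omega⟩ : y n (a + 1) = _), bracket_single]
    simp only [table, Fin.val_last]
    rw [if_neg (by omega)]
    split_ifs with h1
    · rw [sum_Icc_eq_sum_Ico (by omega) (F := fun k => entry β k • x n (k - 2 + (a + 1))),
        Finset.smul_sum, Finset.smul_sum, Finset.smul_sum]
      · refine Finset.sum_congr rfl fun r _ => ?_
        rw [show 2 * r + 1 + 2 * a = 2 * (r + a) + 1 by ring, E_odd, show r + 2 - 2 = r by omega,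
          ← add_assoc, smul_smul, smul_smul, smul_smul, smul_smul, pow_mul, pow_add]
        congr 1
        field_simp
        simp
      · intro k hk
        rw [show k - 2 + (a + 1) = k - 2 + a + 1 by ring, x_eq_zero (by omega), smul_zero]
    · rw [Finset.sum_eq_zero, smul_zero, smul_zero]
      intro r hr
      rw [Finset.mem_Ico] at hr
      have h2 : ¬ a + 1 ≤ n / 2 := fun h2 => h1 ⟨trivial, h2⟩
      rw [E_eq_zero (by omega), smul_zero]
  · rw [E_odd, map_smul, LinearMap.smul_apply, y_last,
      (x_eq_single ⟨a, by omega⟩ : x n (a + 1) = _), bracket_single]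
    simp only [table, Fin.val_last]
    rw [if_neg (by omega)]
    split_ifs with h1
    · rw [Finset.sum_congr rfl (g := fun k => entry β k • (2 : ℂ) ^ (k - 1 + a) •
          E n (2 * (k - 1 + a))), sum_Icc_eq_sum_Ico (by omega), Finset.smul_sum, Finset.smul_sum]
      · refine Finset.sum_congr rfl fun r _ => ?_
        rw [show 2 * r + 1 + (2 * a + 1) = 2 * (r + 1 + a) by ring, show r + 2 - 1 = r + 1 by omega,
          smul_smul, smul_smul, smul_smul, pow_succ (-1 : ℂ), pow_mul, pow_add, pow_succ]
        congr 1
        field_simp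
        simp
      · intro k hk
        rw [E_eq_zero (by omega), smul_zero, smul_zero]
      · intro k hk
        rw [Finset.mem_Icc] at hk
        rw [← add_assoc, y_eq_E (by omega)]
    · rw [Finset.sum_eq_zero, smul_zero, smul_zero]
      intro r hr
      rw [Finset.mem_Ico] at hr
      have h2 : ¬ a + 1 ≤ n / 2 := fun h2 => h1 ⟨trivial, h2⟩
      rw [E_eq_zero (by omega), smul_zero]

/-- Only three basis vectors act nontrivially from the right. -/
theorem bracket_eq (hn : 1 ≤ n) (u v : Space n) : bracket β u v =
    v (Sum.inl ⟨0, hn⟩) • bracket β u (x n 1) + v (Sum.inr 0) • bracket β u (y n 1) +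
      v (Sum.inr (Fin.last (n + 1))) • bracket β u (y n (n + 2)) := by
  have h0 : ∀ q : Fin n ⊕ Fin (n + 2), (∀ p, table β p q = 0) →
      bracket β u (Pi.single q 1) = 0 := by
    intro q hq
    have : (bracket β).flip (Pi.single q 1) = 0 := by
      refine (Pi.basisFun ℂ (Fin n ⊕ Fin (n + 2))).ext fun p => ?_
      rw [Pi.basisFun_apply, LinearMap.flip_apply, bracket_single, hq]
      rfl
    exact LinearMap.congr_fun this u
  have hv : v = ∑ p, v p • (Pi.single p 1 : Space n) := by
    funext t
    simp [Finset.sum_apply, Pi.single_apply]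
  conv_lhs => rw [hv]
  rw [map_sum, Fintype.sum_sum_type, Finset.sum_eq_single ⟨0, hn⟩, Fin.sum_univ_succ,
    Fin.sum_univ_castSucc, Finset.sum_eq_zero, map_smul, map_smul, map_smul, x_one hn, y_one,
    y_last, zero_add]
  · exact (add_assoc _ _ _).symm
  · intro i _
    rw [map_smul, h0, smul_zero]
    intro p
    have := i.2
    rcases p with p | p <;> simp only [table] <;>
      rw [if_neg (by simp), if_neg (by simp; omega)]
  · intro b _ hb
    have hb' : b.val ≠ 0 := fun h => hb (Fin.ext h)
    rw [map_smul, h0, smul_zero]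
    intro p
    rcases p with p | p <;> simp only [table] <;> rw [if_neg (by omega)]
  · simp

end LeibnizFamily

end

/-! ### The models belong to the class. -/

noncomputable section

namespace LeibnizFamily

open Superalgebra

variable {n : ℕ} (β : Fin (numParams n) → ℂ)

/-- Together with the anticommutation of R_{y_1}, R_{y_{n+2}} and R_{y_{n+2}}² = 0, this carries the
Leibniz identity of the model. -/
theorem rightMul_x_eq (hn : 1 ≤ n) (u : Space n) : bracket β u (x n 1) =
    (2 : ℂ) • bracket β (bracket β u (y n 1)) (y n 1) := by
  have : (bracket β).flip (x n 1) =
      (2 : ℂ) • (bracket β).flip (y n 1) ∘ₗ (bracket β).flip (y n 1) := by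
    refine hom_ext (fun i => ?_) ?_
    · simp [bracket_E_x β hn, bracket_E_y]
    · simp [bracket_w_x β hn, bracket_w_y]
  exact LinearMap.congr_fun this u

theorem rightMul_anticomm (u : Space n) : bracket β (bracket β u (y n 1)) (y n (n + 2)) =
    - bracket β (bracket β u (y n (n + 2))) (y n 1) := by
  have : (bracket β).flip (y n (n + 2)) ∘ₗ (bracket β).flip (y n 1) =
      - (bracket β).flip (y n 1) ∘ₗ (bracket β).flip (y n (n + 2)) := by
    refine hom_ext (fun i => ?_) ?_
    · simp only [LinearMap.comp_apply, LinearMap.neg_apply, LinearMap.flip_apply, bracket_E_y,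
        bracket_E_w, map_smul, map_sum, pow_succ]
      simp [add_assoc]
    · simp [bracket_w_w, bracket_w_y]
  exact LinearMap.congr_fun this u

/-- R_{y_{n+2}} raises the index of `E` by at least 2⌊(n+1)/2⌋ + 1 ≥ n + 1, so two applications
exceed 2n. -/
theorem rightMul_sq_eq_zero (u : Space n) :
    bracket β (bracket β u (y n (n + 2))) (y n (n + 2)) = 0 := by
  have : (bracket β).flip (y n (n + 2)) ∘ₗ (bracket β).flip (y n (n + 2)) = 0 := by
    refine hom_ext (fun i => ?_) ?_
    · simp only [LinearMap.comp_apply, LinearMap.zero_apply, LinearMap.flip_apply,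
        bracket_E_w, map_smul, map_sum]
      rw [Finset.sum_eq_zero, smul_zero]
      intro r hr
      rw [Finset.sum_eq_zero, smul_zero, smul_zero]
      intro r' hr'
      rw [Finset.mem_Ico] at hr hr'
      rw [E_eq_zero (by omega), smul_zero]
    · simp [bracket_w_w]
  exact LinearMap.congr_fun this u

theorem table_inr_zero (p q : Fin n ⊕ Fin (n + 2)) : table β p q (Sum.inr 0) = 0 := by
  rcases p with p | p <;> rcases q with q | q <;> simp only [table] <;> split_ifs <;>
    simp [x, y, Finset.sum_apply]
  refine Finset.sum_eq_zero fun k hk => ?_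
  rw [Finset.mem_Icc] at hk
  rw [if_neg (by omega)]

theorem table_inr_last (p q : Fin n ⊕ Fin (n + 2)) :
    table β p q (Sum.inr (Fin.last (n + 1))) = 0 := by
  rcases p with p | p <;> rcases q with q | q <;> simp only [table] <;> split_ifs <;>
    simp [x, y, Finset.sum_apply]
  · omega
  · refine Finset.sum_eq_zero fun k hk => ?_
    rw [Finset.mem_Icc] at hk
    rw [if_neg (by omega)]
  · omega

theorem bracket_inr_zero (u v : Space n) : bracket β u v (Sum.inr 0) = 0 := by
  simp [bracket_apply, Finset.sum_apply, table_inr_zero]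

theorem bracket_inr_last (u v : Space n) : bracket β u v (Sum.inr (Fin.last (n + 1))) = 0 := by
  simp [bracket_apply, Finset.sum_apply, table_inr_last]

theorem E_inl_zero (hn : 1 ≤ n) (i : ℕ) :
    E n i (Sum.inl ⟨0, hn⟩) = if i = 1 then 1 else 0 := by
  obtain ⟨a, rfl | rfl⟩ := Nat.even_or_odd' i
  · rw [if_neg (by omega)]
    by_cases ha : a ≤ n
    · rw [E_even ha]
      simp [y]
    · rw [E_eq_zero (by omega)]
      rfl
  · rw [E_odd]
    rcases Nat.eq_zero_or_pos a with rfl | ha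
    · simp [x]
    · rw [if_neg (by omega), Pi.smul_apply]
      simp [x, ha.ne]

theorem E_inr_zero (i : ℕ) : E n i (Sum.inr 0) = if i = 0 then 1 else 0 := by
  obtain ⟨a, rfl | rfl⟩ := Nat.even_or_odd' i
  · rcases Nat.eq_zero_or_pos a with rfl | ha
    · simp [E_zero, y]
    · rw [if_neg (by omega)]
      by_cases han : a ≤ n
      · rw [E_even han, Pi.smul_apply]
        simp [y, ha.ne]
      · rw [E_eq_zero (by omega)]
        rfl
  · rw [if_neg (by omega), E_odd]
    simp [x]

theorem bracket_inl_zero (hn : 1 ≤ n) (u v : Space n) :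
    bracket β u v (Sum.inl ⟨0, hn⟩) = u (Sum.inr 0) * v (Sum.inr 0) := by
  have : LinearMap.proj (Sum.inl ⟨0, hn⟩) ∘ₗ (bracket β).flip v =
      v (Sum.inr 0) • (LinearMap.proj (Sum.inr 0) : Space n →ₗ[ℂ] ℂ) := by
    refine hom_ext (fun i => ?_) ?_
    · simp only [LinearMap.comp_apply, LinearMap.flip_apply, LinearMap.smul_apply,
        LinearMap.proj_apply]
      rw [bracket_eq β hn, bracket_E_x β hn, bracket_E_y, bracket_E_w]
      simp only [Pi.add_apply, Pi.smul_apply, Finset.sum_apply, E_inl_zero hn, E_inr_zero]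
      rw [Finset.sum_eq_zero, if_neg (by omega)]
      · simp
      · intro r hr
        rw [Finset.mem_Ico] at hr
        rw [if_neg (by omega), smul_zero]
    · simp only [LinearMap.comp_apply, LinearMap.flip_apply, LinearMap.smul_apply,
        LinearMap.proj_apply]
      rw [bracket_eq β hn, bracket_w_x β hn, bracket_w_y, bracket_w_w]
      simp [y]
  rw [mul_comm]
  exact LinearMap.congr_fun this u

theorem isLeibniz (hn : 1 ≤ n) : (algebra β).IsLeibniz := by
  intro a b u v w hv hw
  change bracket β u (bracket β v w) = bracket β (bracket β u v) w -
    _ • bracket β (bracket β u w) v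
  have h2 : ∀ c : ZMod 2, c = 0 ∨ c = 1 := by decide
  change v ∈ part n a at hv
  change w ∈ part n b at hw
  -- A product acts from the right only through its x_1-coordinate, which is the product of the
  -- y_1-coordinates of its factors.
  rw [bracket_eq β hn u (bracket β v w), bracket_inl_zero β hn, bracket_inr_zero,
    bracket_inr_last, zero_smul, zero_smul, add_zero, add_zero, bracket_eq β hn u v,
    bracket_eq β hn u w, bracket_eq β hn _ w, bracket_eq β hn _ v]
  simp only [map_add, map_smul, LinearMap.add_apply, LinearMap.smul_apply,
    rightMul_x_eq β hn, rightMul_anticomm, rightMul_sq_eq_zero, map_neg, LinearMap.neg_apply]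
  obtain rfl | rfl := h2 a <;> obtain rfl | rfl := h2 b <;>
    simp only [part_zero, part_one] at hv hw
  · simp only [hv _, hw _, ZMod.val_zero]
    module
  · simp only [hv _, hw _, ZMod.val_zero]
    module
  · simp only [hv _, hw _, ZMod.val_zero]
    module
  · simp only [hv _, hw _, ZMod.val_one]
    module

theorem algebra_bracket : (algebra β).bracket = bracket β := rfl

theorem rightMul_algebra (u v : Space n) : (algebra β).rightMul u v = bracket β v u := rfl

theorem rightString_y_eq (i : ℕ) : (algebra β).rightString (y n 1) (y n 1) i = E n i := by
  induction i with
  | zero => exact E_zero.symm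
  | succ i ih => rw [rightString_succ, ih, algebra_bracket, bracket_E_y]

theorem y_odd (n i : ℕ) : y n i ∈ part n 1 := part_one n ▸ y_mem n i

theorem x_even (n i : ℕ) : x n i ∈ part n 0 := part_zero n ▸ x_mem n i

theorem even_eq_sum {v : Space n} (hv : v ∈ part n 0) :
    v = ∑ a, v (Sum.inl a) • x n (a.val + 1) := by
  rw [part_zero] at hv
  funext t
  rcases t with t | t
  · simp [x, Finset.sum_apply, ← Fin.ext_iff]
  · simp [x, Finset.sum_apply, hv t]

theorem odd_eq_sum {v : Space n} (hv : v ∈ part n 1) :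
    v = ∑ a, v (Sum.inr a) • y n (a.val + 1) := by
  rw [part_one] at hv
  funext t
  rcases t with t | t
  · simp [y, Finset.sum_apply, hv t]
  · simp [y, Finset.sum_apply, ← Fin.ext_iff]

/-- Every right multiplication kills y_{n+2} and raises the index of `E`. -/
theorem lower_succ_le_span (hn : 1 ≤ n) (i : ℕ) :
    (algebra β).lower (i + 1) ≤ Submodule.span ℂ (E n '' Set.Ici (i + 1)) := by
  have hE : ∀ i j, i ≤ j → E n j ∈ Submodule.span ℂ (E n '' Set.Ici i) :=
    fun i j hij => Submodule.subset_span ⟨j, hij, rfl⟩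
  have hEb : ∀ i j, i ≤ j → ∀ v, bracket β (E n j) v ∈
      Submodule.span ℂ (E n '' Set.Ici (i + 1)) := by
    intro i j hij v
    rw [bracket_eq β hn, bracket_E_x β hn, bracket_E_y, bracket_E_w]
    refine add_mem (add_mem (Submodule.smul_mem _ _ (Submodule.smul_mem _ _ (hE _ _ (by omega))))
      (Submodule.smul_mem _ _ (hE _ _ (by omega)))) (Submodule.smul_mem _ _ (Submodule.smul_mem _ _
      (Submodule.sum_mem _ fun r _ => Submodule.smul_mem _ _ (hE _ _ (by omega)))))
  induction i with
  | zero =>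
    refine lower_succ_le_of_forall fun u _ v => ?_
    have : Submodule.span ℂ (insert (y n (n + 2)) (Set.range (E n))) ≤
        (Submodule.span ℂ (E n '' Set.Ici (0 + 1))).comap ((bracket β).flip v) := by
      rw [Submodule.span_le]
      rintro _ (rfl | ⟨j, rfl⟩)
      · change bracket β (y n (n + 2)) v ∈ Submodule.span ℂ (E n '' Set.Ici (0 + 1))
        rw [bracket_eq β hn, bracket_w_x β hn, bracket_w_y, bracket_w_w]
        simp
      · exact hEb 0 j (Nat.zero_le j) v
    rw [span_E] at this
    exact this trivial
  | succ i ih =>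
    refine lower_succ_le_of_forall fun u hu v => ?_
    have : Submodule.span ℂ (E n '' Set.Ici (i + 1)) ≤
        (Submodule.span ℂ (E n '' Set.Ici (i + 1 + 1))).comap ((bracket β).flip v) := by
      rw [Submodule.span_le]
      rintro _ ⟨j, hj, rfl⟩
      exact hEb (i + 1) j hj v
    exact this (ih hu)

theorem lower_eq_bot (hn : 1 ≤ n) : (algebra β).lower (2 * n + 1) = ⊥ := by
  rw [eq_bot_iff]
  refine (lower_succ_le_span β hn (2 * n)).trans ?_
  rw [Submodule.span_le]
  rintro _ ⟨j, hj, rfl⟩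
  exact E_eq_zero hj

theorem E_last_ne_zero : E n (2 * n) ≠ 0 := by
  rw [E_even le_rfl, (y_eq_single ⟨n, by omega⟩ : y n (n + 1) = _)]
  simp

theorem hasNilindex (hn : 1 ≤ n) : (algebra β).HasNilindex (n + (n + 2)) := by
  refine ⟨by omega, ?_, fun t ht ht' h => ?_⟩
  · rw [show n + (n + 2) - 1 = 2 * n + 1 by omega]
    exact lower_eq_bot β hn
  · have h1 := (algebra β).lower_antitone (show t - 1 ≤ 2 * n by omega)
      (rightString_mem_lower (A := algebra β) (y n 1) (y n 1) (2 * n))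
    rw [h, Submodule.mem_bot, rightString_y_eq] at h1
    exact E_last_ne_zero h1

theorem finrank_even (n : ℕ) : Module.finrank ℂ (part n 0) = n := by
  have hker : part n 0 = LinearMap.ker (LinearMap.funLeft ℂ ℂ (Sum.inr : Fin (n + 2) → _)) := by
    rw [part_zero]
    ext v
    exact ⟨fun h => funext h, fun h b => congrFun h b⟩
  have := LinearMap.finrank_range_add_finrank_ker
    (LinearMap.funLeft ℂ ℂ (Sum.inr : Fin (n + 2) → Fin n ⊕ Fin (n + 2)))
  rw [LinearMap.range_eq_top.2 (LinearMap.funLeft_surjective_of_injective _ _ _ Sum.inr_injective),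
    finrank_top, finrank_space, Module.finrank_fin_fun, ← hker] at this
  exact Nat.add_left_cancel (this.trans (by ring))

theorem finrank_odd (n : ℕ) : Module.finrank ℂ (part n 1) = n + 2 := by
  have h := Submodule.finrank_add_eq_of_isCompl (isCompl_part n)
  rw [finrank_space, finrank_even] at h
  omega

theorem rightMul_pow_x (hn : 1 ≤ n) (k : ℕ) :
    ((algebra β).rightMul (x n 1) ^ k) (x n 1) = x n (k + 1) := by
  induction k with
  | zero => rfl
  | succ k ih =>
    rw [pow_succ', Module.End.mul_apply, ih, rightMul_algebra, x_eq_E, map_smul, LinearMap.smul_apply, bracket_E_x β hn, x_eq_E, smul_smul, pow_succ,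
      show 2 * k + 1 + 2 = 2 * (k + 1) + 1 by ring]

theorem rightMul_pow_y (hn : 1 ≤ n) (k : ℕ) :
    ((algebra β).rightMul (x n 1) ^ k) (y n 1) = (2 : ℂ) ^ k • E n (2 * k) := by
  induction k with
  | zero => rw [pow_zero, pow_zero, one_smul, mul_zero, E_zero]; rfl
  | succ k ih =>
    rw [pow_succ', Module.End.mul_apply, ih, rightMul_algebra, map_smul, LinearMap.smul_apply, bracket_E_x β hn, smul_smul, pow_succ,
      show 2 * k + 2 = 2 * (k + 1) by ring]

theorem hasJordanBlocks_even (hn : 1 ≤ n) :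
    HasJordanBlocks ((algebra β).rightMul (x n 1)) (part n 0) [n] := by
  refine hasJordanBlocks_of_strings (by simp) (by simpa using hn) (fun _ => x n 1)
    (fun _ k => ?_) (fun i => ?_) (fun v hv => ?_) (by simp [finrank_even])
  · rw [rightMul_pow_x β hn]
    exact x_even _ _
  · obtain rfl : i = ⟨0, by simp⟩ := Subsingleton.elim (α := Fin 1) _ _
    rw [rightMul_pow_x β hn]
    exact x_eq_zero le_rfl
  · rw [even_eq_sum hv]
    refine Submodule.sum_mem _ fun a _ => Submodule.smul_mem _ _ (Submodule.subset_span ?_)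
    exact ⟨⟨0, by simp⟩, a.val, a.2, rightMul_pow_x β hn a.val⟩

theorem hasJordanBlocks_odd (hn : 1 ≤ n) :
    HasJordanBlocks ((algebra β).rightMul (x n 1)) (part n 1) [n + 1, 1] := by
  refine hasJordanBlocks_of_strings (by simp) (by simp) ![y n 1, y n (n + 2)]
    (fun i k => ?_) (fun i => ?_) (fun v hv => ?_) (by simp [finrank_odd])
  · induction k with
    | zero =>
      refine Fin.cases ?_ (fun i => ?_) i
      · exact y_odd n 1
      · obtain rfl : i = 0 := Subsingleton.elim (α := Fin 1) _ _
        exact y_odd n (n + 2)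
    | succ k ih =>
      rw [pow_succ', Module.End.mul_apply, rightMul_algebra]
      exact bracket_mem_part β 1 0 _ _ ih (x_even n 1)
  · refine Fin.cases ?_ (fun i => ?_) i
    · exact (rightMul_pow_y β hn (n + 1)).trans (by rw [E_eq_zero (by omega), smul_zero])
    · obtain rfl : i = 0 := Subsingleton.elim (α := Fin 1) _ _
      exact bracket_w_x β hn
  · rw [odd_eq_sum hv]
    refine Submodule.sum_mem _ fun a _ => Submodule.smul_mem _ _ (Submodule.subset_span ?_)
    by_cases ha : a.val ≤ n
    · refine ⟨⟨0, by simp⟩, a.val, Nat.lt_succ_of_le ha, ?_⟩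
      rw [y_eq_E ha]
      exact rightMul_pow_y β hn a.val
    · refine ⟨⟨1, by simp⟩, 0, Nat.zero_lt_one, ?_⟩
      rw [show a.val + 1 = n + 2 by omega]
      rfl

theorem x_one_notMem (hn : 1 ≤ n) :
    x n 1 ∉ Submodule.map₂ (bracket β) (part n 0) (part n 0) := by
  intro h
  have hle : Submodule.map₂ (bracket β) (part n 0) (part n 0) ≤
      LinearMap.ker (LinearMap.proj (Sum.inl ⟨0, hn⟩) : Space n →ₗ[ℂ] ℂ) := by
    refine Submodule.map₂_le.2 fun u hu v _ => ?_
    rw [part_zero] at hu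
    rw [LinearMap.mem_ker, LinearMap.proj_apply, bracket_inl_zero β hn, hu 0, zero_mul]
  have := hle h
  rw [LinearMap.mem_ker, LinearMap.proj_apply] at this
  simp [x] at this

theorem even_mem_lower_one {v : Space n} (hv : v ∈ part n 0) :
    v ∈ (algebra β).lower 1 := by
  rw [even_eq_sum hv]
  refine Submodule.sum_mem _ fun a _ => Submodule.smul_mem _ _ ?_
  rw [x_eq_E, ← rightString_y_eq β]
  exact Submodule.smul_mem _ _ ((algebra β).lower_antitone (by omega)
    (rightString_mem_lower (A := algebra β) (y n 1) (y n 1) (2 * a.val + 1)))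

/-- A smaller head decides the comparison; with equal heads the remaining sum is 0 or 1, which
leaves one possible tail. -/
theorem le_of_sum_eq {c d : List ℕ} {p : ℕ} (hpos : ∀ q ∈ c, 1 ≤ q) (hsum : c.sum = (p :: d).sum)
    (hhead : ∀ q t, c = q :: t → q ≤ p) (hd : d = [] ∨ d = [1]) : c ≤ p :: d := by
  cases c with
  | nil => exact not_lt.1 (List.not_lt_nil _)
  | cons q t =>
    have hq := hhead q t rfl
    rcases hq.lt_or_eq with hlt | rfl
    · exact le_of_lt (List.cons_lt_cons_iff.2 (Or.inl hlt))
    · have ht : t = d := by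
        simp only [List.sum_cons, add_right_inj] at hsum
        rcases hd with rfl | rfl
        · cases t with
          | nil => rfl
          | cons r t =>
            have := hpos r (by simp)
            simp at hsum
            omega
        · cases t with
          | nil => simp at hsum
          | cons r t =>
            have := hpos r (by simp)
            simp at hsum
            cases t with
            | nil => simp at hsum; rw [hsum]
            | cons r' t =>
              have := hpos r' (by simp)
              simp at hsum
              omega
      rw [ht]

theorem inClass (hn : 1 ≤ n) : (algebra β).InClass n (n + 2) := by
  refine ⟨isLeibniz β hn, inferInstance, finrank_even n, finrank_odd n,
    ⟨⟨⟨x n 1, x_even n 1, x_one_notMem β hn, hasJordanBlocks_even β hn⟩, ?_⟩,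
    ⟨⟨x n 1, x_even n 1, x_one_notMem β hn, hasJordanBlocks_odd β hn⟩, ?_⟩⟩, hasNilindex β hn⟩
  · rintro c ⟨u, _, _, hJ⟩
    have hs := hJ.sum_eq
    change _ = Module.finrank ℂ (part n 0) at hs
    rw [finrank_even] at hs
    refine le_of_sum_eq hJ.2.1 (by simpa using hs) (fun q t hqt => ?_) (Or.inl rfl)
    rw [hqt, List.sum_cons] at hs
    omega
  · rintro c ⟨u, hu, _, hJ⟩
    have hs := hJ.sum_eq
    change _ = Module.finrank ℂ (part n 1) at hs
    rw [finrank_odd] at hs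
    refine le_of_sum_eq hJ.2.1 (by simpa using hs) (fun q t hqt => ?_) (Or.inr rfl)
    subst hqt
    obtain ⟨z, _, hz⟩ := hJ.exists_pow_ne_zero
    by_contra hq
    -- Even elements lie in [L, L], so R_u gains two steps at a time and R_u^{n+1} = 0. No block
    -- exceeds n + 1.
    have hlow : ∀ k, ((algebra β).rightMul u ^ k) z ∈ (algebra β).lower (2 * k) := by
      intro k
      induction k with
      | zero => trivial
      | succ k ih =>
        rw [pow_succ', Module.End.mul_apply, rightMul_algebra]
        have := (isLeibniz β hn).bracket_mem_lower (j := 1) ih (even_mem_lower_one β hu)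
        exact this
    have h0 := (algebra β).lower_antitone (show 2 * n + 1 ≤ 2 * (q - 1) by omega) (hlow (q - 1))
    rw [lower_eq_bot β hn, Submodule.mem_bot] at h0
    exact hz h0

end LeibnizFamily

end

/-! ### Isomorphisms between models are scalings of the parameters. -/

noncomputable section

namespace LeibnizFamily

open Superalgebra

variable {n : ℕ} {β β' : Fin (numParams n) → ℂ}

theorem iso_of_scaling (hn : 1 ≤ n) {c t : ℂ} (hc : c ≠ 0) (ht : t ≠ 0)
    (h : ∀ p, β' p = c * t ^ p.val * β p) : (algebra β).Iso (algebra β') := by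
  obtain ⟨a, ha⟩ := IsAlgClosed.exists_pow_nat_eq t two_pos
  have ha0 : a ≠ 0 := by
    rintro rfl
    exact ht (by rw [← ha]; simp)
  set K := (n + 5) / 2 with hK
  -- With y = a y_1 and w = d y_{n+2} in L(β'), the relation for [y, w] asks for d β'_{r+2} =
  -- a^{2r+1} β_{r+2}. Substituting β'_{r+2} = c a^{2(r+2-K)} β_{r+2} gives this d.
  set d : ℂ := a ^ (2 * K - 3) / c with hd
  have hd0 : d ≠ 0 := div_ne_zero (pow_ne_zero _ ha0) hc
  have hstr : ∀ i, (algebra β').rightString (a • y n 1) (a • y n 1) i = a ^ (i + 1) • E n i := by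
    intro i
    induction i with
    | zero => rw [rightString_zero, E_zero, zero_add, pow_one]
    | succ i ih =>
      rw [rightString_succ, ih, algebra_bracket, map_smul, map_smul, LinearMap.smul_apply,
        bracket_E_y, smul_smul]
      congr 1
      ring
  have hP : (algebra β').IsPresentation n β (a • y n 1) (d • y n (n + 2)) := by
    refine ⟨isLeibniz β' hn, Submodule.smul_mem _ _ (y_odd n 1),
      Submodule.smul_mem _ _ (y_odd n (n + 2)), ?_, ?_, ?_, ?_, ?_⟩
    · rw [algebra_bracket, map_smul, map_smul, LinearMap.smul_apply, bracket_w_y, smul_zero,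
        smul_zero]
    · rw [algebra_bracket, map_smul, map_smul, LinearMap.smul_apply, bracket_w_w, smul_zero,
        smul_zero]
    · rw [algebra_bracket, map_smul, map_smul, LinearMap.smul_apply, ← E_zero, bracket_E_w,
        pow_zero, one_smul, Finset.smul_sum, Finset.smul_sum, E_zero]
      refine Finset.sum_congr rfl fun r hr => ?_
      rw [Finset.mem_Ico] at hr
      rw [hstr, smul_smul, smul_smul, smul_smul, add_zero]
      congr 1
      have hlt : r + 2 - (n + 5) / 2 < numParams n := by rw [numParams]; omega
      rw [entry, entry, dif_pos hlt, dif_pos hlt, h, hd, ← ha, ← pow_mul,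
        show 2 * r + 1 + 1 = (2 * K - 3) + 2 * (r + 2 - (n + 5) / 2) + 1 by omega, pow_add, pow_add]
      field_simp
    · rw [hstr, E_eq_zero le_rfl, smul_zero]
    · rw [eq_top_iff, ← span_E, Submodule.span_le]
      rintro _ (rfl | ⟨i, rfl⟩)
      · exact (Submodule.smul_mem_iff _ hd0).1 (Submodule.subset_span (Or.inl rfl))
      · refine (Submodule.smul_mem_iff _ (pow_ne_zero (i + 1) ha0)).1
          (Submodule.subset_span (Or.inr ⟨i, hstr i⟩))
  exact hP.iso (by rw [finrank_space]; ring)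

/-- For 2 ≤ i ≤ n + 1 the vector y_i is [y_{i-1}, x_1], so the coordinates at y_1 and y_{n+2} detect
the odd generators. -/
theorem exists_bracket_eq (hn : 1 ≤ n) (β : Fin (numParams n) → ℂ) {v : Space n}
    (hv : v ∈ part n 1) (h0 : v (Sum.inr 0) = 0) (h1 : v (Sum.inr (Fin.last (n + 1))) = 0) :
    ∃ q r, bracket β q r = v := by
  refine ⟨∑ a : Fin (n + 2), v (Sum.inr a) • y n a.val, x n 1, ?_⟩
  conv_rhs => rw [odd_eq_sum hv]
  rw [map_sum, LinearMap.sum_apply]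
  refine Finset.sum_congr rfl fun a _ => ?_
  rw [map_smul, LinearMap.smul_apply]
  have ha := a.2
  rcases Nat.eq_zero_or_pos a.val with ha0 | ha0
  · rw [show a = 0 from Fin.ext ha0, h0, zero_smul, zero_smul]
  · by_cases han : a.val = n + 1
    · rw [show a = Fin.last (n + 1) from Fin.ext han, h1, zero_smul, zero_smul]
    · obtain ⟨b, hb⟩ : ∃ b, a.val = b + 1 := ⟨a.val - 1, by omega⟩
      rw [hb, y_eq_E (by omega), y_eq_E (by omega), map_smul, LinearMap.smul_apply,
        bracket_E_x β hn, smul_smul, smul_smul, smul_smul, show 2 * (b + 1) = 2 * b + 2 by ring]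
      congr 1
      ring

/-- The coefficients are a convolution of δ with l, a triangular system with diagonal l 0. -/
theorem eq_zero_of_sum_eq_zero {m : ℕ} {δ l : ℕ → ℂ} (hl : l 0 ≠ 0)
    (h : ∑ r ∈ Finset.Ico m n, ∑ j ∈ Finset.range (n + 1),
      (δ r * l j) • E n (2 * (r + j) + 1) = 0) (r : ℕ) (hr : r ∈ Finset.Ico m n) : δ r = 0 := by
  induction r using Nat.strong_induction_on with
  | _ r ih =>
    rw [Finset.mem_Ico] at hr
    have hE : ∀ a, E n (2 * a + 1) (Sum.inl ⟨r, hr.2⟩) = if a = r then ((2 : ℂ) ^ r)⁻¹ else 0 := by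
      intro a
      rw [E_odd, Pi.smul_apply]
      by_cases har : a = r
      · simp [x, har]
      · rw [if_neg har]
        simp only [x, Sum.elim_inl]
        rw [if_neg (by omega), smul_zero]
    have h1 := congrFun h (Sum.inl ⟨r, hr.2⟩)
    simp only [Finset.sum_apply, Pi.smul_apply, hE] at h1
    rw [Finset.sum_eq_single r, Finset.sum_eq_single 0] at h1
    · simpa [hl] using h1
    · intro j _ hj
      rw [if_neg (by omega), smul_zero]
    · simp
    · intro r' hr' hne
      refine Finset.sum_eq_zero fun j _ => ?_
      rcases lt_or_gt_of_ne hne with hlt | hgt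
      · rw [ih r' hlt hr', zero_mul, zero_smul]
      · rw [if_neg (by omega), smul_zero]
    · intro hcon
      exact absurd (Finset.mem_Ico.2 hr) hcon

/-- Both sides of f([y_1, y_{n+2}]) = [f(y_1), f(y_{n+2})] turn out to be convolutions with the same
sequence l, the coordinates of f(y_1). Its leading coefficient a is nonzero, so l cancels and d
β'_{r+2} = a^{2r+1} β_{r+2} remains. -/
theorem scaling_of_iso (hn : 1 ≤ n) (h : (algebra β).Iso (algebra β')) :
    ∃ c t : ℂ, c ≠ 0 ∧ t ≠ 0 ∧ ∀ p, β' p = c * t ^ p.val * β p := by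
  obtain ⟨f, hf, hm⟩ := h
  have hm' : ∀ u v, f (bracket β u v) = bracket β' (f u) (f v) := hm
  have hsymm : ∀ u v, f.symm (bracket β' u v) = bracket β (f.symm u) (f.symm v) := by
    intro u v
    apply f.injective
    rw [hm']
    simp
  set y' := f (y n 1) with hy'
  set w' := f (y n (n + 2)) with hw'
  have hyo : y' ∈ part n 1 := hf 1 _ (y_odd n 1)
  have hwo : w' ∈ part n 1 := hf 1 _ (y_odd n (n + 2))
  have hyl : ∀ a, y' (Sum.inl a) = 0 := by rw [part_one] at hyo; exact hyo
  have hwl : ∀ a, w' (Sum.inl a) = 0 := by rw [part_one] at hwo; exact hwo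
  set a := y' (Sum.inr 0) with ha
  set b := y' (Sum.inr (Fin.last (n + 1))) with hb
  set d := w' (Sum.inr (Fin.last (n + 1))) with hd
  -- The x_1-coordinate of [w', w'] is the square of this coordinate, and [w', w'] = 0.
  have hw0 : w' (Sum.inr 0) = 0 := by
    have := hm' (y n (n + 2)) (y n (n + 2))
    rw [bracket_w_w, map_zero, ← hw'] at this
    have h1 := bracket_inl_zero β' hn w' w'
    rw [← this] at h1
    exact mul_self_eq_zero.1 h1.symm
  -- With d = 0 the image w' would be a product, hence also y_{n+2}, which is a generator.
  have hd0 : d ≠ 0 := by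
    intro h0
    obtain ⟨q, r, hqr⟩ := exists_bracket_eq hn β' hwo hw0 h0
    have h1 := congrArg f.symm hqr
    rw [hsymm, hw', LinearEquiv.symm_apply_apply] at h1
    have h2 := bracket_inr_last β (f.symm q) (f.symm r)
    rw [h1, y_last] at h2
    simp at h2
  have ha0 : a ≠ 0 := by
    intro h0
    have ho : y' - (b / d) • w' ∈ part n 1 := sub_mem hyo (Submodule.smul_mem _ _ hwo)
    obtain ⟨q, r, hqr⟩ := exists_bracket_eq hn β' ho
      (by rw [Pi.sub_apply, Pi.smul_apply, hw0, smul_zero, sub_zero]; exact h0)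
      (by rw [Pi.sub_apply, Pi.smul_apply, ← hb, ← hd, smul_eq_mul, div_mul_cancel₀ _ hd0,
            sub_self])
    have h1 := congrArg f.symm hqr
    rw [hsymm, hw', hy', map_sub, map_smul, LinearEquiv.symm_apply_apply,
      LinearEquiv.symm_apply_apply] at h1
    have h2 := bracket_inr_zero β (f.symm q) (f.symm r)
    rw [h1, y_last, y_one] at h2
    simp at h2
  have hRy : ∀ u, bracket β' u y' = a • bracket β' u (y n 1) + b • bracket β' u (y n (n + 2)) := by
    intro u
    rw [bracket_eq β' hn u y', hyl, zero_smul, zero_add]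
  have hRw : ∀ u, bracket β' u w' = d • bracket β' u (y n (n + 2)) := by
    intro u
    rw [bracket_eq β' hn u w', hwl, hw0, zero_smul, zero_smul, zero_add, zero_add]
  have hRyy : ∀ u, bracket β' (bracket β' u y') y' =
      a ^ 2 • bracket β' (bracket β' u (y n 1)) (y n 1) := by
    intro u
    rw [hRy, hRy]
    simp only [map_add, map_smul, LinearMap.add_apply, LinearMap.smul_apply, rightMul_anticomm,
      rightMul_sq_eq_zero]
    module
  set Y : Space n →ₗ[ℂ] Space n := (bracket β').flip (y n 1) with hY
  have hYE : ∀ k i, (Y ^ k) (E n i) = E n (i + k) := by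
    intro k i
    induction k with
    | zero => rfl
    | succ k ih => rw [pow_succ', Module.End.mul_apply, ih, hY, LinearMap.flip_apply, bracket_E_y, add_assoc]
  obtain ⟨l, hl0, hl⟩ : ∃ l : ℕ → ℂ, l 0 = a ∧
      y' = (∑ j ∈ Finset.range (n + 1), l j • E n (2 * j)) + b • y n (n + 2) := by
    refine ⟨fun j => if hj : j < n + 2 then 2 ^ j * y' (Sum.inr ⟨j, hj⟩) else 0, ?_, ?_⟩
    · simp [ha]
    · conv_lhs => rw [odd_eq_sum hyo]
      rw [Fin.sum_univ_castSucc, Finset.sum_range]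
      congr 1
      refine Finset.sum_congr rfl fun j _ => ?_
      have hj := j.2
      beta_reduce
      rw [dif_pos (by omega), Fin.val_castSucc, y_eq_E (by omega), smul_smul, mul_comm]
      rfl
  have hfE : ∀ r, f (E n (2 * r + 1)) = a ^ (2 * r) • (Y ^ (2 * r)) (bracket β' y' y') := by
    intro r
    induction r with
    | zero =>
      rw [mul_zero, zero_add, pow_zero, pow_zero, one_smul, ← zero_add 1, ← bracket_E_y β, hm',
        E_zero]
      rfl
    | succ r ih =>
      rw [show 2 * (r + 1) + 1 = 2 * r + 1 + 1 + 1 by ring, ← bracket_E_y β, ← bracket_E_y β, hm',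
        hm', ← hy', ih, hRyy, map_smul, LinearMap.smul_apply, map_smul, LinearMap.smul_apply,
        smul_smul, ← pow_add, show 2 * (r + 1) = 2 * r + 1 + 1 by ring, pow_succ' Y, pow_succ' Y]
      congr 2
      ring
  have hyw : bracket β' y' (y n (n + 2)) = ∑ r ∈ Finset.Ico ((n + 1) / 2) n,
      ∑ j ∈ Finset.range (n + 1),
        ((-2 * 2 ^ r * entry β' (r + 2)) * l j) • E n (2 * (r + j) + 1) := by
    rw [hl, map_add, LinearMap.add_apply, map_smul, LinearMap.smul_apply, bracket_w_w, smul_zero,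
      add_zero, map_sum, LinearMap.sum_apply, Finset.sum_comm]
    refine Finset.sum_congr rfl fun j _ => ?_
    rw [map_smul, LinearMap.smul_apply, bracket_E_w, pow_mul, neg_one_sq, one_pow, one_smul,
      Finset.smul_sum]
    refine Finset.sum_congr rfl fun r _ => ?_
    rw [smul_smul, mul_comm, show 2 * r + 1 + 2 * j = 2 * (r + j) + 1 by ring]
  have hyy : ∀ r ∈ Finset.Ico ((n + 1) / 2) n, (Y ^ (2 * r)) (bracket β' y' y') =
      ∑ j ∈ Finset.range (n + 1), (a * l j) • E n (2 * (r + j) + 1) := by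
    intro r hr
    rw [Finset.mem_Ico] at hr
    -- Both r and the indices r' in [y', y_{n+2}] are at least ⌊(n+1)/2⌋, which moves every `E` past
    -- 2n. So the component b of y' plays no role.
    have h1 : (Y ^ (2 * r)) (bracket β' y' (y n (n + 2))) = 0 := by
      rw [hyw, map_sum]
      refine Finset.sum_eq_zero fun r' hr' => ?_
      rw [Finset.mem_Ico] at hr'
      rw [map_sum]
      refine Finset.sum_eq_zero fun j _ => ?_
      rw [map_smul, hYE, E_eq_zero (by omega), smul_zero]
    rw [hRy, map_add, map_smul, map_smul, h1, smul_zero, add_zero, hl, map_add,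
      LinearMap.add_apply, map_smul, LinearMap.smul_apply, bracket_w_y, smul_zero, add_zero,
      map_sum, LinearMap.sum_apply, map_sum, Finset.smul_sum]
    refine Finset.sum_congr rfl fun j _ => ?_
    rw [map_smul, LinearMap.smul_apply, bracket_E_y, map_smul, hYE, smul_smul,
      show 2 * j + 1 + 2 * r = 2 * (r + j) + 1 by ring]
  have hmain := hm' (y n 1) (y n (n + 2))
  rw [← hy', ← hw', hRw, hyw, ← E_zero, bracket_E_w, pow_zero, one_smul, map_sum,
    Finset.smul_sum] at hmain
  have hzero := sub_eq_zero.2 hmain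
  rw [← Finset.sum_sub_distrib] at hzero
  have hzero' : ∑ r ∈ Finset.Ico ((n + 1) / 2) n, ∑ j ∈ Finset.range (n + 1),
      ((2 ^ r * (d * entry β' (r + 2) - a ^ (2 * r + 1) * entry β (r + 2))) * l j) •
        E n (2 * (r + j) + 1) = 0 := by
    rw [← smul_eq_zero_iff_right (two_ne_zero (α := ℂ)), ← hzero, Finset.smul_sum]
    refine Finset.sum_congr rfl fun r hr => ?_
    rw [add_zero, map_smul, hfE, hyy r hr, Finset.smul_sum, Finset.smul_sum, Finset.smul_sum,
      Finset.smul_sum, ← Finset.sum_sub_distrib]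
    refine Finset.sum_congr rfl fun j _ => ?_
    rw [smul_smul, smul_smul, smul_smul, smul_smul, ← sub_smul]
    congr 1
    ring
  have hδ := eq_zero_of_sum_eq_zero (by rw [hl0]; exact ha0) hzero'
  set K := (n + 5) / 2 with hK
  refine ⟨d⁻¹ * a ^ (2 * K - 3), a ^ 2, mul_ne_zero (inv_ne_zero hd0) (pow_ne_zero _ ha0),
    pow_ne_zero _ ha0, fun p => ?_⟩
  have hp := p.2
  have hnum : numParams n = n + 2 - K := rfl
  have h1 := hδ (p.val + K - 2) (by rw [Finset.mem_Ico]; omega)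
  have hent : ∀ γ : Fin (numParams n) → ℂ, entry γ (p.val + K - 2 + 2) = γ p := by
    intro γ
    have : p.val + K - 2 + 2 - (n + 5) / 2 = p.val := by omega
    rw [entry, dif_pos (by omega)]
    simp only [this]
  rw [hent, hent, mul_eq_zero, or_iff_right (pow_ne_zero _ two_ne_zero), sub_eq_zero,
    show 2 * (p.val + K - 2) + 1 = (2 * K - 3) + 2 * p.val by omega, pow_add, pow_mul] at h1
  rw [mul_assoc, mul_assoc, ← mul_assoc (a ^ (2 * K - 3)), ← h1, inv_mul_cancel_left₀ hd0]

theorem iso_iff_scaling (hn : 1 ≤ n) : (algebra β).Iso (algebra β') ↔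
    ∃ c t : ℂ, c ≠ 0 ∧ t ≠ 0 ∧ ∀ p, β' p = c * t ^ p.val * β p :=
  ⟨scaling_of_iso hn, fun ⟨_, _, hc, ht, h⟩ => iso_of_scaling hn hc ht h⟩

end LeibnizFamily

end

/-! ### Normal forms of the parameter vectors under scaling. -/

namespace LeibnizFamily

theorem S_eq_pow (m t : ℕ) : S m t = Complex.exp (2 * Real.pi * Complex.I / t) ^ m := by
  rw [S, mul_comm Complex.I, ← Complex.exp_mul_I, ← Complex.exp_nat_mul]
  congr 1
  ring

theorem S_zero (t : ℕ) : S 0 t = 1 := by rw [S_eq_pow, pow_zero]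

theorem S_ne_zero (m t : ℕ) : S m t ≠ 0 := by
  rw [S_eq_pow]
  exact pow_ne_zero _ (Complex.exp_ne_zero _)

theorem S_pow_self (m : ℕ) {t : ℕ} (ht : t ≠ 0) : S m t ^ t = 1 := by
  rw [S_eq_pow, pow_right_comm, (Complex.isPrimitiveRoot_exp t ht).pow_eq_one, one_pow]

theorem exists_eq_S {t : ℕ} (ht : t ≠ 0) {ω : ℂ} (hω : ω ^ t = 1) : ∃ m < t, S m t = ω := by
  have : NeZero t := ⟨ht⟩
  obtain ⟨m, hm, h⟩ := (Complex.isPrimitiveRoot_exp t ht).eq_pow_of_pow_eq_one hω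
  exact ⟨m, hm, by rw [S_eq_pow, h]⟩

variable {k : ℕ}

theorem WV_first {s j r : ℕ} {α : Fin k → ℂ} (h : Admissible k s j) :
    ∃ hs : s - 1 < k, WV k s j r α ⟨s - 1, hs⟩ = 1 := by
  obtain ⟨h1, h2, h3, h4⟩ := h
  refine ⟨by omega, ?_⟩
  rw [WV, if_pos (Or.inl (by change s - 1 + 1 = s; omega))]

theorem WV_second {s j r : ℕ} {α : Fin k → ℂ} (h : Admissible k s j) (hs : s + j - 1 < k) :
    WV k s j r α ⟨s + j - 1, hs⟩ = 1 := by
  obtain ⟨h1, h2, h3, h4⟩ := h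
  rw [WV, if_pos (Or.inr (by change s + j - 1 + 1 = s + j; omega))]

theorem WV_of_lt {s j r : ℕ} {α : Fin k → ℂ} {p : Fin k} (hj : 1 ≤ j) (hp : s + j < p.val + 1) :
    WV k s j r α p = S r j ^ (p.val + 1 - s) * α p := by
  rw [WV, if_neg (by omega), if_pos hp]

theorem WV_eq_zero {s j r : ℕ} {α : Fin k → ℂ} {p : Fin k} (hp : p.val + 1 < s + j)
    (hps : p.val + 1 ≠ s) : WV k s j r α p = 0 := by
  rw [WV, if_neg (by omega), if_neg (by omega)]

/-- If p₀ and q₀ are the first two support positions, a root t of t^{q₀-p₀} = β_{p₀}/β_{q₀}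
equalizes the two entries and c then makes both equal to 1. -/
theorem exists_WV_eq_scaling {β : Fin k → ℂ} (hβ : β ≠ 0) :
    ∃ s j α, Admissible k s j ∧ ∃ c t : ℂ, c ≠ 0 ∧ t ≠ 0 ∧
      ∀ p, WV k s j 0 α p = c * t ^ p.val * β p := by
  classical
  have hex : ∃ p : ℕ, ∃ h : p < k, β ⟨p, h⟩ ≠ 0 := by
    obtain ⟨p, hp⟩ := Function.ne_iff.1 hβ
    exact ⟨p.val, p.2, hp⟩
  obtain ⟨p₀, hmin, hp₀, hβ₀⟩ : ∃ p₀, (∀ p : Fin k, p.val < p₀ → β p = 0) ∧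
      ∃ h : p₀ < k, β ⟨p₀, h⟩ ≠ 0 := by
    refine ⟨Nat.find hex, fun p hp => ?_, Nat.find_spec hex⟩
    by_contra hne
    exact Nat.find_min hex hp ⟨p.2, hne⟩
  by_cases hex' : ∃ p : ℕ, ∃ h : p < k, p₀ < p ∧ β ⟨p, h⟩ ≠ 0
  · obtain ⟨q₀, hmin', hq₀, hlt, hβ'⟩ : ∃ q₀, (∀ p : Fin k, p₀ < p.val → p.val < q₀ → β p = 0) ∧
        ∃ h : q₀ < k, p₀ < q₀ ∧ β ⟨q₀, h⟩ ≠ 0 := by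
      refine ⟨Nat.find hex', fun p hp hp' => ?_, Nat.find_spec hex'⟩
      by_contra hne
      exact Nat.find_min hex' hp' ⟨p.2, hp, hne⟩
    obtain ⟨t, ht⟩ := IsAlgClosed.exists_pow_nat_eq (β ⟨p₀, hp₀⟩ / β ⟨q₀, hq₀⟩)
      (show 0 < q₀ - p₀ by omega)
    have ht0 : t ≠ 0 := by
      rintro rfl
      rw [zero_pow (by omega)] at ht
      exact div_ne_zero hβ₀ hβ' ht.symm
    refine ⟨p₀ + 1, q₀ - p₀, fun p => (t ^ p₀ * β ⟨p₀, hp₀⟩)⁻¹ * t ^ p.val * β p,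
      ⟨by omega, by omega, by omega, by omega⟩, (t ^ p₀ * β ⟨p₀, hp₀⟩)⁻¹, t,
      inv_ne_zero (mul_ne_zero (pow_ne_zero _ ht0) hβ₀), ht0, fun p => ?_⟩
    have htp : t ^ p₀ ≠ 0 := pow_ne_zero _ ht0
    rw [WV, S_zero, one_pow, one_mul]
    split_ifs with h1 h2
    · rcases h1 with h1 | h1
      · obtain rfl : p = ⟨p₀, hp₀⟩ := Fin.ext (by simpa using h1)
        field_simp
      · obtain rfl : p = ⟨q₀, hq₀⟩ := Fin.ext (by change p.val = q₀; omega)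
        change 1 = _ * t ^ q₀ * _
        have htq : t ^ q₀ = t ^ p₀ * (β ⟨p₀, hp₀⟩ / β ⟨q₀, hq₀⟩) := by
          rw [← ht, ← pow_add]
          congr 1
          omega
        rw [htq]
        field_simp
    · rfl
    · rcases lt_or_ge p.val p₀ with h3 | h3
      · rw [hmin p h3, mul_zero]
      · rw [hmin' p (by omega) (by omega), mul_zero]
  · push Not at hex'
    -- With a single nonzero entry, j is chosen so that s + j = k + 1 falls outside the vector.
    refine ⟨p₀ + 1, k - p₀, 0, ⟨by omega, by omega, by omega, by omega⟩, (β ⟨p₀, hp₀⟩)⁻¹, 1,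
      inv_ne_zero hβ₀, one_ne_zero, fun p => ?_⟩
    have hp := p.2
    rw [one_pow, mul_one]
    by_cases h1 : p.val = p₀
    · obtain rfl : p = ⟨p₀, hp₀⟩ := Fin.ext h1
      rw [WV, if_pos (Or.inl rfl), inv_mul_cancel₀ hβ₀]
    · rw [WV_eq_zero (by omega) (by omega)]
      rcases lt_or_gt_of_ne h1 with h3 | h3
      · rw [hmin p h3, mul_zero]
      · rw [hex' p.val p.2 h3, mul_zero]

theorem not_WV_scaling_zero {s j r : ℕ} {α : Fin k → ℂ} (h : Admissible k s j) {c t : ℂ}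
    (hc : c ≠ 0) (ht : t ≠ 0) : ¬ ∀ p, (0 : Fin k → ℂ) p = c * t ^ p.val * WV k s j r α p := by
  intro hall
  obtain ⟨hs, h1⟩ := WV_first (r := r) (α := α) h
  have := hall ⟨s - 1, hs⟩
  rw [h1, mul_one] at this
  exact mul_ne_zero hc (pow_ne_zero _ ht) this.symm

/-- The positions s and s + j are the first two of the support (the second may fall outside), so an
inclusion of supports compares them. -/
theorem WV_index_le {s j r s' j' r' : ℕ} {α α' : Fin k → ℂ} (h : Admissible k s j)
    (h' : Admissible k s' j') (hz : ∀ p, WV k s' j' r' α' p = 0 → WV k s j r α p = 0) :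
    s' ≤ s ∧ (s = s' → j' ≤ j) := by
  obtain ⟨hs, h1⟩ := WV_first (r := r) (α := α) h
  have hj1 := h.1
  have hj1' := h'.1
  have hs1 := h.2.2.1
  have hs1' := h'.2.2.2
  constructor
  · by_contra hlt
    have := hz ⟨s - 1, hs⟩ (WV_eq_zero (by change s - 1 + 1 < _; omega)
      (by change s - 1 + 1 ≠ _; omega))
    rw [h1] at this
    exact one_ne_zero this
  · rintro rfl
    by_contra hlt
    have hsj : s + j - 1 < k := by have := h'.2.1; omega
    have := hz ⟨s + j - 1, hsj⟩ (WV_eq_zero (by change s + j - 1 + 1 < _; omega)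
      (by change s + j - 1 + 1 ≠ _; omega))
    rw [WV_second h hsj] at this
    exact one_ne_zero this

/-- Scaling preserves the support and hence s and j. The unit entries at s and s + j force c t^{s-1}
= 1 and t^j = 1, so only a j-th root of unity can act on the remaining entries. -/
theorem WV_scaling_iff {s j r s' j' r' : ℕ} {α α' : Fin k → ℂ} (h : Admissible k s j)
    (h' : Admissible k s' j') :
    (∃ c t : ℂ, c ≠ 0 ∧ t ≠ 0 ∧ ∀ p, WV k s' j' r' α' p = c * t ^ p.val * WV k s j r α p) ↔
      s = s' ∧ j = j' ∧ ∃ t < j, ∀ p : Fin k, s + j < p.val + 1 →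
        α' p = S t j ^ (p.val + 1 - s) * α p := by
  constructor
  · rintro ⟨c, t, hc, ht, hall⟩
    have hct : ∀ p : Fin k, c * t ^ p.val ≠ 0 := fun p => mul_ne_zero hc (pow_ne_zero _ ht)
    have i1 := WV_index_le h h' (r := r) (r' := r') (α := α) (α' := α') fun p hp => by
      rw [hall p] at hp
      exact (mul_eq_zero.1 hp).resolve_left (hct p)
    have i2 := WV_index_le h' h (r := r') (r' := r) (α := α') (α' := α) fun p hp => by
      rw [hall p, hp, mul_zero]
    obtain rfl : s = s' := le_antisymm i2.1 i1.1
    obtain rfl : j = j' := le_antisymm (i2.2 rfl) (i1.2 rfl)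
    obtain ⟨hj, hjk, hs1, hsk⟩ := id h
    refine ⟨rfl, rfl, ?_⟩
    by_cases hsj : s + j - 1 < k
    · obtain ⟨hs, h1⟩ := WV_first (r := r) (α := α) h
      obtain ⟨_, h1'⟩ := WV_first (r := r') (α := α') h'
      have e1 := hall ⟨s - 1, hs⟩
      have e2 := hall ⟨s + j - 1, hsj⟩
      rw [h1, h1', mul_one] at e1
      rw [WV_second h hsj, WV_second h' hsj, mul_one] at e2
      change 1 = c * t ^ (s - 1) at e1
      change 1 = c * t ^ (s + j - 1) at e2
      have htj : t ^ j = 1 := by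
        rw [show s + j - 1 = (s - 1) + j by omega, pow_add, ← mul_assoc, ← e1, one_mul] at e2
        exact e2.symm
      -- Besides t, the roots of unity used to form the two vectors enter; the quotient absorbs all
      -- three.
      obtain ⟨m, hm, hS⟩ := exists_eq_S (t := j) (by omega) (ω := t * S r j / S r' j) (by
        rw [div_pow, mul_pow, htj, S_pow_self r (by omega), S_pow_self r' (by omega)]
        norm_num)
      refine ⟨m, hm, fun p hp => ?_⟩
      have e3 := hall p
      rw [WV_of_lt hj hp, WV_of_lt hj hp] at e3
      rw [hS, div_pow, mul_pow, div_mul_eq_mul_div, eq_div_iff (pow_ne_zero _ (S_ne_zero _ _)),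
        mul_comm, e3, show p.val = (s - 1) + (p.val + 1 - s) by omega, pow_add, ← mul_assoc c, ← e1,
        show s - 1 + (p.val + 1 - s) + 1 - s = p.val + 1 - s by omega]
      ring
    -- Here s + j = k + 1, so there are no free parameters and any root serves.
    · refine ⟨0, by omega, fun p hp => ?_⟩
      have := p.2
      omega
  · rintro ⟨rfl, rfl, m, hm, hα⟩
    obtain ⟨hj, hjk, hs1, hsk⟩ := id h
    set t : ℂ := S r' j * S m j / S r j with ht
    have ht0 : t ≠ 0 := div_ne_zero (mul_ne_zero (S_ne_zero _ _) (S_ne_zero _ _)) (S_ne_zero _ _)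
    have htj : t ^ j = 1 := by
      rw [ht, div_pow, mul_pow, S_pow_self _ (by omega), S_pow_self _ (by omega),
        S_pow_self _ (by omega)]
      norm_num
    refine ⟨(t ^ (s - 1))⁻¹, t, inv_ne_zero (pow_ne_zero _ ht0), ht0, fun p => ?_⟩
    have hts : t ^ (s - 1) ≠ 0 := pow_ne_zero _ ht0
    by_cases hp : s + j < p.val + 1
    · rw [WV_of_lt hj hp, WV_of_lt hj hp, hα p hp]
      have e : t ^ p.val = t ^ (s - 1) * t ^ (p.val + 1 - s) := by
        rw [← pow_add]; congr 1; omega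
      rw [e, inv_mul_cancel_left₀ hts, ← mul_assoc, ← mul_assoc, ← mul_pow, ← mul_pow, ht,
        div_mul_cancel₀ _ (S_ne_zero _ _)]
    · simp only [WV]
      split_ifs with h1
      · rcases h1 with h1 | h1
        · rw [show p.val = s - 1 by omega, inv_mul_cancel₀ hts, mul_one]
        · rw [show p.val = (s - 1) + j by omega, pow_add, htj, mul_one, mul_one,
            inv_mul_cancel₀ hts]
      · rw [mul_zero]

end LeibnizFamily

theorem theorem3p5 (n m : ℕ) (hn : 1 ≤ n) (hm : m = n + 2) :
    -- the listed superalgebras are of the kind that is classified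
    ((LeibnizFamily.algebra (n := n) 0).InClass n m ∧
      ∀ (s j r : ℕ) (α : Fin (LeibnizFamily.numParams n) → ℂ),
        LeibnizFamily.Admissible (LeibnizFamily.numParams n) s j → r < j →
        (LeibnizFamily.algebra (LeibnizFamily.WV (LeibnizFamily.numParams n) s j r α)).InClass n m) ∧
    -- every superalgebra of this kind is isomorphic to a listed one
    (∀ (L : Type*) [AddCommGroup L] [Module ℂ L] (A : Superalgebra L), A.InClass n m →
      (∃ (s j r : ℕ) (α : Fin (LeibnizFamily.numParams n) → ℂ),
        LeibnizFamily.Admissible (LeibnizFamily.numParams n) s j ∧ r < j ∧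
        A.Iso (LeibnizFamily.algebra (LeibnizFamily.WV (LeibnizFamily.numParams n) s j r α))) ∨
      A.Iso (LeibnizFamily.algebra (n := n) 0)) ∧
    -- no member of the families is isomorphic to `L(0, …, 0)`
    (∀ (s j r : ℕ) (α : Fin (LeibnizFamily.numParams n) → ℂ),
      LeibnizFamily.Admissible (LeibnizFamily.numParams n) s j → r < j →
      ¬ (LeibnizFamily.algebra (LeibnizFamily.WV (LeibnizFamily.numParams n) s j r α)).Iso
        (LeibnizFamily.algebra (n := n) 0)) ∧
    -- two members of the families are isomorphic only if they are the same entry of the list: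
    -- the parameters of an entry are taken up to the powers of the roots of unity `S_{t,j}`
    (∀ (s j r s' j' r' : ℕ) (α α' : Fin (LeibnizFamily.numParams n) → ℂ),
      LeibnizFamily.Admissible (LeibnizFamily.numParams n) s j → r < j →
      LeibnizFamily.Admissible (LeibnizFamily.numParams n) s' j' → r' < j' →
      ((LeibnizFamily.algebra (LeibnizFamily.WV (LeibnizFamily.numParams n) s j r α)).Iso
          (LeibnizFamily.algebra (LeibnizFamily.WV (LeibnizFamily.numParams n) s' j' r' α')) ↔
        s = s' ∧ j = j' ∧ ∃ t : ℕ, t < j ∧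
          ∀ p : Fin (LeibnizFamily.numParams n), s + j < p.val + 1 →
            α' p = LeibnizFamily.S t j ^ (p.val + 1 - s) * α p)) := by
  subst hm
  have hiff {β β' : Fin (LeibnizFamily.numParams n) → ℂ} :=
    LeibnizFamily.iso_iff_scaling (β := β) (β' := β') hn
  refine ⟨⟨LeibnizFamily.inClass 0 hn, fun s j r α _ _ => LeibnizFamily.inClass _ hn⟩, ?_, ?_, ?_⟩
  · intro L _ _ A hA
    obtain ⟨β, hβ⟩ := hA.exists_iso hn
    by_cases h0 : β = 0
    · exact Or.inr (h0 ▸ hβ.symm)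
    · obtain ⟨s, j, α, hadm, hW⟩ := LeibnizFamily.exists_WV_eq_scaling h0
      -- The root of unity with index 0 suffices, since α is arbitrary.
      exact Or.inl ⟨s, j, 0, α, hadm, hadm.1, hβ.symm.trans (hiff.2 hW)⟩
  · intro s j r α hadm _ hiso
    obtain ⟨c, t, hc, ht, hall⟩ := hiff.1 hiso
    exact LeibnizFamily.not_WV_scaling_zero hadm hc ht hall
  · intro s j r s' j' r' α α' hadm _ hadm' _
    exact hiff.trans (LeibnizFamily.WV_scaling_iff hadm hadm')
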